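/- Let $d\ge 1$ and $n\ge 2$ be integers, and let $\mathbb{T}^d=\mathbb{R}^d/\mathbb{Z}^d$. For a finite Borel measure $\mu$ on $\mathbb{T}^d$ and $\xi\in\mathbb{Z}^d$ let $\widehat\mu(\xi)=\int e^{-2\pi i\xi\cdot x}\,d\mu(x)$ and $\|\mu\|_{M(\lambda)}=\sup_{\xi\in\mathbb{Z}^d}|\widehat\mu(\xi)|\,|\xi|^{\lambda/2}$. The Fourier dimension of $\mu$ is the supremum of all $s\in[0,d]$ with $\|\mu\|_{M(s)}<\infty$; the Fourier dimension of a Borel set $E\subset\mathbb{T}^d$ is the supremum of the Fourier dimensions of the Borel probability measures $\mu$ with $\mathrm{supp}(\mu)\subset E$; and $E$ is a Salem set if its Fourier dimension equals its Hausdorff dimension. The lower Minkowski dimension of a compact set $K\subset\mathbb{T}^d$ is $\liminf_{r\to0^+}\,(d-\log_r|K_r|)$, where $|K_r|$ is the Lebesgue measure of the $r$-neighbourhood of $K$. For $\beta\in(0,d]$ let $\mathcal{X}_\beta$ be the space of all pairs $(E,\mu)$, where $E\subset\mathbb{T}^d$ is compact and $\mu$ is a Borel probability measure with $\mathrm{supp}(\mu)\subset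 E$ and $\|\mu\|_{M(\lambda)}<\infty$ for all $\lambda\in[0,\beta)$, with the product of the topology of the Hausdorff distance on the sets $E$ and the topology on the measures $\mu$ given by the seminorms $\|\cdot\|_{M(\lambda)}$, $\lambda\in[0,\beta)$. A property is generic in $\mathcal{X}_\beta$ if it holds on a comeager subset of $\mathcal{X}_\beta$. Theorem. Let $S\subset\mathbb{T}^d$ be a countable union of compact sets of lower Minkowski dimension zero. Then there is a compact Salem set $E\subset\mathbb{T}^d$ of Hausdorff dimension $d/(n-1)$ such that $$m_1x_1+\dots+m_nx_n\ne s$$ for all $s\in S$, all distinct $x_1,\dots,x_n\in E$ and all integers $m_1,\dots,m_n$ that are not all zero. Moreover, for every $\beta$ with $0<\beta\le d/(n-1)$, for generic $(E,\mu)\in\mathcal{X}_\beta$ the set $E$ is a Salem set of Hausdorff dimension $\beta$ with the same avoidance property. -/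

import Mathlib

open MeasureTheory Filter Topology Set TopologicalSpace
open scoped ENNReal NNReal UniformConvergence

/-- The torus `𝕋^d = ℝ^d / ℤ^d`. It carries the sup metric of the quotient metrics on `ℝ / ℤ`,
which is bi-Lipschitz equivalent to the Euclidean quotient metric: the Borel sets, the Hausdorff
and lower Minkowski dimensions and the topology of the Hausdorff distance are the same. -/
abbrev Torus (d : ℕ) : Type := UnitAddTorus (Fin d)

/-- Lower Minkowski dimension of `E ⊆ 𝕋^d`: the lower limit of `d - log_r |E_r|` as `r → 0⁺`, where
`|E_r|` is the Lebesgue measure of the open `r`-thickening of `E`. The logarithm takes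
values in the extended reals (`log 0 = -∞`), so the empty set has dimension `-∞`. -/
noncomputable def lowerMinkowskiDim {d : ℕ} (E : Set (Torus d)) : EReal :=
  liminf (fun r : ℝ => (d : EReal) -
    ENNReal.log (volume (Metric.thickening r E)) / ((Real.log r : ℝ) : EReal)) (𝓝[>] (0 : ℝ))

/-- The Euclidean length `|ξ|` of a frequency `ξ ∈ ℤ^d`. -/
noncomputable def freqNorm {d : ℕ} (ξ : Fin d → ℤ) : ℝ :=
  Real.sqrt (∑ i, (ξ i : ℝ) ^ 2)

/-- The Fourier coefficient `∫ exp (-2πi ξ · x) dμ(x)` of a measure on the torus. -/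
noncomputable def fourierMeasure {d : ℕ} (μ : Measure (Torus d)) (ξ : Fin d → ℤ) : ℂ :=
  ∫ x, UnitAddTorus.mFourier (-ξ) x ∂μ

/-- The weighted coefficient `|ξ|^(t/2) μ̂(ξ)`; the supremum over `ξ` of its modulus is the
seminorm `‖μ‖_{M(t)}`. -/
noncomputable def weightedFourier {d : ℕ} (t : ℝ) (μ : Measure (Torus d)) (ξ : Fin d → ℤ) : ℂ :=
  ((freqNorm ξ ^ (t / 2) : ℝ) : ℂ) * fourierMeasure μ ξ

/-- `‖μ‖_{M(t)} < ∞`. -/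
def HasFourierDecay {d : ℕ} (t : ℝ) (μ : Measure (Torus d)) : Prop :=
  BddAbove (range fun ξ : Fin d → ℤ => ‖weightedFourier t μ ξ‖)

/-- Fourier dimension of a finite Borel measure: the supremum of the `s ∈ [0, d]` with
`sup_ξ |μ̂(ξ)| |ξ|^(s/2) < ∞`. -/
noncomputable def fourierDimMeasure {d : ℕ} (μ : Measure (Torus d)) : ℝ≥0∞ :=
  ⨆ (s : ℝ≥0) (_ : (s : ℝ) ≤ d) (_ : HasFourierDecay (s : ℝ) μ), (s : ℝ≥0∞)

/-- Fourier dimension of a Borel set: the supremum of the Fourier dimensions of the Borel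
probability measures whose support is contained in the set. -/
noncomputable def fourierDim {d : ℕ} (E : Set (Torus d)) : ℝ≥0∞ :=
  ⨆ (μ : ProbabilityMeasure (Torus d)) (_ : (μ : Measure (Torus d)).support ⊆ E),
    fourierDimMeasure (μ : Measure (Torus d))

/-- A Salem set: the Fourier dimension agrees with the Hausdorff dimension. -/
def IsSalem {d : ℕ} (E : Set (Torus d)) : Prop :=
  fourierDim E = dimH E

/-- The space `𝒳_β` of pairs `(E, μ)`: `E` is a compact subset of `𝕋^d`, `μ` is a Borel probability
measure with `supp μ ⊆ E` (so that `E` is automatically nonempty), and `‖μ‖_{M(t)} < ∞` for every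
`t ∈ [0, β)`. -/
structure SupportPair (d : ℕ) (β : ℝ) where
  set : NonemptyCompacts (Torus d)
  measure : ProbabilityMeasure (Torus d)
  support_subset : (measure : Measure (Torus d)).support ⊆ (set : Set (Torus d))
  decay : ∀ t ∈ Ico (0 : ℝ) β, HasFourierDecay t (measure : Measure (Torus d))

/-- The topology of `𝒳_β`: the Hausdorff metric topology on the first component and the topology
of the seminorms `‖·‖_{M(t)}`, `t ∈ [0, β)`, on the second. Since `‖μ - ν‖_{M(t)}` is the sup
distance of the functions `ξ ↦ |ξ|^(t/2) μ̂(ξ)` and `ξ ↦ |ξ|^(t/2) ν̂(ξ)`, the latter is the topology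
of uniform convergence of these functions for each such `t`. -/
noncomputable instance (d : ℕ) (β : ℝ) : TopologicalSpace (SupportPair d β) :=
  TopologicalSpace.induced
    (fun p : SupportPair d β => ((p.set, fun t : Ico (0 : ℝ) β =>
      UniformFun.ofFun (weightedFourier (t : ℝ) (p.measure : Measure (Torus d)))) :
      NonemptyCompacts (Torus d) × (Ico (0 : ℝ) β → ((Fin d → ℤ) →ᵤ ℂ))))
    inferInstance

/-- `E` contains no distinct points `x₁, …, xₙ` with `m₁ x₁ + ⋯ + mₙ xₙ ∈ S` for some integers
`m₁, …, mₙ` that are not all zero. -/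
def AvoidsLinear {d : ℕ} (n : ℕ) (S E : Set (Torus d)) : Prop :=
  ∀ s ∈ S, ∀ x : Fin n → Torus d, Function.Injective x → (∀ i, x i ∈ E) →
    ∀ m : Fin n → ℤ, m ≠ 0 → ∑ i, m i • x i ≠ s

/-!
By the Baire category theorem in `𝒳_β` it suffices that, for each of countably many families `𝒰` of
open sets, the pairs `(E, μ)` with `E` contained in a member of `𝒰` are dense. The families are the
open sets with efficient coverings, which force `dim E ≤ β`, and, for a compact set `K`, the open
sets with no solution of `a x + ∑ⱼ wⱼ yⱼ ∈ K` such that `x` is close to a given point `c` and the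
`yⱼ` are not. Since the Fourier dimension never exceeds the Hausdorff dimension, `E` is then a Salem
set.

For the density, mollify `μ` to a measure with bounded density `f`, let `t < l < u < β`, and sample
`M ≈ r ^ (-u)` independent uniform points. Away from a ball around `c`, replace `f dx` by the
weighted empirical measure of the sample. Inside the ball, replace it by `f q dx`, where the weight
`q` vanishes on the bad set of all `x` that solve the equation, up to an error of order `r`, with
sample points as `yⱼ`. The bad set has small measure because the equation has at most `n - 1`
unknowns `yⱼ` and `(n - 1) u` is less than the codimension of `K`. The weight changes little with
each sample point, and normalising by the probability of being bad gives it mean close to `1`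
everywhere: the translation invariance of the sample makes this probability independent of `x` when
`∑ⱼ wⱼ ≠ 0`, and some coefficient `a` of a nonzero tuple can always be singled out so that
`∑ⱼ wⱼ ≠ 0` or `w = 0`. The bounded differences inequality then gives an error of at most
`r ^ (l / 2)` in all Fourier coefficients up to `|ξ| = r ^ (-3)`, and mollifying at scale `r`
restores the decay at the remaining frequencies without moving the support by more than `r`.
-/

instance torus_volume_isProbabilityMeasure (d : ℕ) :
    IsProbabilityMeasure (volume : Measure (Torus d)) := by
  have : IsProbabilityMeasure (volume : Measure UnitAddCircle) :=
    ⟨by rw [UnitAddCircle.measure_univ]⟩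
  exact inferInstanceAs
    (IsProbabilityMeasure (Measure.pi fun _ : Fin d => (volume : Measure UnitAddCircle)))

theorem torus_volume_closedBall {d : ℕ} (x : Torus d) {r : ℝ} (hr : 0 ≤ r) (hr' : r ≤ 1 / 2) :
    volume (Metric.closedBall x r) = ENNReal.ofReal ((2 * r) ^ d) := by
  rw [volume_pi, Measure.pi_closedBall _ _ hr]
  simp only [AddCircle.volume_closedBall]
  rw [min_eq_right (by linarith), Finset.prod_const, Finset.card_univ, Fintype.card_fin,
    ENNReal.ofReal_pow (by linarith)]

section Characters

variable {d : ℕ}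

theorem mFourier_apply_add (ξ : Fin d → ℤ) (x y : Torus d) :
    UnitAddTorus.mFourier ξ (x + y) = UnitAddTorus.mFourier ξ x * UnitAddTorus.mFourier ξ y := by
  simp only [UnitAddTorus.mFourier, ContinuousMap.coe_mk, Pi.add_apply, fourier_apply, smul_add,
    AddCircle.toCircle_add, Circle.coe_mul, Finset.prod_mul_distrib]

theorem norm_mFourier_apply (ξ : Fin d → ℤ) (x : Torus d) :
    ‖UnitAddTorus.mFourier ξ x‖ = 1 := by
  simp only [UnitAddTorus.mFourier, ContinuousMap.coe_mk, fourier_apply, norm_prod,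
    Circle.norm_coe, Finset.prod_const_one]

theorem integrable_mFourier (ξ : Fin d → ℤ) (μ : Measure (Torus d)) [IsFiniteMeasure μ] :
    Integrable (fun x => UnitAddTorus.mFourier ξ x) μ :=
  Integrable.of_bound (UnitAddTorus.mFourier ξ).continuous.aestronglyMeasurable 1
    (ae_of_all _ fun x => (norm_mFourier_apply ξ x).le)

theorem norm_fourierMeasure_le (μ : Measure (Torus d)) (ξ : Fin d → ℤ) :
    ‖fourierMeasure μ ξ‖ ≤ μ.real univ := by
  refine (norm_integral_le_integral_norm _).trans_eq ?_
  simp only [norm_mFourier_apply, integral_const, smul_eq_mul, mul_one]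

theorem norm_fourierMeasure_le_one (μ : Measure (Torus d)) [IsProbabilityMeasure μ]
    (ξ : Fin d → ℤ) : ‖fourierMeasure μ ξ‖ ≤ 1 := by
  simpa only [probReal_univ] using norm_fourierMeasure_le μ ξ

theorem fourierMeasure_zero_freq (μ : Measure (Torus d)) :
    fourierMeasure μ 0 = (μ.real univ : ℂ) := by
  simp [fourierMeasure, UnitAddTorus.mFourier_zero]

theorem fourierMeasure_conv (μ ν : Measure (Torus d)) [IsFiniteMeasure μ] [IsFiniteMeasure ν]
    (ξ : Fin d → ℤ) :
    fourierMeasure (μ ∗ ν) ξ = fourierMeasure μ ξ * fourierMeasure ν ξ := by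
  unfold fourierMeasure
  rw [integral_conv (integrable_mFourier _ _)]
  simp only [mFourier_apply_add, integral_const_mul, integral_mul_const]

theorem fourierMeasure_add (μ ν : Measure (Torus d)) [IsFiniteMeasure μ] [IsFiniteMeasure ν]
    (ξ : Fin d → ℤ) :
    fourierMeasure (μ + ν) ξ = fourierMeasure μ ξ + fourierMeasure ν ξ :=
  integral_add_measure (integrable_mFourier _ _) (integrable_mFourier _ _)

theorem fourierMeasure_smul (c : ℝ≥0∞) (μ : Measure (Torus d)) (ξ : Fin d → ℤ) :
    fourierMeasure (c • μ) ξ = (c.toReal : ℂ) * fourierMeasure μ ξ := by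
  unfold fourierMeasure
  rw [integral_smul_measure, Complex.real_smul]

end Characters

section FreqNorm

variable {d : ℕ}

theorem freqNorm_nonneg (ξ : Fin d → ℤ) : 0 ≤ freqNorm ξ := Real.sqrt_nonneg _

theorem freqNorm_zero : freqNorm (0 : Fin d → ℤ) = 0 := by simp [freqNorm]

theorem abs_le_freqNorm (ξ : Fin d → ℤ) (i : Fin d) : |(ξ i : ℝ)| ≤ freqNorm ξ := by
  rw [← Real.sqrt_sq_eq_abs]
  exact Real.sqrt_le_sqrt (Finset.single_le_sum (f := fun i => (ξ i : ℝ) ^ 2)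
    (fun _ _ => sq_nonneg _) (Finset.mem_univ i))

theorem one_le_freqNorm {ξ : Fin d → ℤ} (hξ : ξ ≠ 0) : 1 ≤ freqNorm ξ := by
  obtain ⟨i, hi⟩ := Function.ne_iff.mp hξ
  refine le_trans ?_ (abs_le_freqNorm ξ i)
  exact_mod_cast Int.one_le_abs hi

theorem exists_freqNorm_le_mul_abs {ξ : Fin d → ℤ} (hξ : ξ ≠ 0) :
    ∃ i, ξ i ≠ 0 ∧ freqNorm ξ ≤ d * |(ξ i : ℝ)| := by
  obtain ⟨j, hj⟩ := Function.ne_iff.mp hξ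
  obtain ⟨i, -, hi⟩ := Finset.exists_max_image Finset.univ (fun i => |(ξ i : ℝ)|)
    ⟨j, Finset.mem_univ j⟩
  have hd : (1 : ℝ) ≤ d := by exact_mod_cast Fin.pos j
  refine ⟨i, fun hi0 => hj ?_, Real.sqrt_le_iff.mpr ⟨by positivity, ?_⟩⟩
  · have hj0 := hi j (Finset.mem_univ _)
    simp only [hi0, Int.cast_zero, abs_zero] at hj0
    exact_mod_cast abs_nonpos_iff.mp hj0
  · calc ∑ k, (ξ k : ℝ) ^ 2 ≤ ∑ _k : Fin d, |(ξ i : ℝ)| ^ 2 :=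
          Finset.sum_le_sum fun k _ => sq_le_sq.mpr (by simpa using hi k (Finset.mem_univ _))
      _ = d * |(ξ i : ℝ)| ^ 2 := by simp
      _ ≤ (d * |(ξ i : ℝ)|) ^ 2 := by
          rw [mul_pow]; gcongr; nlinarith

/-- The box `{-N, …, N}^d` of frequencies. -/
noncomputable def freqBox (d N : ℕ) : Finset (Fin d → ℤ) :=
  Fintype.piFinset fun _ => Finset.Icc (-(N : ℤ)) N

theorem mem_freqBox {N : ℕ} {ξ : Fin d → ℤ} (hξ : freqNorm ξ ≤ N) : ξ ∈ freqBox d N := by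
  simp only [freqBox, Fintype.mem_piFinset, Finset.mem_Icc]
  intro i
  have := (abs_le_freqNorm ξ i).trans hξ
  exact abs_le.mp (by exact_mod_cast this)

theorem card_freqBox (d N : ℕ) : (freqBox d N).card = (2 * N + 1) ^ d := by
  simp only [freqBox, Fintype.card_piFinset, Int.card_Icc, Finset.prod_const, Finset.card_univ,
    Fintype.card_fin]
  congr 1
  omega

end FreqNorm

section Convolution

variable {G : Type*} [AddGroup G] [MeasurableSpace G] [MeasurableAdd₂ G]

theorem conv_apply_eq_lintegral (μ ν : Measure G) [SFinite ν] {A : Set G}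
    (hA : MeasurableSet A) : (μ ∗ ν) A = ∫⁻ x, ν ((x + ·) ⁻¹' A) ∂μ := by
  rw [← lintegral_indicator_one hA, Measure.lintegral_conv (measurable_one.indicator hA)]
  refine lintegral_congr fun x => ?_
  rw [← lintegral_indicator_one (measurable_const_add x hA)]
  rfl

theorem conv_apply_compl_eq_zero {μ ν : Measure G} [SFinite ν] {A B Z : Set G}
    (hZ : MeasurableSet Z) (hA : μ Aᶜ = 0) (hB : ν Bᶜ = 0) (hAB : ∀ x ∈ A, ∀ y ∈ B, x + y ∈ Z) :
    (μ ∗ ν) Zᶜ = 0 := by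
  rw [conv_apply_eq_lintegral _ _ hZ.compl]
  refine (lintegral_congr_ae ?_).trans lintegral_zero
  filter_upwards [show ∀ᵐ x ∂μ, x ∈ A from hA] with x hx
  exact measure_mono_null (fun y hy hyB => hy (hAB x hx y hyB)) hB

theorem le_conv_apply {μ ν : Measure G} [IsProbabilityMeasure ν] {A B Z : Set G}
    (hZ : MeasurableSet Z) (hA : MeasurableSet A) (hB : ν Bᶜ = 0)
    (hAB : ∀ x ∈ A, ∀ y ∈ B, x + y ∈ Z) : μ A ≤ (μ ∗ ν) Z := by
  rw [conv_apply_eq_lintegral _ _ hZ, ← lintegral_indicator_one hA]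
  refine lintegral_mono (indicator_le fun x hx => ?_)
  refine ((prob_compl_eq_zero_iff (measurable_const_add x hZ)).mp ?_).ge
  exact measure_mono_null (fun y hy hyB => hy (hAB x hx y hyB)) hB

theorem conv_le_smul_of_le {μ ν κ : Measure G} [IsProbabilityMeasure μ] [SFinite ν]
    [κ.IsAddLeftInvariant] {c : ℝ≥0∞} (hν : ν ≤ c • κ) : μ ∗ ν ≤ c • κ := by
  refine Measure.le_iff.mpr fun A hA => ?_
  rw [conv_apply_eq_lintegral _ _ hA]
  calc ∫⁻ x, ν ((x + ·) ⁻¹' A) ∂μ ≤ ∫⁻ _x, (c • κ) A ∂μ := by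
        refine lintegral_mono fun x => (hν _).trans_eq ?_
        simp only [Measure.smul_apply, measure_preimage_add]
    _ = (c • κ) A := by simp

end Convolution

section ConvolutionNormed

variable {G : Type*} [SeminormedAddCommGroup G] [MeasurableSpace G] [BorelSpace G]
  [MeasurableAdd₂ G]

theorem conv_compl_cthickening_eq_zero {μ φ : Measure G} [SFinite φ] {K : Set G} {r : ℝ}
    (hμ : μ Kᶜ = 0) (hφ : φ (Metric.closedBall 0 r)ᶜ = 0) :
    (μ ∗ φ) (Metric.cthickening r K)ᶜ = 0 := by
  refine conv_apply_compl_eq_zero Metric.isClosed_cthickening.measurableSet hμ hφ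
    fun x hx y hy => Metric.mem_cthickening_of_dist_le _ x _ _ hx ?_
  simpa using hy

theorem measure_closedBall_le_conv {μ φ : Measure G} [IsProbabilityMeasure φ] {r : ℝ}
    (hφ : φ (Metric.closedBall 0 r)ᶜ = 0) (y : G) (s : ℝ) :
    μ (Metric.closedBall y s) ≤ (μ ∗ φ) (Metric.closedBall y (r + s)) := by
  refine le_conv_apply Metric.isClosed_closedBall.measurableSet
    Metric.isClosed_closedBall.measurableSet hφ fun x hx z hz => ?_
  rw [mem_closedBall_iff_norm] at hx ⊢
  rw [mem_closedBall_zero_iff] at hz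
  calc ‖x + z - y‖ = ‖z + (x - y)‖ := by congr 1; abel
    _ ≤ r + s := norm_add_le_of_le hz hx

end ConvolutionNormed

section UniformBall

variable {d : ℕ}

theorem exists_translate_mFourier_eq_neg_one {ξ : Fin d → ℤ} {i : Fin d} (hi : ξ i ≠ 0) :
    ∃ v : Torus d, ‖v‖ ≤ 1 / (2 * |(ξ i : ℝ)|) ∧ UnitAddTorus.mFourier (-ξ) v = -1 := by
  refine ⟨Pi.single i ((1 / (2 * (ξ i : ℝ)) : ℝ) : UnitAddCircle), ?_, ?_⟩
  · rw [Pi.norm_single]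
    refine UnitAddCircle.norm_eq.le.trans ((round_le _ 0).trans_eq ?_)
    simp [abs_mul]
  · simp only [UnitAddTorus.mFourier, ContinuousMap.coe_mk]
    rw [Finset.prod_eq_single i _ (by simp), Pi.single_eq_same, fourier_coe_apply,
      ← Complex.exp_neg_pi_mul_I]
    · congr 1
      have : (ξ i : ℂ) ≠ 0 := by exact_mod_cast hi
      simp
      field_simp
    · intro j _ hj
      rw [Pi.single_eq_of_ne hj]; simp

theorem norm_setIntegral_le_of_add_left_eq_neg {G E : Type*} [AddGroup G] [MeasurableSpace G]
    [MeasurableAdd G] [NormedAddCommGroup E] [NormedSpace ℝ E] {μ : Measure G}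
    [μ.IsAddLeftInvariant] [IsFiniteMeasure μ] {e : G → E} (he : Integrable e μ)
    (he_le : ∀ x, ‖e x‖ ≤ 1) {v : G} (hv : ∀ x, e (v + x) = -e x) {B : Set G}
    (hB : MeasurableSet B) :
    ‖∫ x in B, e x ∂μ‖ ≤ μ.real (B \ (v + ·) ⁻¹' B) := by
  set V := (v + ·) ⁻¹' B
  have hV : MeasurableSet V := measurable_const_add v hB
  have hneg : ∫ x in V, e x ∂μ = -∫ x in B, e x ∂μ := by
    have hshift := (measurePreserving_add_left μ v).setIntegral_preimage_emb
      (measurableEmbedding_addLeft v) e B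
    simp only [hv, integral_neg] at hshift
    exact neg_eq_iff_eq_neg.mp hshift
  have hdouble : (2 : ℝ) • ∫ x in B, e x ∂μ = ∫ x in B \ V, e x ∂μ - ∫ x in V \ B, e x ∂μ := by
    have hsplitB := integral_inter_add_sdiff hV he.integrableOn (s := B)
    have hsplitV := integral_inter_add_sdiff hB he.integrableOn (s := V)
    rw [inter_comm] at hsplitV
    rw [eq_sub_of_add_eq' hsplitB, eq_sub_of_add_eq' hsplitV, hneg, two_smul]
    abel
  have hle (A : Set G) : ‖∫ x in A, e x ∂μ‖ ≤ μ.real A := by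
    simpa using norm_setIntegral_le_of_norm_le_const (measure_lt_top μ A) fun x _ => he_le x
  have hsymm : μ.real (V \ B) = μ.real (B \ V) := by
    have hVB : μ.real V = μ.real B := by simp only [V, Measure.real, measure_preimage_add]
    have hsplitB := measureReal_sdiff_add_inter (μ := μ) (s := B) hV
    have hsplitV := measureReal_sdiff_add_inter (μ := μ) (s := V) hB
    rw [inter_comm] at hsplitV
    linarith
  have h2 : 2 * ‖∫ x in B, e x ∂μ‖ ≤ μ.real (B \ V) + μ.real (V \ B) := by
    rw [← Real.norm_of_nonneg zero_le_two, ← norm_smul, hdouble]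
    exact norm_sub_le_of_le (hle _) (hle _)
  linarith

/-- The uniform probability measure on the closed ball of radius `δ` around `0`; its convolution
powers are the mollifiers. -/
noncomputable def uniformBall (d : ℕ) (δ : ℝ) : Measure (Torus d) :=
  ProbabilityTheory.cond volume (Metric.closedBall 0 δ)

theorem volume_closedBall_pos (x : Torus d) {δ : ℝ} (hδ : 0 < δ) :
    volume (Metric.closedBall x δ) ≠ 0 :=
  (Metric.measure_closedBall_pos volume x hδ).ne'

theorem uniformBall_isProbabilityMeasure {δ : ℝ} (hδ : 0 < δ) :
    IsProbabilityMeasure (uniformBall d δ) :=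
  ProbabilityTheory.cond_isProbabilityMeasure (volume_closedBall_pos 0 hδ)

theorem uniformBall_compl (δ : ℝ) : uniformBall d δ (Metric.closedBall 0 δ)ᶜ = 0 := by
  rw [uniformBall, ProbabilityTheory.cond_apply Metric.isClosed_closedBall.measurableSet,
    inter_compl_self, measure_empty, mul_zero]

theorem uniformBall_le (δ : ℝ) :
    uniformBall d δ ≤ (volume (Metric.closedBall (0 : Torus d) δ))⁻¹ • volume := by
  unfold uniformBall ProbabilityTheory.cond
  gcongr
  exact Measure.restrict_le_self

theorem volume_real_closedBall_sdiff_closedBall_le {δ w : ℝ} (hδ' : δ ≤ 1 / 2)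
    (hw : 0 ≤ w) (hwδ : w ≤ δ) :
    (volume : Measure (Torus d)).real (Metric.closedBall 0 δ \ Metric.closedBall 0 (δ - w)) *
      δ ≤ (2 * δ) ^ d * (d * w) := by
  have hδ : 0 ≤ δ := hw.trans hwδ
  have hball {s : ℝ} (hs : 0 ≤ s) (hs' : s ≤ 1 / 2) :
      (volume : Measure (Torus d)).real (Metric.closedBall 0 s) = (2 * s) ^ d := by
    rw [Measure.real, torus_volume_closedBall _ hs hs', ENNReal.toReal_ofReal (by positivity)]
  rw [measureReal_sdiff (Metric.closedBall_subset_closedBall (by linarith))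
    Metric.isClosed_closedBall.measurableSet, hball hδ hδ',
    hball (sub_nonneg.mpr hwδ) (by linarith)]
  rcases hδ.eq_or_lt with rfl | hδ
  · rw [mul_zero]; positivity
  have hbernoulli : 1 + d * (-(w / δ)) ≤ (1 + -(w / δ)) ^ d := by
    refine one_add_mul_le_pow ?_ d
    linarith [(div_le_one hδ).mpr hwδ]
  have hscale : (2 * (δ - w)) ^ d = (2 * δ) ^ d * (1 + -(w / δ)) ^ d := by
    rw [← mul_pow]; congr 1; field_simp; ring
  calc ((2 * δ) ^ d - (2 * (δ - w)) ^ d) * δ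
      ≤ ((2 * δ) ^ d - (2 * δ) ^ d * (1 + d * (-(w / δ)))) * δ := by rw [hscale]; gcongr
    _ = (2 * δ) ^ d * (d * w) := by field_simp; ring

theorem norm_fourierMeasure_uniformBall_le_of_mFourier_eq_neg_one {δ : ℝ} (hδ : 0 < δ)
    (hδ' : δ ≤ 1 / 2) {ξ : Fin d → ℤ} {v : Torus d} (hvδ : ‖v‖ ≤ δ)
    (hv : UnitAddTorus.mFourier (-ξ) v = -1) :
    ‖fourierMeasure (uniformBall d δ) ξ‖ ≤ d * ‖v‖ / δ := by
  set B := Metric.closedBall (0 : Torus d) δ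
  have hshell : B \ (v + ·) ⁻¹' B ⊆ B \ Metric.closedBall 0 (δ - ‖v‖) := by
    refine sdiff_subset_sdiff_right fun x hx => ?_
    rw [mem_closedBall_zero_iff] at hx
    rw [mem_preimage, mem_closedBall_zero_iff]
    exact (norm_add_le v x).trans (by linarith)
  have hint : ‖∫ x in B, UnitAddTorus.mFourier (-ξ) x‖ * δ ≤ (2 * δ) ^ d * (d * ‖v‖) := by
    refine le_trans ?_ (volume_real_closedBall_sdiff_closedBall_le hδ' (norm_nonneg v) hvδ)
    gcongr
    refine (norm_setIntegral_le_of_add_left_eq_neg (integrable_mFourier _ _)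
      (fun x => (norm_mFourier_apply _ x).le) (v := v) (fun x => ?_)
      Metric.isClosed_closedBall.measurableSet).trans (measureReal_mono hshell)
    rw [mFourier_apply_add, hv, neg_one_mul]
  have hnorm : ‖fourierMeasure (uniformBall d δ) ξ‖ =
      ((2 * δ) ^ d)⁻¹ * ‖∫ x in B, UnitAddTorus.mFourier (-ξ) x‖ := by
    rw [uniformBall, ProbabilityTheory.cond, fourierMeasure_smul, norm_mul, Complex.norm_real,
      torus_volume_closedBall _ hδ.le hδ', ENNReal.toReal_inv,
      ENNReal.toReal_ofReal (by positivity), Real.norm_of_nonneg (by positivity)]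
    rfl
  rw [hnorm, le_div_iff₀ hδ, mul_assoc, inv_mul_le_iff₀ (by positivity)]
  exact hint

theorem norm_fourierMeasure_uniformBall_le {δ : ℝ} (hδ : 0 < δ) (hδ' : δ ≤ 1 / 2) {ξ : Fin d → ℤ}
    (hξ : ξ ≠ 0) :
    ‖fourierMeasure (uniformBall d δ) ξ‖ ≤ (d : ℝ) ^ 2 / (δ * freqNorm ξ) := by
  obtain ⟨i, hi, hξi⟩ := exists_freqNorm_le_mul_abs hξ
  obtain ⟨v, hv, hv_neg⟩ := exists_translate_mFourier_eq_neg_one hi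
  have hξ_pos : 0 < freqNorm ξ := zero_lt_one.trans_le (one_le_freqNorm hξ)
  have hd : (1 : ℝ) ≤ d := by exact_mod_cast Fin.pos i
  have hv_le : ‖v‖ ≤ d / freqNorm ξ := hv.trans <| by
    rw [div_le_div_iff₀ (by positivity) hξ_pos]; nlinarith
  calc ‖fourierMeasure (uniformBall d δ) ξ‖ ≤ d * ‖v‖ / δ := by
        rcases le_total ‖v‖ δ with hvδ | hδv
        · exact norm_fourierMeasure_uniformBall_le_of_mFourier_eq_neg_one hδ hδ' hvδ hv_neg
        · have := uniformBall_isProbabilityMeasure (d := d) hδ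
          refine (norm_fourierMeasure_le_one _ _).trans ((one_le_div hδ).mpr ?_)
          nlinarith
    _ ≤ d * (d / freqNorm ξ) / δ := by gcongr
    _ = (d : ℝ) ^ 2 / (δ * freqNorm ξ) := by field_simp

end UniformBall

section Mollifier

variable {d : ℕ}

/-- The `k`-fold convolution power of the uniform measure on the closed ball of radius `δ`. -/
noncomputable def uniformBallPow (d : ℕ) (δ : ℝ) : ℕ → Measure (Torus d)
  | 0 => Measure.dirac 0
  | k + 1 => uniformBallPow d δ k ∗ uniformBall d δ

theorem uniformBallPow_isProbabilityMeasure {δ : ℝ} (hδ : 0 < δ) (k : ℕ) :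
    IsProbabilityMeasure (uniformBallPow d δ k) := by
  have := uniformBall_isProbabilityMeasure (d := d) hδ
  induction k with
  | zero => exact Measure.dirac.isProbabilityMeasure
  | succ k ih =>
    exact inferInstanceAs (IsProbabilityMeasure (uniformBallPow d δ k ∗ uniformBall d δ))

theorem uniformBallPow_compl {δ : ℝ} (hδ : 0 < δ) (k : ℕ) :
    uniformBallPow d δ k (Metric.closedBall 0 (k * δ))ᶜ = 0 := by
  have := uniformBall_isProbabilityMeasure (d := d) hδ
  induction k with
  | zero =>
    rw [uniformBallPow, Measure.dirac_apply' _ Metric.isClosed_closedBall.measurableSet.compl]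
    simp
  | succ k ih =>
    refine conv_apply_compl_eq_zero Metric.isClosed_closedBall.measurableSet ih
      (uniformBall_compl δ) fun x hx y hy => ?_
    rw [mem_closedBall_zero_iff] at *
    calc ‖x + y‖ ≤ k * δ + δ := norm_add_le_of_le hx hy
      _ = (k + 1 : ℕ) * δ := by push_cast; ring

theorem norm_fourierMeasure_uniformBallPow_le {δ : ℝ} (hδ : 0 < δ) (hδ' : δ ≤ 1 / 2)
    {ξ : Fin d → ℤ} (hξ : ξ ≠ 0) (k : ℕ) :
    ‖fourierMeasure (uniformBallPow d δ k) ξ‖ ≤ ((d : ℝ) ^ 2 / (δ * freqNorm ξ)) ^ k := by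
  have := uniformBall_isProbabilityMeasure (d := d) hδ
  have (k : ℕ) := uniformBallPow_isProbabilityMeasure (d := d) hδ k
  induction k with
  | zero => simpa using norm_fourierMeasure_le_one (uniformBallPow d δ 0) ξ
  | succ k ih =>
    rw [uniformBallPow, fourierMeasure_conv, norm_mul, pow_succ]
    exact mul_le_mul ih (norm_fourierMeasure_uniformBall_le hδ hδ' hξ) (norm_nonneg _)
      ((norm_nonneg _).trans ih)

/-- A mollifier at scale `r`: a probability measure on the ball of radius `r` around `0` with
`|φ̂(ξ)| ≤ (C / (r |ξ|))^d`, so that convolving with `φ` gains `d` powers of `|ξ|`. -/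
structure IsMollifier (C r : ℝ) (φ : Measure (Torus d)) : Prop where
  isProbabilityMeasure : IsProbabilityMeasure φ
  measure_compl_closedBall : φ (Metric.closedBall 0 r)ᶜ = 0
  norm_fourierMeasure_le : ∀ ξ : Fin d → ℤ, ξ ≠ 0 →
    ‖fourierMeasure φ ξ‖ ≤ (C / (r * freqNorm ξ)) ^ d

theorem exists_mollifier (hd : 1 ≤ d) : ∃ C : ℝ, 1 ≤ C ∧ ∀ r : ℝ, 0 < r → r ≤ 1 / 2 →
    ∃ φ : Measure (Torus d), IsMollifier C r φ ∧ ∃ L : ℝ≥0, φ ≤ (L : ℝ≥0∞) • volume := by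
  have hd' : (1 : ℝ) ≤ d := by exact_mod_cast hd
  refine ⟨(d : ℝ) ^ 3, one_le_pow₀ hd', fun r hr hr' => ?_⟩
  have hδ : 0 < r / d := by positivity
  have hδ' : r / d ≤ 1 / 2 := (div_le_self hr.le hd').trans hr'
  have := uniformBall_isProbabilityMeasure (d := d) hδ
  refine ⟨uniformBallPow d (r / d) d,
    ⟨uniformBallPow_isProbabilityMeasure hδ d, ?_, fun ξ hξ => ?_⟩,
    (volume (Metric.closedBall (0 : Torus d) (r / d)))⁻¹.toNNReal, ?_⟩
  · simpa only [mul_div_cancel₀ r (by positivity : (d : ℝ) ≠ 0)]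
      using uniformBallPow_compl (d := d) hδ d
  · refine (norm_fourierMeasure_uniformBallPow_le hδ hδ' hξ d).trans_eq ?_
    congr 1
    field_simp
  · rw [ENNReal.coe_toNNReal (ENNReal.inv_ne_top.mpr (volume_closedBall_pos 0 hδ))]
    obtain ⟨k, rfl⟩ := Nat.exists_eq_add_of_le' hd
    have := uniformBallPow_isProbabilityMeasure (d := k + 1) hδ k
    exact conv_le_smul_of_le (uniformBall_le _)

end Mollifier

section CharacterBound

variable {d : ℕ}

theorem norm_fourier_sub_one_le (n : ℤ) (x : UnitAddCircle) :
    ‖(fourier n x : ℂ) - 1‖ ≤ 2 * Real.pi * |(n : ℝ)| * ‖x‖ := by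
  obtain ⟨a, rfl⟩ := QuotientAddGroup.mk_surjective x
  change ‖(fourier n (a : UnitAddCircle) : ℂ) - 1‖ ≤
    2 * Real.pi * |(n : ℝ)| * ‖(a : UnitAddCircle)‖
  have hround : ((a - round a : ℝ) : UnitAddCircle) = (a : UnitAddCircle) := by
    rw [AddCircle.coe_sub, sub_eq_self, AddCircle.coe_eq_zero_iff]
    exact ⟨round a, by simp⟩
  rw [UnitAddCircle.norm_eq, ← hround, fourier_coe_apply]
  have hexp := Real.norm_exp_I_mul_ofReal_sub_one_le (x := 2 * Real.pi * n * (a - round a))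
  rw [Real.norm_eq_abs, abs_mul, abs_mul, abs_of_pos (by positivity : 0 < 2 * Real.pi)] at hexp
  convert hexp using 4
  push_cast
  ring

theorem norm_prod_sub_one_le_sum {ι R : Type*} [NormedCommRing R] [NormMulClass R]
    (s : Finset ι) (z : ι → R) (hz : ∀ i, ‖z i‖ = 1) :
    ‖∏ i ∈ s, z i - 1‖ ≤ ∑ i ∈ s, ‖z i - 1‖ := by
  classical
  induction s using Finset.induction_on with
  | empty => simp
  | insert i s hi ih =>
    rw [Finset.prod_insert hi, Finset.sum_insert hi]
    calc ‖z i * ∏ j ∈ s, z j - 1‖ = ‖(z i - 1) + z i * (∏ j ∈ s, z j - 1)‖ := by ring_nf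
      _ ≤ ‖z i - 1‖ + ‖z i * (∏ j ∈ s, z j - 1)‖ := norm_add_le _ _
      _ ≤ _ := by rw [norm_mul, hz, one_mul]; gcongr

theorem norm_mFourier_sub_one_le (ξ : Fin d → ℤ) (x : Torus d) :
    ‖UnitAddTorus.mFourier ξ x - 1‖ ≤ 2 * Real.pi * (∑ i, |(ξ i : ℝ)|) * ‖x‖ := by
  simp only [UnitAddTorus.mFourier, ContinuousMap.coe_mk]
  refine (norm_prod_sub_one_le_sum _ _ fun i => by rw [fourier_apply, Circle.norm_coe]).trans ?_
  rw [Finset.mul_sum, Finset.sum_mul]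
  exact Finset.sum_le_sum fun i _ => (norm_fourier_sub_one_le _ _).trans
    (by gcongr; exact norm_le_pi_norm x i)

end CharacterBound

section LatticeSums

theorem rpow_neg_le_sub {a : ℝ} (ha : 0 ≤ a) (ha' : a < 1) (N : ℕ) :
    ((N : ℝ) + 1) ^ (-a) ≤ (1 - a)⁻¹ * (((N : ℝ) + 1) ^ (1 - a) - (N : ℝ) ^ (1 - a)) := by
  have hN : (0 : ℝ) < N + 1 := by positivity
  have hbernoulli : ((N : ℝ) / (N + 1)) ^ (1 - a) ≤ 1 + (1 - a) * (-1 / (N + 1)) := by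
    rw [show (N : ℝ) / (N + 1) = 1 + -1 / (N + 1) by field_simp; ring]
    refine rpow_one_add_le_one_add_mul_self ?_ (by linarith) (by linarith)
    rw [le_div_iff₀ hN]
    linarith [(Nat.cast_nonneg N : (0 : ℝ) ≤ N)]
  have hsplit : ((N : ℝ) + 1) ^ (1 - a) = (N + 1) * ((N : ℝ) + 1) ^ (-a) := by
    rw [sub_eq_add_neg, Real.rpow_add hN, Real.rpow_one]
  rw [Real.div_rpow (Nat.cast_nonneg _) hN.le, div_le_iff₀ (by positivity)] at hbernoulli
  rw [inv_mul_eq_div, le_div_iff₀ (by linarith)]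
  calc ((N : ℝ) + 1) ^ (-a) * (1 - a)
      = ((N : ℝ) + 1) ^ (1 - a) - (1 + (1 - a) * (-1 / (N + 1))) * ((N : ℝ) + 1) ^ (1 - a) := by
        rw [hsplit]; field_simp; ring
    _ ≤ _ := sub_le_sub_left hbernoulli _

theorem sum_range_rpow_neg_le {a : ℝ} (ha : 0 ≤ a) (ha' : a < 1) (N : ℕ) :
    ∑ n ∈ Finset.range N, ((n : ℝ) + 1) ^ (-a) ≤ (1 - a)⁻¹ * (N : ℝ) ^ (1 - a) := by
  refine (Finset.sum_le_sum fun n _ => rpow_neg_le_sub ha ha' n).trans_eq ?_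
  rw [← Finset.mul_sum]
  congr 1
  have htelescope := Finset.sum_range_sub (fun n : ℕ => (n : ℝ) ^ (1 - a)) N
  push_cast at htelescope
  rw [htelescope, Real.zero_rpow (by linarith), sub_zero]

/-- The weight `max(1, |j|)^{-a}`. Products of these over the coordinates dominate the radial
weights `|ξ|^{-t}` and are summed one coordinate at a time. -/
noncomputable def latticeWeight (a : ℝ) (j : ℤ) : ℝ := (max 1 |(j : ℝ)|) ^ (-a)

theorem latticeWeight_nonneg (a : ℝ) (j : ℤ) : 0 ≤ latticeWeight a j := by
  unfold latticeWeight; positivity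

theorem latticeWeight_zero (a : ℝ) : latticeWeight a 0 = 1 := by simp [latticeWeight]

theorem latticeWeight_natCast_succ (a : ℝ) (n : ℕ) :
    latticeWeight a (n + 1 : ℕ) = ((n : ℝ) + 1) ^ (-a) := by
  rw [latticeWeight]
  push_cast
  rw [abs_of_nonneg (by positivity), max_eq_right (by linarith)]

theorem latticeWeight_even (a : ℝ) : Function.Even (latticeWeight a) := fun j => by
  simp [latticeWeight]

theorem sum_latticeWeight_le {a : ℝ} (ha : 0 ≤ a) (ha' : a < 1) {N : ℕ} (hN : 1 ≤ N) :
    ∑ j ∈ Finset.Icc (-(N : ℤ)) N, latticeWeight a j ≤ 3 * (1 - a)⁻¹ * (N : ℝ) ^ (1 - a) := by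
  have hinv : 1 ≤ (1 - a)⁻¹ := (one_le_inv₀ (by linarith)).mpr (by linarith)
  have hpow : 1 ≤ (N : ℝ) ^ (1 - a) :=
    Real.one_le_rpow (by exact_mod_cast hN) (by linarith)
  rw [Finset.sum_Icc_of_even_eq_range (latticeWeight_even a), Finset.sum_range_succ']
  simp only [latticeWeight_natCast_succ, Nat.cast_zero, latticeWeight_zero, two_nsmul]
  have hsum := sum_range_rpow_neg_le ha ha' N
  nlinarith

theorem sum_freqBox_prod_latticeWeight_le {d : ℕ} {a : ℝ} (ha : 0 ≤ a) (ha' : a < 1) {N : ℕ}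
    (hN : 1 ≤ N) :
    ∑ ξ ∈ freqBox d N, ∏ i, latticeWeight a (ξ i) ≤
      (3 * (1 - a)⁻¹ * (N : ℝ) ^ (1 - a)) ^ d := by
  rw [freqBox, ← Finset.prod_univ_sum, Finset.prod_const, Finset.card_univ, Fintype.card_fin]
  exact pow_le_pow_left₀ (Finset.sum_nonneg fun _ _ => latticeWeight_nonneg _ _)
    (sum_latticeWeight_le ha ha' hN) d

theorem freqNorm_rpow_neg_le {d : ℕ} {t : ℝ} (ht : 0 ≤ t) (hd : 1 ≤ d) {ξ : Fin d → ℤ}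
    (hξ : ξ ≠ 0) : freqNorm ξ ^ (-t) ≤ ∏ i, latticeWeight (t / d) (ξ i) := by
  have hξ1 := one_le_freqNorm hξ
  calc freqNorm ξ ^ (-t) = ∏ _i : Fin d, freqNorm ξ ^ (-(t / d)) := by
        rw [Finset.prod_const, Finset.card_univ, Fintype.card_fin, ← Real.rpow_natCast,
          ← Real.rpow_mul (by linarith)]
        congr 1
        field_simp
    _ ≤ _ := Finset.prod_le_prod (fun _ _ => by positivity) fun i _ =>
        Real.rpow_le_rpow_of_nonpos (by positivity) (max_le hξ1 (abs_le_freqNorm ξ i))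
          (by rw [neg_nonpos]; positivity)

/-- The cube `{0, …, N - 1}^d` of frequencies. -/
noncomputable def freqCube (d N : ℕ) : Finset (Fin d → ℤ) :=
  Fintype.piFinset fun _ => Finset.Ico (0 : ℤ) N

theorem card_freqCube (d N : ℕ) : (freqCube d N).card = N ^ d := by
  simp [freqCube, Fintype.card_piFinset]

theorem sum_freqCube_sub_le_sum_freqBox {d N : ℕ} {f : (Fin d → ℤ) → ℝ} (hf : ∀ ξ, 0 ≤ f ξ)
    {k : Fin d → ℤ} (hk : k ∈ freqCube d N) :
    ∑ l ∈ freqCube d N, f (k - l) ≤ ∑ ξ ∈ freqBox d N, f ξ := by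
  rw [← Finset.sum_image (f := f) (sub_right_injective.injOn)]
  refine Finset.sum_le_sum_of_subset_of_nonneg (fun ξ hξ => ?_) fun ξ _ _ => hf ξ
  obtain ⟨l, hl, rfl⟩ := Finset.mem_image.mp hξ
  simp only [freqCube, freqBox, Fintype.mem_piFinset, Finset.mem_Ico, Finset.mem_Icc,
    Pi.sub_apply] at *
  intro i
  have hki := hk i
  have hli := hl i
  omega

end LatticeSums

section Energy

variable {d : ℕ}

theorem norm_weightedFourier (t : ℝ) (μ : Measure (Torus d)) (ξ : Fin d → ℤ) :
    ‖weightedFourier t μ ξ‖ = freqNorm ξ ^ (t / 2) * ‖fourierMeasure μ ξ‖ := by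
  rw [weightedFourier, norm_mul, Complex.norm_real,
    Real.norm_of_nonneg (Real.rpow_nonneg (freqNorm_nonneg ξ) _)]

theorem HasFourierDecay.exists_bound {s : ℝ} {μ : Measure (Torus d)} (h : HasFourierDecay s μ) :
    ∃ A : ℝ, 0 ≤ A ∧ ∀ ξ, freqNorm ξ ^ (s / 2) * ‖fourierMeasure μ ξ‖ ≤ A := by
  obtain ⟨A, hA⟩ := h
  simp only [← norm_weightedFourier]
  exact ⟨A, (norm_nonneg _).trans (hA ⟨0, rfl⟩), fun ξ => hA ⟨ξ, rfl⟩⟩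

theorem HasFourierDecay.exists_sq_norm_le {s t : ℝ} {μ : Measure (Torus d)}
    [IsProbabilityMeasure μ] (h : HasFourierDecay s μ) (ht : 0 ≤ t) (hts : t ≤ s) (hd : 1 ≤ d) :
    ∃ A : ℝ, 0 ≤ A ∧ ∀ ξ, ‖fourierMeasure μ ξ‖ ^ 2 ≤ A * ∏ i, latticeWeight (t / d) (ξ i) := by
  obtain ⟨A, -, hA⟩ := h.exists_bound
  refine ⟨max 1 (A ^ 2), by positivity, fun ξ => ?_⟩
  by_cases hξ : ξ = 0
  · subst hξ
    have hweight : ∏ i : Fin d, latticeWeight (t / d) ((0 : Fin d → ℤ) i) = 1 := by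
      simp [latticeWeight_zero]
    rw [hweight, mul_one]
    exact (pow_le_one₀ (norm_nonneg _) (norm_fourierMeasure_le_one _ _)).trans (le_max_left _ _)
  have hξ1 := one_le_freqNorm hξ
  have hsq : freqNorm ξ ^ s * ‖fourierMeasure μ ξ‖ ^ 2 ≤ A ^ 2 := by
    calc freqNorm ξ ^ s * ‖fourierMeasure μ ξ‖ ^ 2
        = (freqNorm ξ ^ (s / 2) * ‖fourierMeasure μ ξ‖) ^ 2 := by
          rw [mul_pow, ← Real.rpow_mul_natCast (by linarith)]; norm_num
      _ ≤ A ^ 2 := by gcongr; exact hA ξ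
  calc ‖fourierMeasure μ ξ‖ ^ 2 ≤ A ^ 2 * freqNorm ξ ^ (-s) := by
        rwa [Real.rpow_neg (by linarith), ← div_eq_mul_inv, le_div_iff₀' (by positivity)]
    _ ≤ max 1 (A ^ 2) * freqNorm ξ ^ (-t) := by
        gcongr
        exact le_max_right _ _
    _ ≤ _ := by gcongr; exact freqNorm_rpow_neg_le ht hd hξ

theorem exists_sum_freqCube_sq_norm_le {s t : ℝ} {μ : Measure (Torus d)} [IsProbabilityMeasure μ]
    (h : HasFourierDecay s μ) (ht : 0 ≤ t) (hts : t ≤ s) (htd : t < d) :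
    ∃ A : ℝ, ∀ N : ℕ, 1 ≤ N → ∑ k ∈ freqCube d N, ∑ l ∈ freqCube d N,
      ‖fourierMeasure μ (k - l)‖ ^ 2 ≤ A * (N : ℝ) ^ (2 * d - t) := by
  have hd' : (0 : ℝ) < d := ht.trans_lt htd
  have hd : 1 ≤ d := by exact_mod_cast hd'
  obtain ⟨A, hA0, hA⟩ := h.exists_sq_norm_le ht hts hd
  have htd' : t / d < 1 := (div_lt_one hd').mpr htd
  refine ⟨A * (3 * (1 - t / d)⁻¹) ^ d, fun N hN => ?_⟩
  have hN0 : (0 : ℝ) < N := by exact_mod_cast hN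
  have hrow (k) (hk : k ∈ freqCube d N) : ∑ l ∈ freqCube d N, ‖fourierMeasure μ (k - l)‖ ^ 2 ≤
      A * (3 * (1 - t / d)⁻¹ * (N : ℝ) ^ (1 - t / d)) ^ d := by
    refine (sum_freqCube_sub_le_sum_freqBox (f := fun ξ => ‖fourierMeasure μ ξ‖ ^ 2)
      (fun _ => by positivity) hk).trans ?_
    refine (Finset.sum_le_sum fun ξ _ => hA ξ).trans ?_
    rw [← Finset.mul_sum]
    gcongr
    exact sum_freqBox_prod_latticeWeight_le (by positivity) htd' hN
  refine (Finset.sum_le_card_nsmul _ _ _ hrow).trans_eq ?_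
  have hpow : ((N : ℝ) ^ (1 - t / d)) ^ d * (N : ℝ) ^ d = (N : ℝ) ^ (2 * d - t) := by
    rw [← Real.rpow_mul_natCast hN0.le, ← Real.rpow_natCast (N : ℝ), ← Real.rpow_add hN0]
    congr 1
    field_simp
    ring
  rw [card_freqCube, nsmul_eq_mul, ← hpow, mul_pow _ ((N : ℝ) ^ (1 - t / d))]
  push_cast
  ring

theorem sq_half_card_le_normSq_sum_mFourier {N : ℕ} (hN : 1 ≤ N) (hd : 1 ≤ d) {z : Torus d}
    (hz : ‖z‖ ≤ 1 / (16 * d * N)) :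
    ((N : ℝ) ^ d / 2) ^ 2 ≤ Complex.normSq (∑ k ∈ freqCube d N, UnitAddTorus.mFourier k z) := by
  have hclose (k) (hk : k ∈ freqCube d N) : ‖UnitAddTorus.mFourier k z - 1‖ ≤ 1 / 2 := by
    have hsum : ∑ i, |(k i : ℝ)| ≤ d * N := by
      calc ∑ i, |(k i : ℝ)| ≤ ∑ _i : Fin d, (N : ℝ) := Finset.sum_le_sum fun i _ => by
            simp only [freqCube, Fintype.mem_piFinset, Finset.mem_Ico] at hk
            rw [abs_of_nonneg (by exact_mod_cast (hk i).1)]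
            exact_mod_cast (hk i).2.le
        _ = d * N := by simp
    calc _ ≤ 2 * Real.pi * (∑ i, |(k i : ℝ)|) * ‖z‖ := norm_mFourier_sub_one_le k z
      _ ≤ 2 * 4 * (d * N) * (1 / (16 * d * N)) := by
          gcongr
          exact Real.pi_le_four
      _ = 1 / 2 := by field_simp; norm_num
  have hre (k) (hk : k ∈ freqCube d N) : 1 / 2 ≤ (UnitAddTorus.mFourier k z).re := by
    have hk' := (Complex.abs_re_le_norm _).trans (hclose k hk)
    rw [Complex.sub_re, Complex.one_re] at hk'
    linarith [(abs_le.mp hk').1]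
  have hre_sum : (N : ℝ) ^ d / 2 ≤ (∑ k ∈ freqCube d N, UnitAddTorus.mFourier k z).re := by
    have hcard := Finset.card_nsmul_le_sum _ _ _ hre
    rw [card_freqCube, nsmul_eq_mul] at hcard
    push_cast at hcard
    rw [Complex.re_sum]
    linarith
  calc ((N : ℝ) ^ d / 2) ^ 2
      ≤ (∑ k ∈ freqCube d N, UnitAddTorus.mFourier k z).re ^ 2 := by gcongr
    _ ≤ _ := (sq _).trans_le (Complex.re_sq_le_normSq _)

theorem integral_mFourier_sub_prod (μ : Measure (Torus d)) [IsFiniteMeasure μ] (ξ : Fin d → ℤ) :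
    ∫ p, UnitAddTorus.mFourier ξ (p.1 - p.2) ∂μ.prod μ = (‖fourierMeasure μ ξ‖ : ℂ) ^ 2 := by
  have hsub (x y : Torus d) : UnitAddTorus.mFourier ξ (x - y) =
      UnitAddTorus.mFourier ξ x * UnitAddTorus.mFourier (-ξ) y := by
    rw [sub_eq_add_neg, mFourier_apply_add]
    simp only [UnitAddTorus.mFourier, ContinuousMap.coe_mk, Pi.neg_apply, fourier_apply, smul_neg,
      neg_smul]
  have hconj : ∫ x, UnitAddTorus.mFourier ξ x ∂μ = (starRingEnd ℂ) (fourierMeasure μ ξ) := by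
    rw [fourierMeasure, ← integral_conj]
    simp only [UnitAddTorus.mFourier_neg, Complex.conj_conj]
  simp only [hsub]
  rw [integral_prod_mul, hconj]
  exact Complex.conj_mul' _

theorem integral_normSq_sum_mFourier_sub (μ : Measure (Torus d)) [IsFiniteMeasure μ]
    (Λ : Finset (Fin d → ℤ)) :
    ∫ p, Complex.normSq (∑ k ∈ Λ, UnitAddTorus.mFourier k (p.1 - p.2)) ∂μ.prod μ =
      ∑ k ∈ Λ, ∑ l ∈ Λ, ‖fourierMeasure μ (k - l)‖ ^ 2 := by
  have hexpand (z : Torus d) : (Complex.normSq (∑ k ∈ Λ, UnitAddTorus.mFourier k z) : ℂ) =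
      ∑ k ∈ Λ, ∑ l ∈ Λ, UnitAddTorus.mFourier (k - l) z := by
    rw [← Complex.mul_conj, map_sum, Finset.sum_mul_sum]
    refine Finset.sum_congr rfl fun k _ => Finset.sum_congr rfl fun l _ => ?_
    rw [← UnitAddTorus.mFourier_neg, ← UnitAddTorus.mFourier_add, ← sub_eq_add_neg]
  have hint (ξ : Fin d → ℤ) :
      Integrable (fun p : Torus d × Torus d => UnitAddTorus.mFourier ξ (p.1 - p.2)) (μ.prod μ) :=
    Integrable.of_bound (by fun_prop) 1 (ae_of_all _ fun p => (norm_mFourier_apply ξ _).le)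
  apply Complex.ofReal_injective
  rw [← integral_complex_ofReal]
  simp only [hexpand, Complex.ofReal_sum, Complex.ofReal_pow, ← integral_mFourier_sub_prod]
  rw [integral_finsetSum _ fun k _ => integrable_finsetSum _ fun l _ => hint _]
  exact Finset.sum_congr rfl fun k _ => integral_finsetSum _ fun l _ => hint _

theorem lintegral_measure_closedBall {X : Type*} [PseudoMetricSpace X] [MeasurableSpace X]
    [OpensMeasurableSpace X] [SecondCountableTopology X] (μ : Measure X) [SFinite μ] (r : ℝ) :
    ∫⁻ x, μ (Metric.closedBall x r) ∂μ = μ.prod μ {p | dist p.1 p.2 ≤ r} := by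
  rw [Measure.prod_apply (measurableSet_le (by fun_prop) measurable_const)]
  simp only [Metric.closedBall, dist_comm, preimage_ofPred_eq]

theorem exists_lintegral_measure_closedBall_le {s t : ℝ} {μ : Measure (Torus d)}
    [IsProbabilityMeasure μ] (h : HasFourierDecay s μ) (ht : 0 ≤ t) (hts : t ≤ s) (htd : t < d) :
    ∃ A : ℝ≥0∞, A ≠ ∞ ∧ ∀ N : ℕ, 1 ≤ N →
      ∫⁻ x, μ (Metric.closedBall x (1 / (16 * d) / N)) ∂μ ≤ A * (N : ℝ≥0∞) ^ (-t) := by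
  have hd : 1 ≤ d := by exact_mod_cast ht.trans_lt htd
  obtain ⟨A, hA⟩ := exists_sum_freqCube_sq_norm_le h ht hts htd
  refine ⟨ENNReal.ofReal (4 * A), ENNReal.ofReal_ne_top, fun N hN => ?_⟩
  have hN0 : (0 : ℝ) < N := by exact_mod_cast hN
  set F : Torus d × Torus d → ℝ := fun p =>
    Complex.normSq (∑ k ∈ freqCube d N, UnitAddTorus.mFourier k (p.1 - p.2))
  have hF : Integrable F (μ.prod μ) := by
    have hcont : Continuous F := by fun_prop
    obtain ⟨B, hB⟩ := (isCompact_range hcont.norm).bddAbove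
    exact Integrable.of_bound hcont.aestronglyMeasurable B (ae_of_all _ fun p => hB ⟨p, rfl⟩)
  have hmarkov := mul_meas_ge_le_integral_of_nonneg
    (ae_of_all _ fun p => Complex.normSq_nonneg _) hF (((N : ℝ) ^ d / 2) ^ 2)
  rw [integral_normSq_sum_mFourier_sub] at hmarkov
  have hsub : {p : Torus d × Torus d | dist p.1 p.2 ≤ 1 / (16 * d) / N} ⊆
      {p | ((N : ℝ) ^ d / 2) ^ 2 ≤ F p} := fun p hp => by
    refine sq_half_card_le_normSq_sum_mFourier hN hd ?_
    rw [← dist_eq_norm, ← div_div]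
    exact hp
  have hpow : (N : ℝ) ^ (2 * d - t) = ((N : ℝ) ^ d) ^ 2 * (N : ℝ) ^ (-t) := by
    rw [sub_eq_add_neg, Real.rpow_add hN0, ← pow_mul, mul_comm d, ← Real.rpow_natCast]
    norm_cast
  rw [lintegral_measure_closedBall, ← ENNReal.ofReal_natCast, ENNReal.ofReal_rpow_of_pos hN0,
    ← ENNReal.ofReal_mul' (by positivity)]
  refine (measure_mono hsub).trans ?_
  rw [← ofReal_measureReal]
  refine ENNReal.ofReal_le_ofReal (le_of_mul_le_mul_left
    (hmarkov.trans ((hA N hN).trans_eq ?_)) (by positivity : 0 < ((N : ℝ) ^ d / 2) ^ 2))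
  rw [hpow]
  ring

end Energy

section MassDistribution

variable {X : Type*} [MetricSpace X] [MeasurableSpace X] {μ : Measure X}

theorem ofReal_le_dimH_of_measure_closedBall_le [BorelSpace X] {E G : Set X}
    (hG : MeasurableSet G) (hEG : μ (E ∩ G) ≠ 0) {C : ℝ≥0∞} (hC : C ≠ ∞) {ρ t : ℝ} (hρ : 0 < ρ)
    (ht : 0 ≤ t) (hball : ∀ x ∈ G, ∀ r, 0 < r → r ≤ ρ →
      μ (Metric.closedBall x r) ≤ C * ENNReal.ofReal r ^ t) :
    ENNReal.ofReal t ≤ dimH E := by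
  have hdiam (s : Set X) (hs : Metric.ediam s ≤ ENNReal.ofReal (ρ / 2)) :
      μ.restrict G s ≤ C * Metric.ediam s ^ t := by
    rw [Measure.restrict_apply' hG]
    rcases (s ∩ G).eq_empty_or_nonempty with hempty | ⟨x, hxs, hxG⟩
    · simp [hempty]
    have hfin : Metric.ediam s ≠ ∞ := ne_top_of_le_ne_top ENNReal.ofReal_ne_top hs
    have hlt : (Metric.ediam s).toReal < ρ :=
      (ENNReal.toReal_le_of_le_ofReal (by positivity) hs).trans_lt (half_lt_self hρ)
    have hlim : Tendsto (fun r => C * ENNReal.ofReal r ^ t) (𝓝[>] (Metric.ediam s).toReal)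
        (𝓝 (C * Metric.ediam s ^ t)) := by
      have hpow := ((ENNReal.continuous_rpow_const (y := t)).comp
        ENNReal.continuous_ofReal).tendsto (Metric.ediam s).toReal
      simp only [Function.comp_def, ENNReal.ofReal_toReal hfin] at hpow
      exact ENNReal.Tendsto.const_mul (hpow.mono_left nhdsWithin_le_nhds) (Or.inr hC)
    refine ge_of_tendsto hlim ?_
    filter_upwards [Ioo_mem_nhdsGT hlt] with r hr
    refine (measure_mono fun y hy => ?_).trans
      (hball x hxG r (ENNReal.toReal_nonneg.trans_lt hr.1) hr.2.le)
    rw [Metric.mem_closedBall, dist_edist]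
    exact (ENNReal.toReal_mono hfin (Metric.edist_le_ediam_of_mem hy.1 hxs)).trans hr.1.le
  have hle : C⁻¹ • μ.restrict G ≤ μH[t] := by
    refine Measure.le_hausdorffMeasure t _ (ENNReal.ofReal (ρ / 2)) (by simpa using hρ)
      fun s hs => ?_
    rw [Measure.smul_apply, smul_eq_mul, mul_comm, ← div_eq_mul_inv]
    exact ENNReal.div_le_of_le_mul' (hdiam s hs)
  refine le_dimH_of_hausdorffMeasure_ne_zero (d := t.toNNReal) fun hzero => ?_
  rw [Real.coe_toNNReal _ ht] at hzero
  have hE := hle E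
  rw [hzero, Measure.smul_apply, Measure.restrict_apply' hG, smul_eq_mul, nonpos_iff_eq_zero,
    mul_eq_zero] at hE
  exact hE.elim (fun h => hC (ENNReal.inv_eq_zero.mp h)) hEG

theorem measure_closedBall_le_of_dyadic {x : X} {M : ℝ≥0∞} {ρ t : ℝ} (hρ : 0 < ρ) (ht : 0 < t)
    (h : ∀ k : ℕ, ((2 : ℝ≥0∞) ^ k) ^ t * μ (Metric.closedBall x (ρ / 2 ^ k)) ≤ M)
    {r : ℝ} (hr : 0 < r) (hrρ : r ≤ ρ) :
    μ (Metric.closedBall x r) ≤ M * ENNReal.ofReal (2 / ρ) ^ t * ENNReal.ofReal r ^ t := by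
  obtain ⟨k, hk, hk'⟩ := exists_nat_pow_near_of_lt_one (y := (1 / 2 : ℝ)) (x := r / ρ)
    (by positivity) ((div_le_one hρ).mpr hrρ) (by norm_num) (by norm_num)
  rw [div_le_iff₀ hρ, one_div_pow, one_div_mul_eq_div] at hk'
  rw [one_div_pow, lt_div_iff₀ hρ, one_div_mul_eq_div, div_lt_iff₀ (by positivity)] at hk
  have hone : 1 ≤ ENNReal.ofReal (2 / ρ) * ENNReal.ofReal r * (2 : ℝ≥0∞) ^ k := by
    rw [← ENNReal.ofReal_ofNat 2, ← ENNReal.ofReal_pow zero_le_two,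
      ← ENNReal.ofReal_mul (by positivity), ← ENNReal.ofReal_mul (by positivity),
      ENNReal.one_le_ofReal, div_mul_eq_mul_div, div_mul_eq_mul_div, one_le_div hρ]
    rw [pow_succ] at hk
    linarith
  calc μ (Metric.closedBall x r)
      ≤ (ENNReal.ofReal (2 / ρ) * ENNReal.ofReal r * 2 ^ k) ^ t *
          μ (Metric.closedBall x (ρ / 2 ^ k)) :=
        (measure_mono (Metric.closedBall_subset_closedBall hk')).trans
          (le_mul_of_one_le_left' (ENNReal.one_le_rpow hone ht))
    _ = ((2 : ℝ≥0∞) ^ k) ^ t * μ (Metric.closedBall x (ρ / 2 ^ k)) *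
          ENNReal.ofReal (2 / ρ) ^ t * ENNReal.ofReal r ^ t := by
        rw [ENNReal.mul_rpow_of_nonneg _ _ ht.le, ENNReal.mul_rpow_of_nonneg _ _ ht.le]
        ring
    _ ≤ _ := by gcongr; exact h k

theorem exists_measure_forall_le_ne_zero {Ω : Type*} [MeasurableSpace Ω] {μ : Measure Ω}
    (hμ : μ ≠ 0) {f : ℕ → Ω → ℝ≥0∞} (hf : ∀ k, Measurable (f k))
    (hsum : ∑' k, ∫⁻ x, f k x ∂μ ≠ ∞) : ∃ M : ℕ, μ {x | ∀ k, f k x ≤ M} ≠ 0 := by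
  rw [← lintegral_tsum fun k => (hf k).aemeasurable] at hsum
  have hcover : μ (⋃ M : ℕ, {x | ∀ k, f k x ≤ M}) ≠ 0 := fun hnull => hμ <| by
    rw [← ae_eq_bot, ← eventually_false_iff_eq_bot]
    filter_upwards [ae_lt_top (Measurable.tsum hf) hsum, measure_eq_zero_iff_ae_notMem.mp hnull]
      with x hfin hx
    obtain ⟨M, hM⟩ := ENNReal.exists_nat_gt hfin.ne
    exact hx (mem_iUnion.mpr ⟨M, fun k => (ENNReal.le_tsum k).trans hM.le⟩)
  exact (exists_measure_pos_of_not_measure_iUnion_null hcover).imp fun M hM => hM.ne'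

theorem ofReal_le_dimH_of_lintegral_closedBall_le [BorelSpace X] [SecondCountableTopology X]
    [IsProbabilityMeasure μ] {E : Set X} (hE : μ Eᶜ = 0) {ρ t u : ℝ} (hρ : 0 < ρ) (ht : 0 < t)
    (htu : t < u) {A : ℝ≥0∞} (hA : A ≠ ∞)
    (h : ∀ N : ℕ, 1 ≤ N → ∫⁻ x, μ (Metric.closedBall x (ρ / N)) ∂μ ≤ A * (N : ℝ≥0∞) ^ (-u)) :
    ENNReal.ofReal t ≤ dimH E := by
  have hmeas (r : ℝ) : Measurable fun x => μ (Metric.closedBall x r) := by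
    have hset : MeasurableSet {p : X × X | dist p.2 p.1 ≤ r} :=
      measurableSet_le (by fun_prop) measurable_const
    exact measurable_measure_prodMk_left hset
  set f : ℕ → X → ℝ≥0∞ := fun k x =>
    ((2 : ℝ≥0∞) ^ k) ^ t * μ (Metric.closedBall x (ρ / 2 ^ k))
  have hf (k : ℕ) : Measurable (f k) := (hmeas _).const_mul _
  have hterm (k : ℕ) : ∫⁻ x, f k x ∂μ ≤ A * ((2 : ℝ≥0∞) ^ (t - u)) ^ k := by
    rw [lintegral_const_mul _ (hmeas _)]
    have hk := h (2 ^ k) Nat.one_le_two_pow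
    push_cast at hk
    refine (mul_le_mul_right hk _).trans_eq ?_
    rw [mul_left_comm, ← ENNReal.rpow_add _ _ (by positivity) (by finiteness), ← sub_eq_add_neg,
      ← ENNReal.rpow_natCast, ← ENNReal.rpow_natCast, ← ENNReal.rpow_mul, ← ENNReal.rpow_mul,
      mul_comm (k : ℝ)]
  have hsum : ∑' k, ∫⁻ x, f k x ∂μ ≠ ∞ := by
    refine ne_top_of_le_ne_top ?_ (ENNReal.tsum_le_tsum hterm)
    rw [ENNReal.tsum_mul_left, ENNReal.tsum_geometric]
    refine ENNReal.mul_ne_top hA (ENNReal.inv_ne_top.mpr (tsub_pos_of_lt ?_).ne')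
    exact ENNReal.rpow_lt_one_of_one_lt_of_neg (by norm_num) (by linarith)
  obtain ⟨M, hM⟩ := exists_measure_forall_le_ne_zero (NeZero.ne μ) hf hsum
  refine ofReal_le_dimH_of_measure_closedBall_le
    (measurableSet_setOfPred.mpr (Measurable.forall fun k =>
      measurableSet_setOfPred.mp (measurableSet_le (hf k) measurable_const)))
    ?_ (C := M * ENNReal.ofReal (2 / ρ) ^ t) (by finiteness) hρ ht.le
    fun x hx r hr hrρ => measure_closedBall_le_of_dyadic hρ ht hx hr hrρ
  rwa [inter_comm, measure_inter_conull hE]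

end MassDistribution

section FourierDimension

variable {d : ℕ}

theorem HasFourierDecay.ofReal_le_dimH {s : ℝ} (hsd : s ≤ d) {μ : Measure (Torus d)}
    [IsProbabilityMeasure μ] (h : HasFourierDecay s μ) {E : Set (Torus d)} (hE : μ Eᶜ = 0) :
    ENNReal.ofReal s ≤ dimH E := by
  refine le_of_forall_lt fun c hc => ?_
  lift c to ℝ≥0 using hc.ne_top
  rw [← ENNReal.ofReal_coe_nnreal] at hc
  replace hc := (ENNReal.ofReal_lt_ofReal_iff_of_nonneg c.2).mp hc
  obtain ⟨t, hct, hts⟩ := exists_between hc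
  obtain ⟨u, htu, hus⟩ := exists_between hts
  have ht : 0 < t := c.2.trans_lt hct
  have hd : (0 : ℝ) < d := by linarith
  obtain ⟨A, hA_top, hA⟩ :=
    exists_lintegral_measure_closedBall_le h (ht.trans htu).le hus.le (hus.trans_le hsd)
  refine lt_of_lt_of_le ?_ (ofReal_le_dimH_of_lintegral_closedBall_le (ρ := 1 / (16 * d)) hE
    (by positivity) ht htu hA_top hA)
  rw [← ENNReal.ofReal_coe_nnreal]
  exact (ENNReal.ofReal_lt_ofReal_iff ht).mpr hct

theorem fourierDim_le_dimH (E : Set (Torus d)) : fourierDim E ≤ dimH E := by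
  refine iSup₂_le fun μ hμ => iSup_le fun s => iSup₂_le fun hs h => ?_
  rw [← ENNReal.ofReal_coe_nnreal]
  exact h.ofReal_le_dimH hs
    (measure_mono_null (compl_subset_compl.mpr hμ) Measure.measure_compl_support)

theorem le_fourierDim {β : ℝ} (hβ : β ≤ d) {E : Set (Torus d)} (μ : ProbabilityMeasure (Torus d))
    (hμ : (μ : Measure (Torus d)).support ⊆ E)
    (h : ∀ t ∈ Ico (0 : ℝ) β, HasFourierDecay t (μ : Measure (Torus d))) :
    ENNReal.ofReal β ≤ fourierDim E := by
  refine le_of_forall_lt fun c hc => ?_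
  obtain ⟨s, hcs, hsβ⟩ := exists_between hc
  lift s to ℝ≥0 using hsβ.ne_top
  rw [← ENNReal.ofReal_coe_nnreal] at hsβ
  replace hsβ := (ENNReal.ofReal_lt_ofReal_iff_of_nonneg s.2).mp hsβ
  calc (c : ℝ≥0∞) < s := hcs
    _ ≤ fourierDimMeasure (μ : Measure (Torus d)) :=
        le_iSup_of_le s (le_iSup₂_of_le (hsβ.le.trans hβ) (h s ⟨s.2, hsβ⟩) le_rfl)
    _ ≤ fourierDim E := le_iSup₂_of_le μ hμ le_rfl

end FourierDimension

section BoundedDifferences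

open ProbabilityTheory

/-- `G` changes by at most `c` when a single coordinate is changed. -/
def BoundedDifferences {ι Ω : Type*} (c : ℝ) (G : (ι → Ω) → ℝ) : Prop :=
  ∀ (X X' : ι → Ω) (k : ι), (∀ j, j ≠ k → X j = X' j) → |G X - G X'| ≤ c

theorem BoundedDifferences.add {ι Ω : Type*} {c c' : ℝ} {G G' : (ι → Ω) → ℝ}
    (hG : BoundedDifferences c G) (hG' : BoundedDifferences c' G') :
    BoundedDifferences (c + c') fun X => G X + G' X := fun X X' k hk => by
  rw [add_sub_add_comm]
  exact (abs_add_le _ _).trans (add_le_add (hG X X' k hk) (hG' X X' k hk))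

theorem BoundedDifferences.abs_sub_le {ι Ω : Type*} [Fintype ι] {c : ℝ} {G : (ι → Ω) → ℝ}
    (hG : BoundedDifferences c G) (X X' : ι → Ω) : |G X - G X'| ≤ Fintype.card ι * c := by
  classical
  have hpiecewise (s : Finset ι) : |G (s.piecewise X X') - G X'| ≤ s.card * c := by
    induction s using Finset.induction_on with
    | empty => simp
    | insert k s hk ih =>
      have hstep := hG ((insert k s).piecewise X X') (s.piecewise X X') k
        fun j hj => s.piecewise_insert_of_ne X X' hj
      rw [Finset.card_insert_of_notMem hk]
      push_cast
      linarith [_root_.abs_sub_le (G ((insert k s).piecewise X X')) (G (s.piecewise X X')) (G X')]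
  simpa using hpiecewise Finset.univ

theorem BoundedDifferences.exists_forall_abs_le {ι Ω : Type*} [Finite ι] {c : ℝ}
    {G : (ι → Ω) → ℝ} (hG : BoundedDifferences c G) : ∃ B, ∀ X, |G X| ≤ B := by
  have := Fintype.ofFinite ι
  rcases isEmpty_or_nonempty (ι → Ω) with _ | ⟨⟨X₀⟩⟩
  · exact ⟨0, isEmptyElim⟩
  · exact ⟨Fintype.card ι * c + |G X₀|, fun X => by
      linarith [abs_sub_abs_le_abs_sub (G X) (G X₀), hG.abs_sub_le X X₀]⟩

theorem boundedDifferences_average {Ω : Type*} {M : ℕ} {g : Ω → ℝ} {L : ℝ}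
    (hg : ∀ x, |g x| ≤ L) :
    BoundedDifferences (2 * L / M) fun X : Fin M → Ω => (M : ℝ)⁻¹ * ∑ k, g (X k) :=
    fun X X' k hk => by
  have hsum : ∑ j, g (X j) - ∑ j, g (X' j) = g (X k) - g (X' k) := by
    rw [← Finset.sum_sub_distrib]
    exact Finset.sum_eq_single k (fun j _ hj => by rw [hk j hj, sub_self]) (by simp)
  rw [← mul_sub, hsum, abs_mul, abs_of_nonneg (by positivity), inv_mul_eq_div]
  gcongr
  exact (abs_sub _ _).trans (by linarith [hg (X k), hg (X' k)])

variable {Ω Ω' : Type*} [MeasurableSpace Ω] [MeasurableSpace Ω']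

theorem abs_integral_le_of_forall_abs_le {P : Measure Ω} [IsProbabilityMeasure P] {g : Ω → ℝ}
    {B : ℝ} (h : ∀ x, |g x| ≤ B) : |∫ x, g x ∂P| ≤ B := by
  simpa using norm_integral_le_of_norm_le_const (μ := P) (f := g) (C := B) (ae_of_all _ h)

theorem hasSubgaussianMGF_sub_integral_of_abs_sub_le {P : Measure Ω} [IsProbabilityMeasure P]
    {c : ℝ} {g : Ω → ℝ} (hg : Measurable g) (h : ∀ x x', |g x - g x'| ≤ c) :
    HasSubgaussianMGF (fun x => g x - ∫ y, g y ∂P) (‖c‖₊ ^ 2) P := by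
  obtain ⟨x₀⟩ := nonempty_of_isProbabilityMeasure P
  have hmem : ∀ᵐ x ∂P, g x ∈ Icc (g x₀ - c) (g x₀ + c) :=
    ae_of_all _ fun x => by
      constructor <;> linarith [(abs_le.mp (h x x₀)).1, (abs_le.mp (h x x₀)).2]
  convert! hasSubgaussianMGF_of_mem_Icc hg.aemeasurable hmem using 2
  rw [add_sub_sub_cancel, ← two_mul, nnnorm_mul, Real.nnnorm_ofNat,
    mul_div_cancel_left₀ _ two_ne_zero]

theorem hasSubgaussianMGF_sub_integral_prod {P : Measure Ω} {Q : Measure Ω'}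
    [IsProbabilityMeasure P] [IsProbabilityMeasure Q] {G : Ω × Ω' → ℝ} (hG : Measurable G) {B : ℝ}
    (hB : ∀ p, |G p| ≤ B) {c C : ℝ≥0}
    (hfst : ∀ y, HasSubgaussianMGF (fun x => G (x, y) - ∫ x', G (x', y) ∂P) c P)
    (hsnd : HasSubgaussianMGF (fun y => (∫ x, G (x, y) ∂P) - ∫ p, G p ∂P.prod Q) C Q) :
    HasSubgaussianMGF (fun p => G p - ∫ p, G p ∂P.prod Q) (c + C) (P.prod Q) := by
  have hint (t : ℝ) : Integrable (fun p => Real.exp (t * (G p - ∫ p, G p ∂P.prod Q))) (P.prod Q) :=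
    integrable_exp_mul_of_mem_Icc (a := -B - ∫ p, G p ∂P.prod Q) (b := B - ∫ p, G p ∂P.prod Q)
      (hG.sub_const _).aemeasurable (ae_of_all _ fun p =>
        ⟨sub_le_sub_right (abs_le.mp (hB p)).1 _, sub_le_sub_right (abs_le.mp (hB p)).2 _⟩)
  refine ⟨hint, fun t => ?_⟩
  set E := ∫ p, G p ∂P.prod Q
  have hinner (y : Ω') : ∫ x, Real.exp (t * (G (x, y) - E)) ∂P ≤
      Real.exp (c * t ^ 2 / 2) * Real.exp (t * ((∫ x, G (x, y) ∂P) - E)) := by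
    have hsplit (x : Ω) : Real.exp (t * (G (x, y) - E)) =
        Real.exp (t * (G (x, y) - ∫ x', G (x', y) ∂P)) *
          Real.exp (t * ((∫ x, G (x, y) ∂P) - E)) := by
      rw [← Real.exp_add]
      ring_nf
    simp only [hsplit]
    rw [integral_mul_const]
    gcongr
    exact (hfst y).mgf_le t
  calc mgf (fun p => G p - E) (P.prod Q) t
      = ∫ y, ∫ x, Real.exp (t * (G (x, y) - E)) ∂P ∂Q := integral_prod_symm _ (hint t)
    _ ≤ ∫ y, Real.exp (c * t ^ 2 / 2) * Real.exp (t * ((∫ x, G (x, y) ∂P) - E)) ∂Q :=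
        integral_mono (hint t).integral_prod_right ((hsnd.integrable_exp_mul t).const_mul _) hinner
    _ ≤ Real.exp (c * t ^ 2 / 2) * Real.exp (C * t ^ 2 / 2) := by
        rw [integral_const_mul]
        gcongr
        exact hsnd.mgf_le t
    _ = Real.exp ((c + C : ℝ≥0) * t ^ 2 / 2) := by
        rw [← Real.exp_add]
        push_cast
        ring_nf

theorem BoundedDifferences.integral_cons {M : ℕ} {c : ℝ} {G : (Fin (M + 1) → Ω) → ℝ}
    (hG : BoundedDifferences c G) {P : Measure Ω} [IsProbabilityMeasure P]
    (hint : ∀ y : Fin M → Ω, Integrable (fun x => G (Fin.cons x y)) P) :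
    BoundedDifferences c fun y : Fin M → Ω => ∫ x, G (Fin.cons x y) ∂P := fun y y' k hk => by
  rw [← integral_sub (hint y) (hint y')]
  refine abs_integral_le_of_forall_abs_le fun x => hG _ _ k.succ fun j hj => ?_
  cases j using Fin.cases with
  | zero => rfl
  | succ j => exact hk j fun h => hj (congrArg Fin.succ h)

theorem piFinSuccAbove_zero_symm_apply {M : ℕ} (p : Ω × (Fin M → Ω)) :
    (MeasurableEquiv.piFinSuccAbove (fun _ : Fin (M + 1) => Ω) 0).symm p = Fin.cons p.1 p.2 :=
  Fin.insertNth_zero' p.1 p.2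

theorem hasSubgaussianMGF_pi_of_cons {M : ℕ} {P : Fin (M + 1) → Measure Ω}
    [∀ k, IsProbabilityMeasure (P k)] {G : (Fin (M + 1) → Ω) → ℝ} {c : ℝ≥0}
    (h : HasSubgaussianMGF (fun p => G (Fin.cons p.1 p.2) -
      ∫ p, G (Fin.cons p.1 p.2) ∂(P 0).prod (Measure.pi fun k => P k.succ)) c
        ((P 0).prod (Measure.pi fun k => P k.succ))) :
    HasSubgaussianMGF (fun X => G X - ∫ Y, G Y ∂Measure.pi P) c (Measure.pi P) := by
  have hmp : MeasurePreserving (MeasurableEquiv.piFinSuccAbove (fun _ : Fin (M + 1) => Ω) 0)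
      (Measure.pi P) ((P 0).prod (Measure.pi fun k => P k.succ)) :=
    measurePreserving_piFinSuccAbove P 0
  have hmean : ∫ X, G X ∂Measure.pi P =
      ∫ p, G (Fin.cons p.1 p.2) ∂(P 0).prod (Measure.pi fun k => P k.succ) := by
    simp only [← piFinSuccAbove_zero_symm_apply]
    exact (hmp.symm.integral_comp' G).symm
  rw [← hmean, ← hmp.map_eq] at h
  convert! h.of_map hmp.measurable.aemeasurable using 1
  ext X
  simp only [← piFinSuccAbove_zero_symm_apply, Function.comp_apply,
    MeasurableEquiv.symm_apply_apply]

/-- McDiarmid's inequality, up to the constant: conditioning on all coordinates but the first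
reduces to the one-dimensional Hoeffding lemma. -/
theorem BoundedDifferences.hasSubgaussianMGF_sub_integral {c : ℝ} {M : ℕ} (P : Fin M → Measure Ω)
    [∀ k, IsProbabilityMeasure (P k)] {G : (Fin M → Ω) → ℝ} (hc : BoundedDifferences c G)
    (hG : Measurable G) :
    HasSubgaussianMGF (fun X => G X - ∫ Y, G Y ∂Measure.pi P) (M * ‖c‖₊ ^ 2) (Measure.pi P) := by
  induction M with
  | zero =>
    have hconst (X : Fin 0 → Ω) : G X = G default := by rw [Subsingleton.elim X default]
    simp [hconst]
  | succ M ih =>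
    obtain ⟨B, hB⟩ := hc.exists_forall_abs_le
    have hGcons : Measurable fun p : Ω × (Fin M → Ω) => G (Fin.cons p.1 p.2) := by
      simp only [← piFinSuccAbove_zero_symm_apply]
      exact hG.comp (MeasurableEquiv.measurable _)
    have hfst (y : Fin M → Ω) := hasSubgaussianMGF_sub_integral_of_abs_sub_le (P := P 0) (c := c)
      (hGcons.comp (measurable_prodMk_right (y := y))) fun x x' => hc _ _ 0 fun j hj => by
        obtain ⟨j, rfl⟩ := Fin.exists_succ_eq.mpr hj
        rfl
    have hsnd := ih (fun k => P k.succ)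
      (hc.integral_cons (P := P 0) fun y => Integrable.of_bound
        (hGcons.comp (measurable_prodMk_right (y := y))).aestronglyMeasurable B
        (ae_of_all _ fun x => hB _))
      (hGcons.stronglyMeasurable.integral_prod_left (μ := P 0)).measurable
    rw [← integral_prod_symm _ (Integrable.of_bound hGcons.aestronglyMeasurable B
      (ae_of_all _ fun p => hB _))] at hsnd
    convert! hasSubgaussianMGF_pi_of_cons
      (hasSubgaussianMGF_sub_integral_prod hGcons (fun p => hB _) hfst hsnd) using 1
    push_cast
    ring

theorem exists_forall_abs_le_of_hasSubgaussianMGF {P : Measure Ω} [IsProbabilityMeasure P]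
    {ι : Type*} [Fintype ι] {X : ι → Ω → ℝ} {c : ℝ≥0} (hX : ∀ i, HasSubgaussianMGF (X i) c P)
    {s a : ℝ} (hs : 0 < s)
    (ha : 2 * Fintype.card ι * Real.exp (c * s ^ 2 / 2) ≤ Real.exp (s * a)) :
    ∃ ω, ∀ i, |X i ω| ≤ a := by
  have hint (i : ι) : Integrable (fun ω => Real.exp (s * X i ω) + Real.exp (-s * X i ω)) P :=
    ((hX i).integrable_exp_mul s).add ((hX i).integrable_exp_mul (-s))
  obtain ⟨ω, hω⟩ := exists_le_integral (μ := P)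
    (f := fun ω => ∑ i, (Real.exp (s * X i ω) + Real.exp (-s * X i ω)))
    (integrable_finsetSum _ fun i _ => hint i)
  have hmean : ∫ ω, ∑ i, (Real.exp (s * X i ω) + Real.exp (-s * X i ω)) ∂P ≤ Real.exp (s * a) := by
    rw [integral_finsetSum _ fun i _ => hint i]
    calc ∑ i, ∫ ω, (Real.exp (s * X i ω) + Real.exp (-s * X i ω)) ∂P
        ≤ ∑ _i : ι, 2 * Real.exp (c * s ^ 2 / 2) := by
          refine Finset.sum_le_sum fun i _ => ?_
          rw [integral_add ((hX i).integrable_exp_mul s) ((hX i).integrable_exp_mul (-s))]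
          have hneg := (hX i).mgf_le (-s)
          rw [neg_sq] at hneg
          linarith! [(hX i).mgf_le s]
      _ = 2 * Fintype.card ι * Real.exp (c * s ^ 2 / 2) := by
          rw [Finset.sum_const, Finset.card_univ, nsmul_eq_mul]
          ring
      _ ≤ Real.exp (s * a) := ha
  refine ⟨ω, fun i => ?_⟩
  have hi := (Finset.single_le_sum (f := fun i => Real.exp (s * X i ω) + Real.exp (-s * X i ω))
    (fun _ _ => by positivity) (Finset.mem_univ i)).trans (hω.trans hmean)
  have hpos : s * X i ω ≤ s * a := Real.exp_le_exp.mp (by linarith [Real.exp_pos (-s * X i ω)])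
  have hneg : s * -X i ω ≤ s * a := Real.exp_le_exp.mp (by
    rw [mul_neg, ← neg_mul]
    linarith [Real.exp_pos (s * X i ω)])
  exact abs_le'.mpr ⟨le_of_mul_le_mul_left hpos hs, le_of_mul_le_mul_left hneg hs⟩

end BoundedDifferences

section BoundedDensity

variable {Ω : Type*} [MeasurableSpace Ω]

/-- A measurable density with values in `[0, L]`. -/
structure IsBoundedDensity (f : Ω → ℝ) (L : ℝ) : Prop where
  measurable : Measurable f
  nonneg : ∀ x, 0 ≤ f x
  le : ∀ x, f x ≤ L

/-- The measure `f dP`; negative values of `f` are truncated to `0`. -/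
noncomputable def densityMeasure (P : Measure Ω) (f : Ω → ℝ) : Measure Ω :=
  P.withDensity fun x => ENNReal.ofReal (f x)

variable {P : Measure Ω} {f g : Ω → ℝ} {L L' : ℝ}

theorem IsBoundedDensity.indicator (hf : IsBoundedDensity f L) {Q : Set Ω} (hQ : MeasurableSet Q) :
    IsBoundedDensity (Q.indicator f) L where
  measurable := hf.measurable.indicator hQ
  nonneg := indicator_nonneg fun x _ => hf.nonneg x
  le x := (indicator_le_self' (fun x _ => hf.nonneg x) x).trans (hf.le x)

theorem IsBoundedDensity.mul (hf : IsBoundedDensity f L) (hg : IsBoundedDensity g L') :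
    IsBoundedDensity (fun x => f x * g x) (L * L') where
  measurable := hf.measurable.mul hg.measurable
  nonneg x := mul_nonneg (hf.nonneg x) (hg.nonneg x)
  le x := mul_le_mul (hf.le x) (hg.le x) (hg.nonneg x) ((hf.nonneg x).trans (hf.le x))

theorem IsBoundedDensity.integrable [IsFiniteMeasure P] (hf : IsBoundedDensity f L) :
    Integrable f P :=
  Integrable.of_bound hf.measurable.aestronglyMeasurable L (ae_of_all _ fun x => by
    rw [Real.norm_eq_abs, abs_of_nonneg (hf.nonneg x)]
    exact hf.le x)

theorem IsBoundedDensity.abs_mul_le (hf : IsBoundedDensity f L) {h : Ω → ℝ}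
    (hh : ∀ x, |h x| ≤ 1) (x : Ω) : |f x * h x| ≤ L := by
  rw [abs_mul, abs_of_nonneg (hf.nonneg x)]
  exact (mul_le_of_le_one_right (hf.nonneg x) (hh x)).trans (hf.le x)

theorem IsBoundedDensity.isFiniteMeasure_densityMeasure [IsFiniteMeasure P]
    (hf : IsBoundedDensity f L) : IsFiniteMeasure (densityMeasure P f) := by
  have hle : ∫⁻ x, ENNReal.ofReal (f x) ∂P ≤ ∫⁻ _, ENNReal.ofReal L ∂P :=
    lintegral_mono fun x => ENNReal.ofReal_le_ofReal (hf.le x)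
  rw [lintegral_const] at hle
  exact isFiniteMeasure_withDensity <| ne_top_of_le_ne_top
    (ENNReal.mul_ne_top ENNReal.ofReal_ne_top (measure_ne_top P univ)) hle

theorem IsBoundedDensity.integral_densityMeasure (hf : IsBoundedDensity f L) (h : Ω → ℝ) :
    ∫ x, h x ∂densityMeasure P f = ∫ x, f x * h x ∂P := by
  rw [densityMeasure, integral_withDensity_eq_integral_toReal_smul hf.measurable.ennreal_ofReal
    (ae_of_all _ fun _ => ENNReal.ofReal_lt_top)]
  simp only [ENNReal.toReal_ofReal (hf.nonneg _), smul_eq_mul]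

end BoundedDensity

section SampleMeasure

variable {Ω : Type*} [MeasurableSpace Ω] {M : ℕ}

/-- Random weights `q X`, depending on a sample `X` of `M` points with law `P`, which change little
when one sample point is replaced and whose mean is close to `1`. They lie in `[0, 2]`: conditioning
on an event of probability at least `1 / 2` costs a factor of at most `2`. -/
structure IsSampleWeight (P : Measure Ω) (q : (Fin M → Ω) → Ω → ℝ) (D b : ℝ) : Prop where
  measurable_uncurry : Measurable (Function.uncurry q)
  nonneg : ∀ X x, 0 ≤ q X x
  le_two : ∀ X x, q X x ≤ 2
  integral_abs_sub_le : ∀ (X X' : Fin M → Ω) (k : Fin M), (∀ j, j ≠ k → X j = X' j) →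
    ∫ x, |q X x - q X' x| ∂P ≤ D / M
  integral_abs_mean_sub_one_le : ∫ x, |∫ X, q X x ∂(Measure.pi fun _ => P) - 1| ∂P ≤ b

theorem IsSampleWeight.isBoundedDensity {P : Measure Ω} {q : (Fin M → Ω) → Ω → ℝ} {D b : ℝ}
    (hq : IsSampleWeight P q D b) (X : Fin M → Ω) : IsBoundedDensity (q X) 2 where
  measurable := hq.measurable_uncurry.comp measurable_prodMk_left
  nonneg := hq.nonneg X
  le := hq.le_two X

/-- The random measure that replaces `f dP` by the empirical measure of the sample `X` outside `Q`
and by `f q dP` on `Q`. -/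
noncomputable def sampleMeasure (P : Measure Ω) (f : Ω → ℝ) (Q : Set Ω)
    (q : (Fin M → Ω) → Ω → ℝ) (X : Fin M → Ω) : Measure Ω :=
  ∑ k, ENNReal.ofReal ((M : ℝ)⁻¹ * Qᶜ.indicator f (X k)) • Measure.dirac (X k) +
    densityMeasure P fun x => Q.indicator f x * q X x

/-- The sample points outside `Q` together with the points of `Q` of nonzero weight. -/
def sampleCarrier (Q : Set Ω) (q : (Fin M → Ω) → Ω → ℝ) (X : Fin M → Ω) : Set Ω :=
  range X \ Q ∪ {x ∈ Q | q X x ≠ 0}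

variable {P : Measure Ω} {f : Ω → ℝ} {Q : Set Ω} {q : (Fin M → Ω) → Ω → ℝ} {L D b : ℝ}

theorem isFiniteMeasure_sampleMeasure [IsFiniteMeasure P] (hf : IsBoundedDensity f L)
    (hQ : MeasurableSet Q) (hq : IsSampleWeight P q D b) (X : Fin M → Ω) :
    IsFiniteMeasure (sampleMeasure P f Q q X) := by
  have hatom (k : Fin M) : IsFiniteMeasure
      (ENNReal.ofReal ((M : ℝ)⁻¹ * Qᶜ.indicator f (X k)) • Measure.dirac (X k)) :=
    Measure.smul_finite _ ENNReal.ofReal_ne_top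
  have hdensity := ((hf.indicator hQ).mul (hq.isBoundedDensity X)).isFiniteMeasure_densityMeasure
    (P := P)
  unfold sampleMeasure
  infer_instance

theorem integral_sampleMeasure [IsFiniteMeasure P] (hf : IsBoundedDensity f L)
    (hQ : MeasurableSet Q) (hq : IsSampleWeight P q D b) (X : Fin M → Ω) {h : Ω → ℝ}
    (hh : Measurable h) {B : ℝ} (hB : ∀ x, |h x| ≤ B) :
    ∫ x, h x ∂sampleMeasure P f Q q X =
      (M : ℝ)⁻¹ * ∑ k, Qᶜ.indicator f (X k) * h (X k) + ∫ x, Q.indicator f x * h x * q X x ∂P := by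
  have := isFiniteMeasure_sampleMeasure hf hQ hq X
  have hint : Integrable h (sampleMeasure P f Q q X) :=
    Integrable.of_bound hh.aestronglyMeasurable B (ae_of_all _ hB)
  rw [sampleMeasure] at hint ⊢
  rw [integral_add_measure hint.left_of_add_measure hint.right_of_add_measure,
    ((hf.indicator hQ).mul (hq.isBoundedDensity X)).integral_densityMeasure]
  simp only [mul_right_comm _ _ (h _)]
  congr 1
  rw [integral_finsetSum_measure fun k _ => (Integrable.of_bound hh.aestronglyMeasurable B
    (ae_of_all _ hB)).smul_measure ENNReal.ofReal_ne_top, Finset.mul_sum]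
  refine Finset.sum_congr rfl fun k _ => ?_
  rw [integral_smul_measure, integral_dirac' _ _ hh.stronglyMeasurable, ENNReal.toReal_ofReal
    (mul_nonneg (by positivity) ((hf.indicator hQ.compl).nonneg _)), smul_eq_mul, mul_assoc]

theorem sampleMeasure_compl_eq_zero [MeasurableSingletonClass Ω] (hf : Measurable f)
    (hQ : MeasurableSet Q) (hq : Measurable (Function.uncurry q)) (X : Fin M → Ω) :
    sampleMeasure P f Q q X ({x | f x ≠ 0} ∩ sampleCarrier Q q X)ᶜ = 0 := by
  rw [sampleMeasure, Measure.add_apply, add_eq_zero, Measure.finsetSum_apply,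
    Finset.sum_eq_zero_iff]
  refine ⟨fun k _ => ?_, ?_⟩
  · rw [Measure.smul_apply, smul_eq_mul, mul_eq_zero]
    by_cases hk : Qᶜ.indicator f (X k) = 0
    · simp [hk]
    · right
      have hmem : X k ∈ {x | f x ≠ 0} ∩ sampleCarrier Q q X :=
        ⟨fun h => hk (by simp [h]),
          Or.inl ⟨mem_range_self k, mem_of_indicator_ne_zero hk⟩⟩
      exact measure_mono_null (compl_subset_compl.mpr (singleton_subset_iff.mpr hmem)) (by simp)
  · have hmeas : Measurable fun x => Q.indicator f x * q X x :=
      (hf.indicator hQ).mul (hq.comp measurable_prodMk_left)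
    rw [densityMeasure, withDensity_apply_eq_zero hmeas.ennreal_ofReal]
    refine measure_mono_null (fun x ⟨hx, hxG⟩ => hxG ?_) measure_empty
    have hne : Q.indicator f x * q X x ≠ 0 := fun h => hx (by simp [h])
    have hxQ := mem_of_indicator_ne_zero (left_ne_zero_of_mul hne)
    have hfx : f x ≠ 0 := by simpa only [indicator_of_mem hxQ] using left_ne_zero_of_mul hne
    exact ⟨hfx, Or.inr ⟨hxQ, right_ne_zero_of_mul hne⟩⟩

theorem integral_average_pi [IsProbabilityMeasure P] (hM : 1 ≤ M) {g : Ω → ℝ}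
    (hg : Integrable g P) :
    ∫ X : Fin M → Ω, (M : ℝ)⁻¹ * ∑ k, g (X k) ∂(Measure.pi fun _ => P) = ∫ x, g x ∂P := by
  have heval (k : Fin M) : ∫ X, g (X k) ∂(Measure.pi fun _ : Fin M => P) = ∫ x, g x ∂P :=
    integral_comp_eval (μ := fun _ : Fin M => P) hg.aestronglyMeasurable
  rw [integral_const_mul, integral_finsetSum _ fun k _ =>
    integrable_comp_eval (μ := fun _ : Fin M => P) (i := k) hg]
  simp only [heval, Finset.sum_const, Finset.card_univ, Fintype.card_fin, nsmul_eq_mul]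
  rw [inv_mul_cancel_left₀ (by positivity)]

namespace IsSampleWeight

variable [IsProbabilityMeasure P] {w : Ω → ℝ}

theorem stronglyMeasurable_integral_mul (hq : IsSampleWeight P q D b) (hw : Measurable w) :
    StronglyMeasurable fun X => ∫ x, w x * q X x ∂P :=
  StronglyMeasurable.integral_prod_right (f := fun X x => w x * q X x)
    ((hw.comp measurable_snd).mul hq.measurable_uncurry).stronglyMeasurable

theorem boundedDifferences_integral_mul (hq : IsSampleWeight P q D b) (hw : Measurable w)
    (hL : ∀ x, |w x| ≤ L) : BoundedDifferences (L * (D / M)) fun X => ∫ x, w x * q X x ∂P :=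
    fun X X' k hk => by
  obtain ⟨x₀⟩ := nonempty_of_isProbabilityMeasure P
  have hL0 : 0 ≤ L := (abs_nonneg _).trans (hL x₀)
  have hint (X : Fin M → Ω) := (hq.isBoundedDensity X).integrable (P := P)
  have hint' (X : Fin M → Ω) : Integrable (fun x => w x * q X x) P :=
    (hint X).bdd_mul hw.aestronglyMeasurable (ae_of_all _ hL)
  rw [← integral_sub (hint' X) (hint' X')]
  simp only [← mul_sub]
  calc |∫ x, w x * (q X x - q X' x) ∂P|
      ≤ ∫ x, L * |q X x - q X' x| ∂P :=
        norm_integral_le_of_norm_le (((hint X).sub (hint X')).abs.const_mul L)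
          (ae_of_all _ fun x => by
            rw [Real.norm_eq_abs, abs_mul]
            gcongr
            exact hL x)
    _ ≤ L * (D / M) := by
        rw [integral_const_mul]
        gcongr
        exact hq.integral_abs_sub_le X X' k hk

theorem integrable_uncurry (hq : IsSampleWeight P q D b) :
    Integrable (Function.uncurry q) ((Measure.pi fun _ => P).prod P) :=
  Integrable.of_bound hq.measurable_uncurry.aestronglyMeasurable 2 (ae_of_all _ fun p => by
    rw [Real.norm_eq_abs, Function.uncurry, abs_of_nonneg (hq.nonneg p.1 p.2)]
    exact hq.le_two p.1 p.2)

theorem integrable_mul_prod (hq : IsSampleWeight P q D b) (hw : Measurable w)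
    (hL : ∀ x, |w x| ≤ L) :
    Integrable (fun p : (Fin M → Ω) × Ω => w p.2 * q p.1 p.2)
      ((Measure.pi fun _ => P).prod P) :=
  hq.integrable_uncurry.bdd_mul (hw.comp measurable_snd).aestronglyMeasurable
    (ae_of_all _ fun p => hL p.2)

theorem abs_integral_integral_mul_sub_le (hq : IsSampleWeight P q D b) (hw : Measurable w)
    (hL : ∀ x, |w x| ≤ L) :
    |∫ X, ∫ x, w x * q X x ∂P ∂(Measure.pi fun _ => P) - ∫ x, w x ∂P| ≤ L * b := by
  set π := Measure.pi fun _ : Fin M => P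
  obtain ⟨x₀⟩ := nonempty_of_isProbabilityMeasure P
  have hL0 : 0 ≤ L := (abs_nonneg _).trans (hL x₀)
  have hwint : Integrable w P := Integrable.of_bound hw.aestronglyMeasurable L (ae_of_all _ hL)
  have hmean : Integrable (fun x => ∫ X, q X x ∂π) P := hq.integrable_uncurry.integral_prod_right
  rw [integral_integral_swap (hq.integrable_mul_prod hw hL)]
  simp only [integral_const_mul]
  rw [← integral_sub (hmean.bdd_mul hw.aestronglyMeasurable (ae_of_all _ hL)) hwint]
  simp only [← mul_sub_one]
  calc |∫ x, w x * (∫ X, q X x ∂π - 1) ∂P|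
      ≤ ∫ x, L * |∫ X, q X x ∂π - 1| ∂P :=
        norm_integral_le_of_norm_le ((hmean.sub (integrable_const 1)).abs.const_mul L)
          (ae_of_all _ fun x => by
            rw [Real.norm_eq_abs, abs_mul]
            gcongr
            exact hL x)
    _ ≤ L * b := by
        rw [integral_const_mul]
        gcongr
        exact hq.integral_abs_mean_sub_one_le

end IsSampleWeight

theorem abs_integral_integral_sampleMeasure_sub_le [IsProbabilityMeasure P] (hM : 1 ≤ M)
    (hf : IsBoundedDensity f L) (hQ : MeasurableSet Q) (hq : IsSampleWeight P q D b) {h : Ω → ℝ}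
    (hh : Measurable h) (hh1 : ∀ x, |h x| ≤ 1) :
    |∫ X, ∫ x, h x ∂sampleMeasure P f Q q X ∂(Measure.pi fun _ => P) -
      ∫ x, h x ∂densityMeasure P f| ≤ L * b := by
  have hI := (hf.indicator hQ).abs_mul_le hh1
  have hIm := (hf.indicator hQ).measurable.mul hh
  have hIint : Integrable (fun x => Q.indicator f x * h x) P :=
    Integrable.of_bound hIm.aestronglyMeasurable L (ae_of_all _ hI)
  have hJint : Integrable (fun x => Qᶜ.indicator f x * h x) P :=
    Integrable.of_bound ((hf.indicator hQ.compl).measurable.mul hh).aestronglyMeasurable L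
      (ae_of_all _ ((hf.indicator hQ.compl).abs_mul_le hh1))
  have hsplit : ∫ x, f x * h x ∂P =
      (∫ x, Qᶜ.indicator f x * h x ∂P) + ∫ x, Q.indicator f x * h x ∂P := by
    rw [← integral_add hJint hIint]
    simp only [← add_mul, indicator_compl_add_self_apply]
  simp only [fun X => integral_sampleMeasure hf hQ hq X hh hh1]
  rw [integral_add, integral_average_pi hM hJint, hf.integral_densityMeasure, hsplit,
    add_sub_add_left_eq_sub]
  · exact hq.abs_integral_integral_mul_sub_le hIm hI
  · exact (integrable_finsetSum _ fun k _ => integrable_comp_eval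
      (f := fun x => Qᶜ.indicator f x * h x) (μ := fun _ => P) (i := k) hJint).const_mul _
  · exact (hq.integrable_mul_prod hIm hI).integral_prod_left

/-- The exponential moments of the error come from McDiarmid's inequality: replacing a point of the
sample changes each integral by at most `L * (2 + D) / M`. -/
theorem exists_forall_abs_integral_sampleMeasure_sub_le [IsProbabilityMeasure P] (hM : 1 ≤ M)
    (hf : IsBoundedDensity f L) (hQ : MeasurableSet Q) (hq : IsSampleWeight P q D b)
    {ι : Type*} [Fintype ι] (h : ι → Ω → ℝ) (hh : ∀ i, Measurable (h i))
    (hh1 : ∀ i x, |h i x| ≤ 1) {a : ℝ}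
    (ha : 2 * Fintype.card ι * Real.exp ((L * (2 + D)) ^ 2 / 2) ≤ Real.exp (Real.sqrt M * a)) :
    ∃ X : Fin M → Ω, ∀ i, |∫ x, h i x ∂sampleMeasure P f Q q X - ∫ x, h i x ∂densityMeasure P f| ≤
      a + L * b := by
  have hM0 : (0 : ℝ) < M := by exact_mod_cast hM
  have hbdd (i : ι) : BoundedDifferences (L * (2 + D) / M) fun X =>
      ∫ x, h i x ∂sampleMeasure P f Q q X := by
    simp only [fun X => integral_sampleMeasure hf hQ hq X (hh i) (hh1 i)]
    convert! (boundedDifferences_average ((hf.indicator hQ.compl).abs_mul_le (hh1 i))).add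
      (hq.boundedDifferences_integral_mul ((hf.indicator hQ).measurable.mul (hh i))
        ((hf.indicator hQ).abs_mul_le (hh1 i))) using 1
    ring
  have hmeas (i : ι) : Measurable fun X => ∫ x, h i x ∂sampleMeasure P f Q q X := by
    simp only [fun X => integral_sampleMeasure hf hQ hq X (hh i) (hh1 i)]
    exact (Measurable.const_mul (Finset.measurable_sum _ fun k _ =>
      ((hf.indicator hQ.compl).measurable.mul (hh i)).comp (measurable_pi_apply k)) _).add
      (hq.stronglyMeasurable_integral_mul
        ((hf.indicator hQ).measurable.mul (hh i))).measurable
  obtain ⟨X, hX⟩ := exists_forall_abs_le_of_hasSubgaussianMGF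
    (fun i => (hbdd i).hasSubgaussianMGF_sub_integral (fun _ => P) (hmeas i))
    (Real.sqrt_pos.mpr hM0) (a := a) (by
      convert! ha using 3
      push_cast
      rw [Real.sq_sqrt hM0.le, Real.norm_eq_abs, sq_abs]
      field_simp)
  exact ⟨X, fun i => (abs_sub_le _ _ _).trans (add_le_add (hX i)
    (abs_integral_integral_sampleMeasure_sub_le hM hf hQ hq (hh i) (hh1 i)))⟩

end SampleMeasure

section FourierDecay

variable {d : ℕ} {s t : ℝ} {μ ν : Measure (Torus d)}

theorem hasFourierDecay_of_forall_le {A : ℝ}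
    (h : ∀ ξ, freqNorm ξ ^ (s / 2) * ‖fourierMeasure μ ξ‖ ≤ A) : HasFourierDecay s μ := by
  refine ⟨A, ?_⟩
  rintro _ ⟨ξ, rfl⟩
  simp only [norm_weightedFourier]
  exact h ξ

theorem HasFourierDecay.mono (h : HasFourierDecay s μ) (hts : t ≤ s) : HasFourierDecay t μ := by
  obtain ⟨A, -, hA⟩ := h.exists_bound
  refine hasFourierDecay_of_forall_le (A := max (‖fourierMeasure μ 0‖) A) fun ξ => ?_
  rcases eq_or_ne ξ 0 with rfl | hξ
  · refine (mul_le_of_le_one_left (norm_nonneg _) ?_).trans (le_max_left _ _)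
    rw [freqNorm_zero]
    exact Real.zero_rpow_le_one _
  · refine le_trans ?_ ((hA ξ).trans (le_max_right _ _))
    gcongr
    exact one_le_freqNorm hξ

theorem HasFourierDecay.conv [IsFiniteMeasure μ] [IsFiniteMeasure ν] (h : HasFourierDecay s ν) :
    HasFourierDecay s (μ ∗ ν) := by
  obtain ⟨A, -, hA⟩ := h.exists_bound
  refine hasFourierDecay_of_forall_le (A := μ.real univ * A) fun ξ => ?_
  rw [fourierMeasure_conv, norm_mul, mul_left_comm]
  have hw := Real.rpow_nonneg (freqNorm_nonneg ξ) (s / 2)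
  gcongr
  exacts [norm_fourierMeasure_le μ ξ, hA ξ]

theorem HasFourierDecay.smul (h : HasFourierDecay s μ) (c : ℝ≥0∞) :
    HasFourierDecay s (c • μ) := by
  obtain ⟨A, -, hA⟩ := h.exists_bound
  refine hasFourierDecay_of_forall_le (A := c.toReal * A) fun ξ => ?_
  rw [fourierMeasure_smul, norm_mul, mul_left_comm, Complex.norm_real,
    Real.norm_of_nonneg ENNReal.toReal_nonneg]
  gcongr
  exact hA ξ

end FourierDecay

section Mollifier

variable {d : ℕ} {C r t : ℝ} {φ : Measure (Torus d)}

theorem IsMollifier.rpow_mul_norm_fourierMeasure_le (hφ : IsMollifier C r φ) (hC : 1 ≤ C)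
    (hr : 0 < r) (ht : 0 ≤ t) (htd : t ≤ 2 * d) (ξ : Fin d → ℤ) :
    freqNorm ξ ^ (t / 2) * ‖fourierMeasure φ ξ‖ ≤ C ^ d * r ^ (-(t / 2)) := by
  have := hφ.isProbabilityMeasure
  rw [Real.rpow_neg hr.le, ← div_eq_mul_inv, le_div_iff₀ (by positivity), mul_right_comm,
    ← Real.mul_rpow (freqNorm_nonneg ξ) hr.le, mul_comm (freqNorm ξ) r]
  have hx : 0 ≤ r * freqNorm ξ := mul_nonneg hr.le (freqNorm_nonneg ξ)
  rcases le_total (r * freqNorm ξ) 1 with hx1 | hx1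
  · calc (r * freqNorm ξ) ^ (t / 2) * ‖fourierMeasure φ ξ‖ ≤ 1 * 1 := by
          gcongr
          exacts [Real.rpow_le_one hx hx1 (by linarith), norm_fourierMeasure_le_one φ ξ]
      _ ≤ C ^ d := by
          rw [one_mul]
          exact one_le_pow₀ hC
  · have hξ : ξ ≠ 0 := by
      rintro rfl
      rw [freqNorm_zero, mul_zero] at hx1
      linarith
    calc (r * freqNorm ξ) ^ (t / 2) * ‖fourierMeasure φ ξ‖
        ≤ (r * freqNorm ξ) ^ (d : ℝ) * (C / (r * freqNorm ξ)) ^ d := by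
          gcongr
          exacts [by linarith, hφ.norm_fourierMeasure_le ξ hξ]
      _ = C ^ d := by
          rw [Real.rpow_natCast, ← mul_pow, mul_div_cancel₀ _ (by positivity)]

theorem IsMollifier.rpow_mul_norm_fourierMeasure_le_of_inv_pow_le (hφ : IsMollifier C r φ)
    (hC : 0 ≤ C) (hr : 0 < r) (hr1 : r ≤ 1) (htd : t ≤ d) {ξ : Fin d → ℤ}
    (hξ : r⁻¹ ^ 3 ≤ freqNorm ξ) :
    freqNorm ξ ^ (t / 2) * ‖fourierMeasure φ ξ‖ ≤ C ^ d * r ^ ((d : ℝ) / 2) := by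
  have hr3 : 0 < r⁻¹ ^ 3 := by positivity
  have hx0 : 0 < freqNorm ξ := hr3.trans_le hξ
  have hx1 : 1 ≤ freqNorm ξ := (one_le_pow₀ ((one_le_inv₀ hr).mpr hr1)).trans hξ
  have hξ0 : ξ ≠ 0 := by
    rintro rfl
    exact hx0.ne' freqNorm_zero
  calc freqNorm ξ ^ (t / 2) * ‖fourierMeasure φ ξ‖
      ≤ freqNorm ξ ^ ((d : ℝ) / 2) * (C / (r * freqNorm ξ)) ^ d := by
        gcongr
        exact hφ.norm_fourierMeasure_le ξ hξ0
    _ = C ^ d * r ^ (-(d : ℝ)) * freqNorm ξ ^ (-((d : ℝ) / 2)) := by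
        rw [div_pow, mul_pow, Real.rpow_neg hr.le, Real.rpow_natCast,
          show -((d : ℝ) / 2) = (d : ℝ) / 2 - d by ring, Real.rpow_sub hx0, Real.rpow_natCast]
        field_simp
    _ ≤ C ^ d * r ^ (-(d : ℝ)) * (r⁻¹ ^ 3) ^ (-((d : ℝ) / 2)) := by
        gcongr ?_ * ?_
        exact Real.rpow_le_rpow_of_nonpos hr3 hξ (by rw [neg_nonpos]; positivity)
    _ = C ^ d * r ^ ((d : ℝ) / 2) := by
        rw [← Real.rpow_natCast r⁻¹ 3, ← Real.rpow_mul (by positivity), Real.inv_rpow hr.le,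
          ← Real.rpow_neg hr.le, mul_assoc, ← Real.rpow_add hr]
        congr 2
        push_cast
        ring

theorem IsMollifier.hasFourierDecay (hφ : IsMollifier C r φ) (hC : 1 ≤ C) (hr : 0 < r)
    (ht : 0 ≤ t) (htd : t ≤ 2 * d) : HasFourierDecay t φ :=
  hasFourierDecay_of_forall_le (hφ.rpow_mul_norm_fourierMeasure_le hC hr ht htd)

end Mollifier

section FourierClose

variable {d : ℕ} {t ε : ℝ} {μ ν ρ : Measure (Torus d)}

/-- `‖μ - ν‖_{M(t)} ≤ ε`. -/
def FourierClose (t ε : ℝ) (μ ν : Measure (Torus d)) : Prop :=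
  ∀ ξ, freqNorm ξ ^ (t / 2) * ‖fourierMeasure μ ξ - fourierMeasure ν ξ‖ ≤ ε

theorem FourierClose.trans {ε' : ℝ} (h : FourierClose t ε μ ν) (h' : FourierClose t ε' ν ρ) :
    FourierClose t (ε + ε') μ ρ := by
  intro ξ
  refine le_trans ?_ (add_le_add (h ξ) (h' ξ))
  rw [← mul_add]
  exact mul_le_mul_of_nonneg_left (norm_sub_le_norm_sub_add_norm_sub _ _ _)
    (Real.rpow_nonneg (freqNorm_nonneg ξ) _)

theorem FourierClose.mono {ε' : ℝ} (h : FourierClose t ε μ ν) (hε : ε ≤ ε') :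
    FourierClose t ε' μ ν :=
  fun ξ => (h ξ).trans hε

theorem FourierClose.inv_smul {A : ℝ} (hA : ∀ ξ, freqNorm ξ ^ (t / 2) * ‖fourierMeasure μ ξ‖ ≤ A)
    (h : FourierClose t ε ρ μ) (hρ : 1 / 2 ≤ ρ.real univ) :
    FourierClose t (2 * (ε + |ρ.real univ - 1| * A)) ((ρ univ)⁻¹ • ρ) μ := by
  intro ξ
  set c := ρ.real univ with hc
  have hc0 : 0 < c := by linarith
  have hcinv : c⁻¹ ≤ 2 := by
    rw [inv_le_comm₀ hc0 two_pos]
    linarith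
  have hsplit : (c⁻¹ : ℂ) * fourierMeasure ρ ξ - fourierMeasure μ ξ =
      (c⁻¹ : ℂ) * ((fourierMeasure ρ ξ - fourierMeasure μ ξ) -
        ((c - 1 : ℝ) : ℂ) * fourierMeasure μ ξ) := by
    have hcne : (c : ℂ) ≠ 0 := by exact_mod_cast hc0.ne'
    push_cast
    field_simp
    ring
  have hw := Real.rpow_nonneg (freqNorm_nonneg ξ) (t / 2)
  rw [fourierMeasure_smul, ENNReal.toReal_inv, ← measureReal_def, ← hc, Complex.ofReal_inv, hsplit,
    norm_mul, norm_inv, Complex.norm_real, Real.norm_of_nonneg hc0.le, mul_left_comm]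
  calc c⁻¹ * (freqNorm ξ ^ (t / 2) * ‖fourierMeasure ρ ξ - fourierMeasure μ ξ -
        ((c - 1 : ℝ) : ℂ) * fourierMeasure μ ξ‖)
      ≤ 2 * (freqNorm ξ ^ (t / 2) * (‖fourierMeasure ρ ξ - fourierMeasure μ ξ‖ +
        |c - 1| * ‖fourierMeasure μ ξ‖)) := by
        gcongr
        refine (norm_sub_le _ _).trans_eq ?_
        rw [norm_mul, Complex.norm_real, Real.norm_eq_abs]
    _ = 2 * (freqNorm ξ ^ (t / 2) * ‖fourierMeasure ρ ξ - fourierMeasure μ ξ‖ +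
        |c - 1| * (freqNorm ξ ^ (t / 2) * ‖fourierMeasure μ ξ‖)) := by ring
    _ ≤ 2 * (ε + |c - 1| * A) := by
        gcongr
        exacts [h ξ, hA ξ]

end FourierClose

section Mollification

variable {d : ℕ} {t t' l C r ε : ℝ} {μ ν φ : Measure (Torus d)}

theorem norm_fourierMeasure_sub_one_le {η : ℝ} (φ : Measure (Torus d)) [IsProbabilityMeasure φ]
    (hφ : φ (Metric.closedBall 0 η)ᶜ = 0) (ξ : Fin d → ℤ) :
    ‖fourierMeasure φ ξ - 1‖ ≤ 2 * Real.pi * (d * freqNorm ξ) * η := by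
  have hint : fourierMeasure φ ξ - 1 = ∫ x, (UnitAddTorus.mFourier (-ξ) x - 1) ∂φ := by
    rw [integral_sub (integrable_mFourier _ _) (integrable_const _)]
    simp [fourierMeasure]
  have hsum : ∑ i, |(((-ξ) i : ℤ) : ℝ)| ≤ d * freqNorm ξ := by
    calc ∑ i, |(((-ξ) i : ℤ) : ℝ)| ≤ ∑ _i : Fin d, freqNorm ξ :=
          Finset.sum_le_sum fun i _ => by simpa using abs_le_freqNorm ξ i
      _ = d * freqNorm ξ := by simp
  have hmem : ∀ᵐ x ∂φ, x ∈ Metric.closedBall 0 η := hφ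
  have hbound : ∀ᵐ x ∂φ,
      ‖UnitAddTorus.mFourier (-ξ) x - 1‖ ≤ 2 * Real.pi * (d * freqNorm ξ) * η := by
    filter_upwards [hmem] with x hx
    rw [mem_closedBall_zero_iff] at hx
    refine (norm_mFourier_sub_one_le _ _).trans ?_
    have := freqNorm_nonneg ξ
    gcongr
  simpa [hint] using norm_integral_le_of_norm_le_const hbound

theorem HasFourierDecay.eventually_norm_le (htt : t < t') (h : HasFourierDecay t' μ)
    (hε : 0 < ε) :
    ∀ᶠ R : ℝ in atTop, ∀ ξ, R ≤ freqNorm ξ → freqNorm ξ ^ (t / 2) * ‖fourierMeasure μ ξ‖ ≤ ε := by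
  obtain ⟨A, hA0, hA⟩ := h.exists_bound
  have hlim : Tendsto (fun R : ℝ => A * R ^ (-((t' - t) / 2))) atTop (𝓝 0) := by
    simpa using (tendsto_rpow_neg_atTop (by linarith : 0 < (t' - t) / 2)).const_mul A
  filter_upwards [hlim.eventually (ge_mem_nhds hε), eventually_gt_atTop 0] with R hR hR0 ξ hξ
  have hN : 0 < freqNorm ξ := hR0.trans_le hξ
  calc freqNorm ξ ^ (t / 2) * ‖fourierMeasure μ ξ‖
      = freqNorm ξ ^ (t' / 2) * ‖fourierMeasure μ ξ‖ * freqNorm ξ ^ (-((t' - t) / 2)) := by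
        rw [mul_right_comm, ← Real.rpow_add hN]
        ring_nf
    _ ≤ A * R ^ (-((t' - t) / 2)) := by
        gcongr ?_ * ?_
        exacts [hA ξ, Real.rpow_le_rpow_of_nonpos hR0 hξ (by linarith)]
    _ ≤ ε := hR

theorem HasFourierDecay.eventually_fourierClose_conv [IsProbabilityMeasure μ] (ht : 0 ≤ t)
    (htt : t < t') (h : HasFourierDecay t' μ) (hε : 0 < ε) :
    ∀ᶠ η : ℝ in 𝓝[>] 0, ∀ φ : Measure (Torus d), IsProbabilityMeasure φ →
      φ (Metric.closedBall 0 η)ᶜ = 0 → FourierClose t ε (μ ∗ φ) μ := by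
  obtain ⟨R, hR, hR0⟩ :=
    ((h.eventually_norm_le htt (half_pos hε)).and (eventually_ge_atTop 0)).exists
  have hlim : Tendsto (fun η : ℝ => R ^ (t / 2) * (2 * Real.pi * (d * R) * η)) (𝓝[>] 0) (𝓝 0) := by
    refine tendsto_nhdsWithin_of_tendsto_nhds (Continuous.tendsto' ?_ _ _ ?_)
    · fun_prop
    · simp
  filter_upwards [hlim.eventually (ge_mem_nhds hε), self_mem_nhdsWithin] with η hη hη0 φ _ hφ ξ
  have hη0' : 0 < η := hη0
  have hfactor : fourierMeasure (μ ∗ φ) ξ - fourierMeasure μ ξ =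
      fourierMeasure μ ξ * (fourierMeasure φ ξ - 1) := by
    rw [fourierMeasure_conv]
    ring
  rw [hfactor, norm_mul]
  rcases le_total (freqNorm ξ) R with hξ | hξ
  · calc freqNorm ξ ^ (t / 2) * (‖fourierMeasure μ ξ‖ * ‖fourierMeasure φ ξ - 1‖)
        ≤ R ^ (t / 2) * (1 * (2 * Real.pi * (d * R) * η)) := by
          gcongr
          · exact freqNorm_nonneg ξ
          · exact norm_fourierMeasure_le_one μ ξ
          · refine (norm_fourierMeasure_sub_one_le φ hφ ξ).trans ?_
            gcongr
      _ ≤ ε := by rwa [one_mul]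
  · have htwo : ‖fourierMeasure φ ξ - 1‖ ≤ 2 := by
      refine (norm_sub_le _ _).trans ?_
      rw [norm_one]
      linarith [norm_fourierMeasure_le_one φ ξ]
    calc freqNorm ξ ^ (t / 2) * (‖fourierMeasure μ ξ‖ * ‖fourierMeasure φ ξ - 1‖)
        = freqNorm ξ ^ (t / 2) * ‖fourierMeasure μ ξ‖ * ‖fourierMeasure φ ξ - 1‖ := by ring
      _ ≤ ε / 2 * 2 := by
          gcongr
          exact hR ξ hξ
      _ = ε := by ring

theorem IsMollifier.fourierClose_conv {M : ℝ} [IsFiniteMeasure μ] [IsFiniteMeasure ν]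
    (hφ : IsMollifier C r φ) (hC : 1 ≤ C) (hr : 0 < r) (hr1 : r ≤ 1) (ht : 0 ≤ t) (htd : t ≤ d)
    (hM : 1 ≤ M) (hbdd : ∀ ξ, ‖fourierMeasure ν ξ - fourierMeasure μ ξ‖ ≤ M)
    (hlow : ∀ ξ, freqNorm ξ ≤ r⁻¹ ^ 3 →
      ‖fourierMeasure ν ξ - fourierMeasure μ ξ‖ ≤ r ^ (l / 2)) :
    FourierClose t (M * C ^ d * r ^ min ((l - t) / 2) ((d : ℝ) / 2)) (ν ∗ φ) (μ ∗ φ) := by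
  intro ξ
  have := hφ.isProbabilityMeasure
  set e := min ((l - t) / 2) ((d : ℝ) / 2)
  have hle {a : ℝ} (ha : e ≤ a) : r ^ a ≤ r ^ e := Real.rpow_le_rpow_of_exponent_ge hr hr1 ha
  rw [fourierMeasure_conv, fourierMeasure_conv, ← sub_mul, norm_mul, mul_left_comm]
  rcases le_total (freqNorm ξ) (r⁻¹ ^ 3) with hξ | hξ
  · calc ‖fourierMeasure ν ξ - fourierMeasure μ ξ‖ * (freqNorm ξ ^ (t / 2) * ‖fourierMeasure φ ξ‖)
        ≤ r ^ (l / 2) * (C ^ d * r ^ (-(t / 2))) := by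
          have hw := Real.rpow_nonneg (freqNorm_nonneg ξ) (t / 2)
          gcongr ?_ * ?_
          exacts [hlow ξ hξ, hφ.rpow_mul_norm_fourierMeasure_le hC hr ht (by linarith) ξ]
      _ = C ^ d * r ^ ((l - t) / 2) := by
          rw [mul_left_comm, ← Real.rpow_add hr]
          ring_nf
      _ ≤ M * C ^ d * r ^ e := by
          gcongr ?_ * ?_
          · exact le_mul_of_one_le_left (by positivity) hM
          · exact hle (min_le_left _ _)
  · calc ‖fourierMeasure ν ξ - fourierMeasure μ ξ‖ * (freqNorm ξ ^ (t / 2) * ‖fourierMeasure φ ξ‖)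
        ≤ M * (C ^ d * r ^ ((d : ℝ) / 2)) := by
          have hw := Real.rpow_nonneg (freqNorm_nonneg ξ) (t / 2)
          gcongr ?_ * ?_
          exacts [hbdd ξ, hφ.rpow_mul_norm_fourierMeasure_le_of_inv_pow_le (by linarith) hr hr1
            htd hξ]
      _ = M * C ^ d * r ^ ((d : ℝ) / 2) := by ring
      _ ≤ M * C ^ d * r ^ e := by
          gcongr ?_ * ?_
          exact hle (min_le_right _ _)

theorem abs_measureReal_univ_sub (μ ν : Measure (Torus d)) :
    |ν.real univ - μ.real univ| = ‖fourierMeasure ν 0 - fourierMeasure μ 0‖ := by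
  rw [fourierMeasure_zero_freq, fourierMeasure_zero_freq, ← Complex.ofReal_sub, Complex.norm_real,
    Real.norm_eq_abs]

theorem measureReal_conv_univ [IsFiniteMeasure μ] [IsFiniteMeasure ν] :
    (μ ∗ ν).real univ = μ.real univ * ν.real univ := by
  have h := fourierMeasure_conv μ ν 0
  simp only [fourierMeasure_zero_freq] at h
  exact_mod_cast h

theorem tendsto_rpow_nhdsGT_zero {a : ℝ} (ha : 0 < a) :
    Tendsto (fun r : ℝ => r ^ a) (𝓝[>] 0) (𝓝 0) := by
  have h := (Real.continuousAt_rpow_const 0 a (Or.inr ha.le)).tendsto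
  rw [Real.zero_rpow ha.ne'] at h
  exact tendsto_nhdsWithin_of_tendsto_nhds h

theorem HasFourierDecay.eventually_fourierClose_normalized [IsProbabilityMeasure μ] (hd : 1 ≤ d)
    (ht : 0 ≤ t) (htd : t ≤ d) (htt : t < t') (htl : t < l) (hC : 1 ≤ C)
    (h : HasFourierDecay t' μ) (hε : 0 < ε) :
    ∀ᶠ r : ℝ in 𝓝[>] 0, ∀ φ : Measure (Torus d), IsMollifier C r φ →
      ∀ ν : Measure (Torus d), IsFiniteMeasure ν →
      (∀ ξ, freqNorm ξ ≤ r⁻¹ ^ 3 → ‖fourierMeasure ν ξ - fourierMeasure μ ξ‖ ≤ r ^ (l / 2)) →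
      ν ∗ φ ≠ 0 ∧ FourierClose t ε (((ν ∗ φ) univ)⁻¹ • (ν ∗ φ)) μ := by
  obtain ⟨A, hA0, hA⟩ := (h.mono htt.le).exists_bound
  set e := min ((l - t) / 2) ((d : ℝ) / 2)
  have hd' : (1 : ℝ) ≤ d := by exact_mod_cast hd
  have he0 : 0 < e := lt_min (by linarith) (by linarith)
  have hmass := tendsto_rpow_nhdsGT_zero (by linarith : 0 < l / 2)
  have herror : Tendsto (fun r : ℝ => 3 * C ^ d * r ^ e + r ^ (l / 2) * A) (𝓝[>] 0) (𝓝 0) := by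
    simpa using ((tendsto_rpow_nhdsGT_zero he0).const_mul (3 * C ^ d)).add (hmass.mul_const A)
  filter_upwards [h.eventually_fourierClose_conv ht htt (by positivity : 0 < ε / 4),
    herror.eventually (ge_mem_nhds (by positivity : 0 < ε / 4)),
    hmass.eventually (ge_mem_nhds (by norm_num : (0 : ℝ) < 1 / 2)),
    Ioo_mem_nhdsGT one_pos] with r hconv hr_error hr_mass hr φ hφ ν _ hlow
  have := hφ.isProbabilityMeasure
  have hmassν : |ν.real univ - 1| ≤ r ^ (l / 2) := by
    have := hlow 0 (by rw [freqNorm_zero]; have := hr.1; positivity)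
    rwa [← abs_measureReal_univ_sub, probReal_univ (μ := μ)] at this
  obtain ⟨hmass_ge, hmass_le⟩ := abs_le.mp hmassν
  have hbdd (ξ) : ‖fourierMeasure ν ξ - fourierMeasure μ ξ‖ ≤ 3 := by
    refine (norm_sub_le _ _).trans ?_
    linarith [norm_fourierMeasure_le ν ξ, norm_fourierMeasure_le_one μ ξ]
  have hmass_conv : (ν ∗ φ).real univ = ν.real univ := by
    rw [measureReal_conv_univ, probReal_univ (μ := φ), mul_one]
  have hclose := (hφ.fourierClose_conv hC hr.1 hr.2.le ht htd (by norm_num) hbdd hlow).trans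
    (hconv φ hφ.isProbabilityMeasure hφ.measure_compl_closedBall)
  constructor
  · intro hzero
    rw [hzero, measureReal_zero_apply] at hmass_conv
    linarith
  · refine (hclose.inv_smul hA (by rw [hmass_conv]; linarith)).mono ?_
    rw [hmass_conv]
    have := mul_le_mul_of_nonneg_right hmassν hA0
    linarith

end Mollification

section SupportPairTopology

theorem support_subset_of_tendsto {ι X : Type*} [MetricSpace X] [SecondCountableTopology X]
    [MeasurableSpace X] [OpensMeasurableSpace X] {l : Filter ι} [l.NeBot]
    {μs : ι → ProbabilityMeasure X} {μ : ProbabilityMeasure X} {Es : ι → NonemptyCompacts X}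
    {E : NonemptyCompacts X} (hμ : Tendsto μs l (𝓝 μ)) (hE : Tendsto Es l (𝓝 E))
    (h : ∀ i, (μs i : Measure X).support ⊆ Es i) : (μ : Measure X).support ⊆ E := by
  intro x hx
  by_contra hxE
  obtain ⟨δ, hδ, hdisj⟩ :=
    (disjoint_singleton_right.mpr hxE).exists_thickenings E.isCompact isClosed_singleton
  rw [Metric.thickening_singleton] at hdisj
  have hnull : ∀ᶠ i in l, (μs i : Measure X) (Metric.ball x δ) = 0 := by
    have hopen := NonemptyCompacts.isOpen_subsets_of_isOpen
      (Metric.isOpen_thickening (δ := δ) (E := (E : Set X)))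
    have hmem := Metric.self_subset_thickening hδ (E : Set X)
    filter_upwards [hE.eventually (hopen.mem_nhds hmem)] with i hi
    refine measure_mono_null ?_ (Measure.measure_compl_support (μ := (μs i : Measure X)))
    exact fun y hy hys => Set.disjoint_left.mp hdisj (hi (h i hys)) hy
  have hle := ProbabilityMeasure.le_liminf_measure_open_of_tendsto hμ
    (Metric.isOpen_ball (x := x) (ε := δ))
  rw [liminf_congr hnull, liminf_const] at hle
  exact (Measure.mem_support_iff_forall x |>.mp hx _
    (Metric.ball_mem_nhds x hδ)).not_ge hle

variable {d : ℕ} {β s t : ℝ} {ι : Type*} {l : Filter ι}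

theorem fourierMeasure_tendsto {μs : ι → ProbabilityMeasure (Torus d)}
    {μ : ProbabilityMeasure (Torus d)} (h : Tendsto μs l (𝓝 μ)) (ξ : Fin d → ℤ) :
    Tendsto (fun i => fourierMeasure (μs i : Measure (Torus d)) ξ) l
      (𝓝 (fourierMeasure (μ : Measure (Torus d)) ξ)) := by
  have hint := ProbabilityMeasure.tendsto_iff_forall_integral_tendsto.mp h
  have hre := hint (.mkOfCompact ⟨fun x => (UnitAddTorus.mFourier (-ξ) x).re, by fun_prop⟩)
  have him := hint (.mkOfCompact ⟨fun x => (UnitAddTorus.mFourier (-ξ) x).im, by fun_prop⟩)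
  have hre_im (ν : ProbabilityMeasure (Torus d)) : fourierMeasure (ν : Measure (Torus d)) ξ =
      ((∫ x, (UnitAddTorus.mFourier (-ξ) x).re ∂(ν : Measure (Torus d)) : ℝ) : ℂ) +
      ((∫ x, (UnitAddTorus.mFourier (-ξ) x).im ∂(ν : Measure (Torus d)) : ℝ) : ℂ) * Complex.I :=
    (integral_re_add_im (𝕜 := ℂ) (integrable_mFourier (-ξ) _)).symm
  simp only [hre_im]
  exact ((Complex.continuous_ofReal.tendsto _).comp hre).add
    (((Complex.continuous_ofReal.tendsto _).comp him).mul_const _)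

theorem hasFourierDecay_of_tendstoUniformly [l.NeBot] {μs : ι → Measure (Torus d)}
    {μ : Measure (Torus d)} (hμs : ∀ i, HasFourierDecay s (μs i))
    (h : TendstoUniformly (fun i => weightedFourier s (μs i)) (weightedFourier s μ) l) :
    HasFourierDecay s μ := by
  obtain ⟨i, hi⟩ := (Metric.tendstoUniformly_iff.mp h 1 one_pos).exists
  obtain ⟨A, hA⟩ := hμs i
  refine ⟨A + 1, ?_⟩
  rintro _ ⟨ξ, rfl⟩
  refine (norm_le_norm_add_norm_sub' _ (weightedFourier s (μs i) ξ)).trans ?_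
  exact add_le_add (hA ⟨ξ, rfl⟩) ((dist_eq_norm _ _).symm.trans_le (hi ξ).le)

theorem norm_weightedFourier_sub (t : ℝ) (μ ν : Measure (Torus d)) (ξ : Fin d → ℤ) :
    ‖weightedFourier t μ ξ - weightedFourier t ν ξ‖ =
      freqNorm ξ ^ (t / 2) * ‖fourierMeasure μ ξ - fourierMeasure ν ξ‖ := by
  rw [weightedFourier, weightedFourier, ← mul_sub, norm_mul, Complex.norm_real,
    Real.norm_of_nonneg (Real.rpow_nonneg (freqNorm_nonneg ξ) _)]

theorem norm_weightedFourier_sub_le_of_le (hts : t ≤ s) (μ ν : Measure (Torus d))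
    [IsProbabilityMeasure μ] [IsProbabilityMeasure ν] (ξ : Fin d → ℤ) :
    ‖weightedFourier t μ ξ - weightedFourier t ν ξ‖ ≤
      ‖weightedFourier s μ ξ - weightedFourier s ν ξ‖ := by
  rw [norm_weightedFourier_sub, norm_weightedFourier_sub]
  rcases eq_or_ne ξ 0 with rfl | hξ
  · rw [fourierMeasure_zero_freq, fourierMeasure_zero_freq, probReal_univ, probReal_univ, sub_self,
      norm_zero, mul_zero, mul_zero]
  · gcongr
    exact one_le_freqNorm hξ

theorem tendstoUniformly_weightedFourier_of_le (hts : t ≤ s)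
    {μs : ι → ProbabilityMeasure (Torus d)} {μ : ProbabilityMeasure (Torus d)}
    (h : TendstoUniformly (fun i => weightedFourier s (μs i : Measure (Torus d)))
      (weightedFourier s (μ : Measure (Torus d))) l) :
    TendstoUniformly (fun i => weightedFourier t (μs i : Measure (Torus d)))
      (weightedFourier t (μ : Measure (Torus d))) l := by
  rw [Metric.tendstoUniformly_iff] at h ⊢
  intro ε hε
  filter_upwards [h ε hε] with i hi ξ
  refine lt_of_le_of_lt ?_ (hi ξ)
  rw [dist_eq_norm, dist_eq_norm]
  exact norm_weightedFourier_sub_le_of_le hts _ _ ξ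

theorem SupportPair.tendsto_iff {u : ι → SupportPair d β} {p : SupportPair d β} :
    Tendsto u l (𝓝 p) ↔ Tendsto (fun i => (u i).set) l (𝓝 p.set) ∧
      ∀ t : Ico (0 : ℝ) β, TendstoUniformly
        (fun i => weightedFourier (t : ℝ) ((u i).measure : Measure (Torus d)))
        (weightedFourier (t : ℝ) (p.measure : Measure (Torus d))) l := by
  rw [nhds_induced, tendsto_comap_iff, nhds_prod_eq, tendsto_prod_iff', tendsto_pi_nhds]
  refine and_congr Iff.rfl (forall_congr' fun t => ?_)
  rw [UniformFun.tendsto_iff_tendstoUniformly]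
  rfl

/-- A sequence in `[0, β)` converging to `β`; countably many of the seminorms `‖·‖_{M(t)}` with
`t ∈ [0, β)` suffice to define the topology of `𝒳_β`. -/
noncomputable def exponentSeq (β : ℝ) (k : ℕ) : ℝ := β - β / (k + 2)

theorem exponentSeq_mem (hβ : 0 < β) (k : ℕ) : exponentSeq β k ∈ Ico (0 : ℝ) β := by
  have hk1 : (1 : ℝ) ≤ k + 2 := by linarith [(Nat.cast_nonneg k : (0 : ℝ) ≤ k)]
  exact ⟨sub_nonneg.mpr (div_le_self hβ.le hk1), sub_lt_self _ (by positivity)⟩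

theorem eventually_le_exponentSeq (ht : t < β) : ∀ᶠ k in atTop, t ≤ exponentSeq β k := by
  have hlim : Tendsto (exponentSeq β) atTop (𝓝 (β - 0)) :=
    tendsto_const_nhds.sub (Tendsto.const_div_atTop
      (tendsto_atTop_add_const_right _ _ tendsto_natCast_atTop_atTop) β)
  rw [sub_zero] at hlim
  exact hlim.eventually (le_mem_nhds ht)

theorem SupportPair.dense_of_approx (hβ : 0 < β) {S : Set (SupportPair d β)}
    (h : ∀ p : SupportPair d β, ∀ t ∈ Ico (0 : ℝ) β, ∀ ε > 0, ∃ p' ∈ S, dist p'.set p.set ≤ ε ∧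
      FourierClose t ε (p'.measure : Measure (Torus d)) (p.measure : Measure (Torus d))) :
    Dense S := by
  intro p
  choose u huS hu_dist hu_close using fun k : ℕ => h p (exponentSeq β k) (exponentSeq_mem hβ k)
    (1 / ((k : ℝ) + 1)) (by positivity)
  refine mem_closure_of_tendsto (f := u) (b := atTop) ?_ (Eventually.of_forall huS)
  have hlim : Tendsto (fun k : ℕ => 1 / ((k : ℝ) + 1)) atTop (𝓝 0) :=
    tendsto_one_div_add_atTop_nhds_zero_nat
  refine SupportPair.tendsto_iff.mpr ⟨?_, fun t => ?_⟩
  · rw [tendsto_iff_dist_tendsto_zero]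
    exact squeeze_zero (fun _ => dist_nonneg) hu_dist hlim
  · rw [Metric.tendstoUniformly_iff]
    intro ε hε
    filter_upwards [hlim.eventually (gt_mem_nhds hε), eventually_le_exponentSeq t.2.2]
      with k hk hkt ξ
    rw [dist_comm, dist_eq_norm]
    refine (norm_weightedFourier_sub_le_of_le hkt _ _ ξ).trans_lt ?_
    rw [norm_weightedFourier_sub]
    exact (hu_close k ξ).trans_lt hk

/-- The embedding of `𝒳_β` as a closed subset of a completely metrizable space: the set together
with the weighted Fourier transforms for the exponents `exponentSeq β k`. -/
noncomputable def SupportPair.toSeq (p : SupportPair d β) :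
    NonemptyCompacts (Torus d) × (ℕ → ((Fin d → ℤ) →ᵤ ℂ)) :=
  (p.set, fun k => UniformFun.ofFun
    (weightedFourier (exponentSeq β k) (p.measure : Measure (Torus d))))

theorem SupportPair.tendsto_toSeq_iff (hβ : 0 < β) {u : ι → SupportPair d β}
    {p : SupportPair d β} :
    Tendsto (fun i => (u i).toSeq) l (𝓝 p.toSeq) ↔ Tendsto u l (𝓝 p) := by
  simp only [SupportPair.tendsto_iff, toSeq, nhds_prod_eq, tendsto_prod_iff', tendsto_pi_nhds,
    UniformFun.tendsto_iff_tendstoUniformly]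
  refine and_congr_right fun _ => ⟨fun h t => ?_, fun h k => h ⟨_, exponentSeq_mem hβ k⟩⟩
  obtain ⟨k, hk⟩ := (eventually_le_exponentSeq t.2.2).exists
  exact tendstoUniformly_weightedFourier_of_le hk (h k)

theorem SupportPair.isInducing_toSeq (hβ : 0 < β) :
    IsInducing (SupportPair.toSeq : SupportPair d β → _) := by
  refine isInducing_iff_nhds.mpr fun p => le_antisymm ?_ ?_
  · exact tendsto_iff_comap.mp ((SupportPair.tendsto_toSeq_iff hβ).mpr tendsto_id)
  · exact (SupportPair.tendsto_toSeq_iff hβ (u := id)).mp tendsto_comap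

theorem SupportPair.isClosed_range_toSeq (hβ : 0 < β) :
    IsClosed (range (SupportPair.toSeq : SupportPair d β → _)) := by
  refine isSeqClosed_iff_isClosed.mp fun v y hv hy => ?_
  choose u hu using hv
  obtain rfl : (fun n => (u n).toSeq) = v := funext hu
  let 𝒢 : Ultrafilter ℕ := Ultrafilter.of atTop
  obtain ⟨μ, -, hμ⟩ := (isCompact_univ (X := ProbabilityMeasure (Torus d))).ultrafilter_le_nhds
    (𝒢.map fun n => (u n).measure) (by simp)
  have hy' : Tendsto (fun n => (u n).toSeq) 𝒢 (𝓝 y) := hy.mono_left (Ultrafilter.of_le _)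
  obtain ⟨E, g⟩ := y
  simp only [SupportPair.toSeq, nhds_prod_eq, tendsto_prod_iff', tendsto_pi_nhds,
    UniformFun.tendsto_iff_tendstoUniformly] at hy'
  obtain ⟨hE, hg⟩ := hy'
  have hgμ (k : ℕ) : UniformFun.toFun (g k) =
      weightedFourier (exponentSeq β k) (μ : Measure (Torus d)) := by
    ext ξ
    exact tendsto_nhds_unique ((hg k).tendsto_at ξ) ((fourierMeasure_tendsto hμ ξ).const_mul _)
  have hdecay (k : ℕ) : HasFourierDecay (exponentSeq β k) (μ : Measure (Torus d)) :=
    hasFourierDecay_of_tendstoUniformly (fun n => (u n).decay _ (exponentSeq_mem hβ k))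
      (hgμ k ▸ hg k)
  have hsupp := support_subset_of_tendsto hμ hE fun n => (u n).support_subset
  refine ⟨⟨E, μ, hsupp, fun t ht => ?_⟩, ?_⟩
  · obtain ⟨k, hk⟩ := (eventually_le_exponentSeq ht.2).exists
    exact (hdecay k).mono hk
  · exact Prod.ext rfl (funext fun k => UniformFun.toFun.injective (hgμ k).symm)

theorem SupportPair.baireSpace (hβ : 0 < β) : BaireSpace (SupportPair d β) := by
  have hind := SupportPair.isInducing_toSeq (d := d) hβ
  let _ : UniformSpace (SupportPair d β) :=
    (UniformSpace.comap SupportPair.toSeq inferInstance).replaceTopology hind.eq_induced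
  have hui : IsUniformInducing (SupportPair.toSeq : SupportPair d β → _) := ⟨rfl⟩
  have : CompleteSpace (SupportPair d β) :=
    hui.completeSpace (SupportPair.isClosed_range_toSeq hβ).isComplete
  have : IsCountablyGenerated (uniformity (SupportPair d β)) := by
    rw [← hui.comap_uniformity]
    infer_instance
  infer_instance

end SupportPairTopology

section BoundedDensity

variable {Ω : Type*} [MeasurableSpace Ω] {P μ : Measure Ω} {K : Set Ω} {L : ℝ≥0}

theorem rnDeriv_ae_le_of_le_smul [SigmaFinite P] [SigmaFinite μ] (h : μ ≤ (L : ℝ≥0∞) • P) :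
    ∀ᵐ x ∂P, μ.rnDeriv P x ≤ L := by
  have hac : μ ≪ P :=
    (Measure.absolutelyContinuous_of_le h).trans Measure.smul_absolutelyContinuous
  refine ae_le_of_forall_setLIntegral_le_of_sigmaFinite (Measure.measurable_rnDeriv _ _)
    fun s _ _ => ?_
  rw [Measure.setLIntegral_rnDeriv hac, setLIntegral_const]
  exact h s

theorem exists_isBoundedDensity [SigmaFinite P] [SigmaFinite μ] (h : μ ≤ (L : ℝ≥0∞) • P)
    (hK : MeasurableSet K) (hμK : μ Kᶜ = 0) :
    ∃ f, IsBoundedDensity f L ∧ (∀ x ∉ K, f x = 0) ∧ densityMeasure P f = μ := by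
  have hac : μ ≪ P :=
    (Measure.absolutelyContinuous_of_le h).trans Measure.smul_absolutelyContinuous
  set f : Ω → ℝ := K.indicator fun x => min (μ.rnDeriv P x).toReal L with hf
  have hfL : IsBoundedDensity f L := by
    refine ⟨((Measure.measurable_rnDeriv _ _).ennreal_toReal.min measurable_const).indicator hK,
      indicator_nonneg fun _ _ => le_min ENNReal.toReal_nonneg L.2, fun x => ?_⟩
    exact indicator_apply_le' (fun _ => min_le_right _ _) fun _ => L.2
  have hae : (fun x => ENNReal.ofReal (f x)) =ᵐ[P] K.indicator (μ.rnDeriv P) := by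
    filter_upwards [rnDeriv_ae_le_of_le_smul h] with x hx
    by_cases hxK : x ∈ K
    · have hle : (μ.rnDeriv P x).toReal ≤ L := ENNReal.toReal_mono ENNReal.coe_ne_top hx
      simp [hf, hxK, min_eq_left hle,
        ENNReal.ofReal_toReal (ne_top_of_le_ne_top ENNReal.coe_ne_top hx)]
    · simp [hf, hxK]
  refine ⟨f, hfL, fun x hx => indicator_of_notMem hx _, ?_⟩
  rw [densityMeasure, withDensity_congr_ae hae, withDensity_indicator hK,
    ← restrict_withDensity hK, Measure.withDensity_rnDeriv_eq _ _ hac]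
  exact Measure.restrict_eq_self_of_ae_mem hμK

end BoundedDensity

section Mixture

/-- The convex combination `(1 - a) μ + a σ` of two measures, meant for `0 ≤ a ≤ 1`. -/
noncomputable def mixture {Ω : Type*} [MeasurableSpace Ω] (a : ℝ) (μ σ : Measure Ω) : Measure Ω :=
  ENNReal.ofReal (1 - a) • μ + ENNReal.ofReal a • σ

section

variable {Ω : Type*} [MeasurableSpace Ω] {μ σ : Measure Ω} {a : ℝ}

theorem isProbabilityMeasure_mixture [IsProbabilityMeasure μ] [IsProbabilityMeasure σ]
    (ha : 0 ≤ a) (ha1 : a ≤ 1) : IsProbabilityMeasure (mixture a μ σ) := by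
  constructor
  simp only [mixture, Measure.coe_add, Measure.coe_smul, Pi.add_apply, Pi.smul_apply, measure_univ,
    smul_eq_mul, mul_one]
  rw [← ENNReal.ofReal_add (by linarith) ha, sub_add_cancel, ENNReal.ofReal_one]

theorem mixture_apply_eq_zero {Z : Set Ω} (hμ : μ Z = 0) (hσ : σ Z = 0) :
    mixture a μ σ Z = 0 := by
  simp [mixture, hμ, hσ]

theorem mixture_apply_pos {Z : Set Ω} (ha : 0 < a) (hσ : 0 < σ Z) : 0 < mixture a μ σ Z := by
  have hpos : 0 < ENNReal.ofReal a * σ Z := ENNReal.mul_pos (by simpa using ha) hσ.ne'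
  exact hpos.trans_le (by simp [mixture])

end

variable {d : ℕ} {a t ε : ℝ} {μ σ φ : Measure (Torus d)}

theorem fourierMeasure_mixture [IsFiniteMeasure μ] [IsFiniteMeasure σ] (ha : 0 ≤ a) (ha1 : a ≤ 1)
    (ξ : Fin d → ℤ) : fourierMeasure (mixture a μ σ) ξ =
      fourierMeasure μ ξ + a * (fourierMeasure σ ξ - fourierMeasure μ ξ) := by
  have := Measure.smul_finite μ (c := ENNReal.ofReal (1 - a)) ENNReal.ofReal_ne_top
  have := Measure.smul_finite σ (c := ENNReal.ofReal a) ENNReal.ofReal_ne_top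
  rw [mixture, fourierMeasure_add, fourierMeasure_smul, fourierMeasure_smul,
    ENNReal.toReal_ofReal (by linarith), ENNReal.toReal_ofReal ha]
  push_cast
  ring

theorem norm_fourierMeasure_mixture_sub_le [IsProbabilityMeasure μ] [IsProbabilityMeasure σ]
    (ha : 0 ≤ a) (ha1 : a ≤ 1) (ξ : Fin d → ℤ) :
    ‖fourierMeasure (mixture a μ σ) ξ - fourierMeasure μ ξ‖ ≤ 2 * a := by
  have hle : ‖fourierMeasure σ ξ - fourierMeasure μ ξ‖ ≤ 1 + 1 :=
    (norm_sub_le _ _).trans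
      (add_le_add (norm_fourierMeasure_le_one σ ξ) (norm_fourierMeasure_le_one μ ξ))
  rw [fourierMeasure_mixture ha ha1, add_sub_cancel_left, norm_mul, Complex.norm_real,
    Real.norm_of_nonneg ha]
  nlinarith

theorem exists_fourierClose_mixture_conv [IsProbabilityMeasure μ] [IsProbabilityMeasure σ]
    [IsFiniteMeasure φ] (hφ : HasFourierDecay t φ) (hε : 0 < ε) :
    ∃ a, 0 < a ∧ a ≤ 1 ∧ FourierClose t ε (mixture a μ σ ∗ φ) (μ ∗ φ) := by
  obtain ⟨A, hA0, hA⟩ := hφ.exists_bound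
  set a := min 1 (ε / (2 * (A + 1)))
  have ha : 0 < a := lt_min one_pos (by positivity)
  have ha1 : a ≤ 1 := min_le_left _ _
  have haA : a * (2 * (A + 1)) ≤ ε :=
    (le_div_iff₀ (by positivity)).mp (min_le_right _ _)
  have := isProbabilityMeasure_mixture (μ := μ) (σ := σ) ha.le ha1
  refine ⟨a, ha, ha1, fun ξ => ?_⟩
  have hw := Real.rpow_nonneg (freqNorm_nonneg ξ) (t / 2)
  rw [fourierMeasure_conv, fourierMeasure_conv, ← sub_mul, norm_mul]
  calc freqNorm ξ ^ (t / 2) *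
        (‖fourierMeasure (mixture a μ σ) ξ - fourierMeasure μ ξ‖ * ‖fourierMeasure φ ξ‖)
      ≤ freqNorm ξ ^ (t / 2) * (2 * a * ‖fourierMeasure φ ξ‖) := by
        gcongr
        exact norm_fourierMeasure_mixture_sub_le ha.le ha1 ξ
    _ = 2 * a * (freqNorm ξ ^ (t / 2) * ‖fourierMeasure φ ξ‖) := by ring
    _ ≤ 2 * a * A := by gcongr; exact hA ξ
    _ ≤ ε := by linarith

end Mixture

section SpreadNear

variable {d : ℕ} {η t t' C ε : ℝ} {E : Set (Torus d)} {μ τ φ : Measure (Torus d)}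

/-- `μ` is a probability measure with bounded density and Fourier decay which lives within
distance `η` of `E` and charges the `η`-ball about every point of `E`. -/
structure IsSpreadNear (E : Set (Torus d)) (η : ℝ) (μ : Measure (Torus d)) : Prop where
  isProbabilityMeasure : IsProbabilityMeasure μ
  exists_le_smul_volume : ∃ L : ℝ≥0, μ ≤ (L : ℝ≥0∞) • volume
  measure_compl_cthickening : μ (Metric.cthickening η E)ᶜ = 0
  measure_closedBall_pos : ∀ y ∈ E, 0 < μ (Metric.closedBall y η)
  hasFourierDecay : ∀ s : ℝ, 0 ≤ s → s ≤ 2 * d → HasFourierDecay s μ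

theorem IsMollifier.isSpreadNear_conv [IsProbabilityMeasure τ] (hφ : IsMollifier C η φ)
    (hφL : ∃ L : ℝ≥0, φ ≤ (L : ℝ≥0∞) • volume) (hC : 1 ≤ C) (hη : 0 < η)
    (hτ : τ (Metric.cthickening η E)ᶜ = 0) (hpos : ∀ y ∈ E, 0 < τ (Metric.closedBall y η)) :
    IsSpreadNear E (2 * η) (τ ∗ φ) := by
  have := hφ.isProbabilityMeasure
  refine ⟨inferInstance, hφL.imp fun L hL => conv_le_smul_of_le hL, ?_, fun y hy => ?_,
    fun s hs hsd => (hφ.hasFourierDecay hC hη hs hsd).conv⟩ <;> rw [two_mul]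
  · exact measure_mono_null
      (compl_subset_compl.mpr (Metric.cthickening_cthickening_subset hη.le hη.le E))
      (conv_compl_cthickening_eq_zero hτ hφ.measure_compl_closedBall)
  · exact (hpos y hy).trans_le (measure_closedBall_le_conv hφ.measure_compl_closedBall y η)

theorem exists_isProbabilityMeasure_thickening (hE : E.Nonempty) (hη : 0 < η) :
    ∃ σ : Measure (Torus d), IsProbabilityMeasure σ ∧ σ (Metric.cthickening η E)ᶜ = 0 ∧
      ∀ y ∈ E, 0 < σ (Metric.closedBall y η) := by
  obtain ⟨z, hz⟩ := hE
  have hopen : IsOpen (Metric.thickening η E) := Metric.isOpen_thickening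
  have hne : volume (Metric.thickening η E) ≠ 0 :=
    (hopen.measure_pos volume ⟨z, Metric.self_subset_thickening hη E hz⟩).ne'
  refine ⟨ProbabilityTheory.cond volume (Metric.thickening η E),
    ProbabilityTheory.cond_isProbabilityMeasure hne, ?_, fun y hy => ?_⟩ <;>
    rw [ProbabilityTheory.cond_apply hopen.measurableSet]
  · have hempty : Metric.thickening η E ∩ (Metric.cthickening η E)ᶜ = ∅ :=
      (disjoint_compl_right_iff_subset.mpr (Metric.thickening_subset_cthickening η E)).inter_eq
    rw [hempty, measure_empty, mul_zero]
  · refine ENNReal.mul_pos (ENNReal.inv_ne_zero.mpr (measure_ne_top _ _)) ?_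
    refine ((Metric.measure_ball_pos volume y hη).trans_le (measure_mono ?_)).ne'
    exact fun x hx =>
      ⟨Metric.mem_thickening_iff.mpr ⟨y, hy, hx⟩, Metric.ball_subset_closedBall hx⟩

/-- A small mass spread over a neighbourhood of `E` is added before mollifying, so that every point
of `E` stays close to the support. -/
theorem exists_isSpreadNear [IsProbabilityMeasure μ] (hd : 1 ≤ d) (hE : E.Nonempty)
    (hμE : μ Eᶜ = 0) (ht : 0 ≤ t) (htd : t ≤ d) (htt : t < t') (hμ : HasFourierDecay t' μ)
    (hε : 0 < ε) {η₁ : ℝ} (hη₁ : 0 < η₁) :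
    ∃ η μ', 0 < η ∧ η ≤ η₁ ∧ IsSpreadNear E η μ' ∧ FourierClose t ε μ' μ := by
  obtain ⟨C, hC, hmollifier⟩ := exists_mollifier hd
  obtain ⟨η, hclose, hηmem⟩ := ((hμ.eventually_fourierClose_conv ht htt (half_pos hε)).and
    (Ioc_mem_nhdsGT (show (0 : ℝ) < min (1 / 2) (η₁ / 2) by positivity))).exists
  obtain ⟨hη, hηle⟩ := hηmem
  obtain ⟨φ, hφ, hφL⟩ := hmollifier η hη (hηle.trans (min_le_left _ _))
  have hφP := hφ.isProbabilityMeasure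
  obtain ⟨σ, hσP, hσE, hσpos⟩ := exists_isProbabilityMeasure_thickening hE hη
  have hφt : HasFourierDecay t φ :=
    hφ.hasFourierDecay hC hη ht (by linarith [(Nat.cast_nonneg d : (0 : ℝ) ≤ d)])
  obtain ⟨a, ha, ha1, hmix⟩ :=
    exists_fourierClose_mixture_conv (μ := μ) (σ := σ) hφt (half_pos hε)
  have := isProbabilityMeasure_mixture (μ := μ) (σ := σ) ha.le ha1
  have hμη : μ (Metric.cthickening η E)ᶜ = 0 :=
    measure_mono_null (compl_subset_compl.mpr (Metric.self_subset_cthickening E)) hμE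
  refine ⟨2 * η, mixture a μ σ ∗ φ, by positivity, ?_, ?_, ?_⟩
  · linarith [hηle.trans (min_le_right _ _)]
  · exact hφ.isSpreadNear_conv hφL hC hη (mixture_apply_eq_zero hμη hσE)
      fun y hy => mixture_apply_pos ha (hσpos y hy)
  · simpa using hmix.trans (hclose φ hφP hφ.measure_compl_closedBall)

end SpreadNear

section FiniteNet

variable {X : Type*} [PseudoMetricSpace X] [MeasurableSpace X] {μ : Measure X} {E : Set X}

theorem exists_finset_cover_forall_le_measureReal [IsFiniteMeasure μ] (hE : IsCompact E) {η : ℝ}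
    (hη : 0 < η) (hpos : ∀ y ∈ E, 0 < μ (Metric.closedBall y η)) :
    ∃ F : Finset X, E ⊆ ⋃ y ∈ F, Metric.ball y η ∧
      ∃ κ > 0, ∀ y ∈ F, κ ≤ μ.real (Metric.closedBall y η) := by
  obtain ⟨F, hFE, hF, hcover⟩ := finite_cover_balls_of_compact hE hη
  lift F to Finset X using hF
  refine ⟨F, hcover, ?_⟩
  rcases F.eq_empty_or_nonempty with rfl | hFne
  · exact ⟨1, one_pos, by simp⟩
  · obtain ⟨z, hz, hmin⟩ := F.exists_min_image (fun y => μ.real (Metric.closedBall y η)) hFne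
    exact ⟨_, ENNReal.toReal_pos (hpos z (hFE hz)).ne' (measure_ne_top _ _), hmin⟩

theorem hausdorffDist_support_le [HereditarilyLindelofSpace X] (hE : IsCompact E) {ε : ℝ}
    (hε : 0 ≤ ε) (hμE : μ (Metric.cthickening ε E)ᶜ = 0)
    (hpos : ∀ x ∈ E, 0 < μ (Metric.closedBall x ε)) :
    Metric.hausdorffDist μ.support E ≤ ε := by
  refine Metric.hausdorffDist_le_of_mem_dist hε (fun x hx => ?_) fun x hx => ?_
  · have hx := Measure.support_subset_of_isClosed Metric.isClosed_cthickening hμE hx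
    rw [hE.cthickening_eq_biUnion_closedBall hε] at hx
    obtain ⟨y, hy, hxy⟩ := mem_iUnion₂.mp hx
    exact ⟨y, hy, hxy⟩
  · obtain ⟨z, hz, hzμ⟩ := Measure.nonempty_inter_support_of_pos (hpos x hx)
    exact ⟨z, hzμ, by rwa [dist_comm]⟩

end FiniteNet

section DensityCriterion

variable {d : ℕ} {β t ε η : ℝ} {𝒰 : Set (Set (Torus d))}

theorem SupportPair.isOpen_setOf_exists_subset (h𝒰 : ∀ U ∈ 𝒰, IsOpen U) :
    IsOpen {p : SupportPair d β | ∃ U ∈ 𝒰, (p.set : Set (Torus d)) ⊆ U} := by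
  have hcont : Continuous (SupportPair.set : SupportPair d β → _) :=
    continuous_iff_continuousAt.mpr fun p =>
      (SupportPair.tendsto_iff.mp (tendsto_id (α := SupportPair d β) (x := 𝓝 p))).1
  have hunion : {p : SupportPair d β | ∃ U ∈ 𝒰, (p.set : Set (Torus d)) ⊆ U} =
      ⋃ U ∈ 𝒰, SupportPair.set ⁻¹' {K | (K : Set (Torus d)) ⊆ U} := by
    ext p
    simp
  rw [hunion]
  exact isOpen_biUnion fun U hU =>
    (NonemptyCompacts.isOpen_subsets_of_isOpen (h𝒰 U hU)).preimage hcont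

/-- The pair `(supp μ, μ)`. -/
noncomputable def SupportPair.ofMeasure (μ : Measure (Torus d)) [hμ : IsProbabilityMeasure μ]
    (h : ∀ s ∈ Ico (0 : ℝ) β, HasFourierDecay s μ) : SupportPair d β where
  set := ⟨⟨μ.support, Measure.isClosed_support.isCompact⟩, Measure.nonempty_support hμ.ne_zero⟩
  measure := ⟨μ, hμ⟩
  support_subset := subset_rfl
  decay := h

/-- `ν` is carried by `{f ≠ 0}` and approximates the measure with density `f`: the Fourier
coefficients up to frequency `r⁻³` agree up to `r ^ (l / 2)`, and no closed ball of radius `ρ`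
about a point of `F` loses more than `ε` of its mass. -/
structure ApproximatesDensity (f : Torus d → ℝ) (l r : ℝ) (F : Finset (Torus d)) (ρ ε : ℝ)
    (ν : Measure (Torus d)) : Prop where
  isFiniteMeasure : IsFiniteMeasure ν
  measure_zeros : ν {x | f x = 0} = 0
  norm_fourierMeasure_sub_le : ∀ ξ, freqNorm ξ ≤ r⁻¹ ^ 3 →
    ‖fourierMeasure ν ξ - fourierMeasure (densityMeasure volume f) ξ‖ ≤ r ^ (l / 2)
  measureReal_closedBall_le : ∀ y ∈ F, (densityMeasure volume f).real (Metric.closedBall y ρ) ≤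
    ν.real (Metric.closedBall y ρ) + ε

/-- Every bounded density can be approximated, with Fourier error of smaller order than
`r ^ (t / 2)` for a given `t < β`, by measures concentrated on sets whose thickening belongs
to `𝒰`. -/
def FourierApproximable (d : ℕ) (β : ℝ) (𝒰 : Set (Set (Torus d))) : Prop :=
  ∀ t, 0 ≤ t → t < β → ∃ l > t, ∀ (f : Torus d → ℝ) (L : ℝ), IsBoundedDensity f L →
    ∀ (F : Finset (Torus d)) (ρ ε r₀ : ℝ), 0 < ε → 0 < r₀ →
    ∃ r, 0 < r ∧ r ≤ r₀ ∧ ∃ ν : Measure (Torus d), ApproximatesDensity f l r F ρ ε ν ∧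
      ∃ G, ν Gᶜ = 0 ∧ Metric.thickening (2 * r) G ∈ 𝒰

theorem IsMollifier.hausdorffDist_support_smul_conv_le {C r : ℝ} {c : ℝ≥0∞} {E : Set (Torus d)}
    {ν φ : Measure (Torus d)} {F : Finset (Torus d)} (hφ : IsMollifier C r φ) (hc : c ≠ 0)
    (hr : 0 ≤ r) (hrη : r ≤ η) (hE : IsCompact E) (hν : ν (Metric.cthickening η E)ᶜ = 0)
    (hF : E ⊆ ⋃ y ∈ F, Metric.ball y η) (hpos : ∀ y ∈ F, 0 < ν (Metric.closedBall y η)) :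
    Metric.hausdorffDist (c • (ν ∗ φ)).support E ≤ 3 * η := by
  have := hφ.isProbabilityMeasure
  have hη : 0 ≤ η := hr.trans hrη
  refine hausdorffDist_support_le hE (by positivity) ?_ fun x hx => ?_
  · have hsub : Metric.cthickening r (Metric.cthickening η E) ⊆ Metric.cthickening (3 * η) E :=
      (Metric.cthickening_cthickening_subset hr hη E).trans
        (Metric.cthickening_mono (by linarith) E)
    rw [Measure.smul_apply, measure_mono_null (compl_subset_compl.mpr hsub)
      (conv_compl_cthickening_eq_zero hν hφ.measure_compl_closedBall), smul_zero]
  · obtain ⟨y, hy, hxy⟩ := mem_iUnion₂.mp (hF hx)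
    have hsub : Metric.closedBall y (r + η) ⊆ Metric.closedBall x (3 * η) := by
      refine Metric.closedBall_subset_closedBall' ?_
      linarith [Metric.mem_ball'.mp hxy]
    have hball : 0 < (ν ∗ φ) (Metric.closedBall x (3 * η)) :=
      ((hpos y hy).trans_le
        (measure_closedBall_le_conv hφ.measure_compl_closedBall y η)).trans_le (measure_mono hsub)
    exact ENNReal.mul_pos hc hball.ne'

theorem IsMollifier.support_smul_conv_subset_thickening {C r : ℝ} (c : ℝ≥0∞) {G : Set (Torus d)}
    {ν φ : Measure (Torus d)} (hφ : IsMollifier C r φ) (hr : 0 < r) (hG : ν Gᶜ = 0) :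
    (c • (ν ∗ φ)).support ⊆ Metric.thickening (2 * r) G := by
  have := hφ.isProbabilityMeasure
  refine subset_trans ?_ (Metric.cthickening_subset_thickening' (by positivity)
    (by linarith : r < 2 * r) G)
  refine Measure.support_subset_of_isClosed Metric.isClosed_cthickening ?_
  rw [mem_ae_iff, Measure.smul_apply,
    conv_compl_cthickening_eq_zero hG hφ.measure_compl_closedBall, smul_zero]

/-- The normalised mollification, at the scale `r` of the approximation, of a measure approximating
the density of `μ`. -/
theorem FourierApproximable.exists_supportPair (hd : 1 ≤ d) (hβd : β ≤ d)
    (h : FourierApproximable d β 𝒰) (ht : t ∈ Ico 0 β) (hε : 0 < ε) (hη : 0 < η)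
    {E : Set (Torus d)} (hE : IsCompact E) {μ : Measure (Torus d)} (hμ : IsSpreadNear E η μ) :
    ∃ p : SupportPair d β, (∃ U ∈ 𝒰, (p.set : Set (Torus d)) ⊆ U) ∧
      Metric.hausdorffDist (p.set : Set (Torus d)) E ≤ 3 * η ∧
      FourierClose t ε (p.measure : Measure (Torus d)) μ := by
  have hμP := hμ.isProbabilityMeasure
  have hd0 : (1 : ℝ) ≤ d := mod_cast hd
  have htd : t ≤ d := ht.2.le.trans hβd
  obtain ⟨L, hL⟩ := hμ.exists_le_smul_volume
  obtain ⟨f, hf, hfE, rfl⟩ := exists_isBoundedDensity hL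
    Metric.isClosed_cthickening.measurableSet hμ.measure_compl_cthickening
  obtain ⟨F, hcover, κ, hκ, hF⟩ :=
    exists_finset_cover_forall_le_measureReal hE hη hμ.measure_closedBall_pos
  obtain ⟨C, hC, hmollifier⟩ := exists_mollifier hd
  obtain ⟨l, htl, happrox⟩ := h t ht.1 ht.2
  obtain ⟨r₀, hr₀, hnormalized⟩ := mem_nhdsGT_iff_exists_Ioc_subset.mp
    ((hμ.hasFourierDecay (t + d) (by linarith [ht.1]) (by linarith)
      ).eventually_fourierClose_normalized hd ht.1 htd (by linarith) htl hC hε)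
  obtain ⟨r, hr, hrle, ν, hν, G, hG, hGU⟩ := happrox f L hf F η (κ / 2) (min r₀ (min η (1 / 2)))
    (half_pos hκ) (lt_min hr₀ (lt_min hη one_half_pos))
  obtain ⟨hrr₀, hrη, hr1⟩ : r ≤ r₀ ∧ r ≤ η ∧ r ≤ 1 / 2 := by simpa using hrle
  obtain ⟨φ, hφ, -⟩ := hmollifier r hr hr1
  have hφP := hφ.isProbabilityMeasure
  have hνfin := hν.isFiniteMeasure
  obtain ⟨hne, hclose⟩ := hnormalized ⟨hr, hrr₀⟩ φ hφ ν hνfin hν.norm_fourierMeasure_sub_le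
  have : NeZero (ν ∗ φ) := ⟨hne⟩
  have hdecay : ∀ s ∈ Ico (0 : ℝ) β, HasFourierDecay s (((ν ∗ φ) univ)⁻¹ • (ν ∗ φ)) :=
    fun s hs => (hφ.hasFourierDecay hC hr hs.1 (by linarith [hs.2])).conv.smul _
  refine ⟨SupportPair.ofMeasure _ hdecay,
    ⟨_, hGU, hφ.support_smul_conv_subset_thickening _ hr hG⟩, ?_, hclose⟩
  refine hφ.hausdorffDist_support_smul_conv_le (ENNReal.inv_ne_zero.mpr (measure_ne_top _ _)) hr.le
    hrη hE (measure_mono_null hfE hν.measure_zeros) hcover fun y hy => ?_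
  have hball : 0 < ν.real (Metric.closedBall y η) := by
    linarith [hν.measureReal_closedBall_le y hy, hF y hy]
  exact (ENNReal.toReal_pos_iff.mp hball).1

theorem SupportPair.dense_of_fourierApproximable (hd : 1 ≤ d) (hβ : 0 < β) (hβd : β ≤ d)
    (h : FourierApproximable d β 𝒰) :
    Dense {p : SupportPair d β | ∃ U ∈ 𝒰, (p.set : Set (Torus d)) ⊆ U} := by
  refine SupportPair.dense_of_approx hβ fun p t ht ε hε => ?_
  obtain ⟨t', htt, htβ⟩ := exists_between ht.2
  have hpE : (p.measure : Measure (Torus d)) (p.set : Set (Torus d))ᶜ = 0 :=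
    measure_mono_null (compl_subset_compl.mpr p.support_subset) Measure.measure_compl_support
  obtain ⟨η, μ, hη, hηε, hμ, hμp⟩ := exists_isSpreadNear hd p.set.nonempty hpE ht.1
    (ht.2.le.trans hβd) htt (p.decay t' ⟨ht.1.trans htt.le, htβ⟩) (half_pos hε)
    (show 0 < ε / 3 by positivity)
  obtain ⟨q, hq𝒰, hqp, hqμ⟩ :=
    h.exists_supportPair hd hβd ht (half_pos hε) hη p.set.isCompact hμ
  refine ⟨q, hq𝒰, ?_, by simpa using hqμ.trans hμp⟩
  rw [Metric.NonemptyCompacts.dist_eq]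
  linarith

end DensityCriterion

section Minkowski

variable {d : ℕ} {K : Set (Torus d)} {α : ℝ}

theorem frequently_measureReal_thickening_le (hK : lowerMinkowskiDim K < α) :
    ∃ᶠ r : ℝ in 𝓝[>] 0, volume.real (Metric.thickening r K) ≤ r ^ ((d : ℝ) - α) := by
  have hfreq := frequently_lt_of_liminf_lt (by isBoundedDefault) hK
  refine (hfreq.and_eventually (Ioo_mem_nhdsGT one_pos)).mono fun r ⟨hr, hr0, hr1⟩ => ?_
  set V := volume (Metric.thickening r K)
  change V.toReal ≤ _
  by_cases hV0 : V = 0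
  · rw [hV0, ENNReal.toReal_zero]
    positivity
  have hVtop : V ≠ ∞ := measure_ne_top _ _
  have hVpos : 0 < V.toReal := ENNReal.toReal_pos hV0 hVtop
  have hdim : (d : ℝ) - Real.log V.toReal / Real.log r < α := by
    rw [ENNReal.log_pos_real hV0 hVtop, ← EReal.coe_div] at hr
    exact_mod_cast hr
  have hlog : Real.log V.toReal < ((d : ℝ) - α) * Real.log r := by
    rw [← lt_div_iff_of_neg (Real.log_neg hr0 hr1)]
    linarith
  rw [← Real.log_le_log_iff hVpos (by positivity), Real.log_rpow hr0]
  exact hlog.le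

theorem frequently_measureReal_thickening_mul_le (hK : lowerMinkowskiDim K < α) {A : ℝ}
    (hA : 0 < A) :
    ∃ᶠ r : ℝ in 𝓝[>] 0,
      volume.real (Metric.thickening (A * r) K) ≤ A ^ ((d : ℝ) - α) * r ^ ((d : ℝ) - α) := by
  have hscale : Tendsto (fun R : ℝ => R / A) (𝓝[>] 0) (𝓝[>] 0) := by
    refine tendsto_nhdsWithin_iff.mpr ⟨tendsto_nhdsWithin_of_tendsto_nhds ?_, ?_⟩
    · simpa using (continuous_id.div_const A).tendsto 0
    · filter_upwards [self_mem_nhdsWithin] with R hR using div_pos hR hA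
  have hpos : ∀ᶠ R : ℝ in 𝓝[>] 0, 0 < R := self_mem_nhdsWithin
  refine hscale.frequently (((frequently_measureReal_thickening_le hK).and_eventually hpos).mono
    fun R ⟨hR, hR0⟩ => ?_)
  rwa [← Real.mul_rpow hA.le (by positivity), mul_div_cancel₀ _ hA.ne']

end Minkowski

section BadSet

variable {G : Type*} [AddCommGroup G] {N M : ℕ} {a : ℤ} {w : Fin N → ℤ} {W : Set G} {c : ℝ}

/-- The points `x` with `a x + ∑ⱼ wⱼ X_{κ j} ∈ W` for some choice `κ` of indices. -/
def badSet (a : ℤ) (w : Fin N → ℤ) (W : Set G) (X : Fin M → G) : Set G :=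
  {x | ∃ κ : Fin N → Fin M, a • x + ∑ j, w j • X (κ j) ∈ W}

theorem badSet_eq_iUnion (X : Fin M → G) :
    badSet a w W X = ⋃ κ : Fin N → Fin M, {x | a • x + ∑ j, w j • X (κ j) ∈ W} :=
  ofPred_exists _

theorem mem_badSet_zero (hM : 1 ≤ M) (X : Fin M → G) (x : G) :
    x ∈ badSet a (0 : Fin N → ℤ) W X ↔ a • x ∈ W := by
  have : Nonempty (Fin M) := ⟨⟨0, hM⟩⟩
  simp [badSet]

theorem badSet_diff_badSet_subset {X X' : Fin M → G} {k : Fin M} (h : ∀ j, j ≠ k → X j = X' j) :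
    badSet a w W X \ badSet a w W X' ⊆
      ⋃ κ ∈ ({κ | ∃ j, κ j = k} : Finset (Fin N → Fin M)),
        {x | a • x + ∑ j, w j • X (κ j) ∈ W} := by
  rintro x ⟨⟨κ, hκ⟩, hx'⟩
  refine mem_iUnion₂.mpr ⟨κ, Finset.mem_filter.mpr ⟨Finset.mem_univ κ, ?_⟩, hκ⟩
  by_contra! hcon
  refine hx' ⟨κ, ?_⟩
  rwa [Finset.sum_congr rfl fun j _ => by rw [← h (κ j) (hcon j)]]

theorem mem_badSet_add_const {v x x' : G} (hv : (∑ j, w j) • v = a • (x - x')) (X : Fin M → G) :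
    x' ∈ badSet a w W (X + fun _ => v) ↔ x ∈ badSet a w W X := by
  refine exists_congr fun κ => ?_
  suffices a • x' + ∑ j, w j • (X (κ j) + v) = a • x + ∑ j, w j • X (κ j) by
    rw [← this]; rfl
  simp only [smul_add, Finset.sum_add_distrib]
  rw [← Finset.sum_smul, hv, smul_sub]
  abel

theorem card_filter_exists_eq_mul_le (k : Fin M) :
    (Finset.card {κ : Fin N → Fin M | ∃ j, κ j = k} : ℝ) * M ≤ N * (M : ℝ) ^ N := by
  have hfix (j : Fin N) : Finset.card {κ : Fin N → Fin M | κ j = k} * M = M ^ N := by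
    have := Fintype.card_filter_piFinset_const (Finset.univ : Finset (Fin M)) j k
    rw [Fintype.piFinset_univ, if_pos (Finset.mem_univ k), Finset.card_fin,
      Fintype.card_fin] at this
    rw [this, pow_sub_one_mul j.pos.ne']
  have hsub : ({κ : Fin N → Fin M | ∃ j, κ j = k} : Finset _) ⊆
      Finset.univ.biUnion fun j => {κ : Fin N → Fin M | κ j = k} := fun κ hκ => by simpa using hκ
  have hcard : Finset.card {κ : Fin N → Fin M | ∃ j, κ j = k} * M ≤ N * M ^ N :=
    calc _ ≤ (∑ j, Finset.card {κ : Fin N → Fin M | κ j = k}) * M :=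
          Nat.mul_le_mul_right _ ((Finset.card_le_card hsub).trans Finset.card_biUnion_le)
      _ = N * M ^ N := by simp [Finset.sum_mul, hfix]
  exact_mod_cast hcard

/-- The weight that equals `c` off the bad set of the sample and vanishes on it. -/
noncomputable def badSetWeight (c : ℝ) (a : ℤ) (w : Fin N → ℤ) (W : Set G) (X : Fin M → G) :
    G → ℝ :=
  (badSet a w W X)ᶜ.indicator fun _ => c

theorem notMem_badSet_of_badSetWeight_ne_zero {X : Fin M → G} {x : G}
    (h : badSetWeight c a w W X x ≠ 0) : x ∉ badSet a w W X :=
  mem_of_indicator_ne_zero h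

theorem abs_badSetWeight_sub_le (hc0 : 0 ≤ c) (X X' : Fin M → G) (x : G) :
    |badSetWeight c a w W X x - badSetWeight c a w W X' x| ≤
      c * ((badSet a w W X \ badSet a w W X').indicator 1 x +
        (badSet a w W X' \ badSet a w W X).indicator 1 x) := by
  by_cases hx : x ∈ badSet a w W X <;> by_cases hx' : x ∈ badSet a w W X' <;>
    simp [badSetWeight, hx, hx', abs_of_nonneg hc0]

variable [TopologicalSpace G] [IsTopologicalAddGroup G]

theorem isOpen_setOf_mem_badSet (hW : IsOpen W) :
    IsOpen {p : (Fin M → G) × G | p.2 ∈ badSet a w W p.1} := by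
  have heq : {p : (Fin M → G) × G | p.2 ∈ badSet a w W p.1} =
      ⋃ κ : Fin N → Fin M, (fun p => a • p.2 + ∑ j, w j • p.1 (κ j)) ⁻¹' W := by
    ext p
    simp [badSet]
  rw [heq]
  exact isOpen_iUnion fun κ => hW.preimage (by fun_prop)

theorem isOpen_badSet (hW : IsOpen W) (X : Fin M → G) : IsOpen (badSet a w W X) :=
  (isOpen_setOf_mem_badSet hW).preimage (Continuous.prodMk_right X)

variable [MeasurableSpace G] [BorelSpace G]

theorem measurableSet_setOf_mem_badSet [SecondCountableTopology G] (hW : IsOpen W) :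
    MeasurableSet {p : (Fin M → G) × G | p.2 ∈ badSet a w W p.1} :=
  (isOpen_setOf_mem_badSet hW).measurableSet

theorem integral_badSetWeight [SecondCountableTopology G] {μ : Measure G} [IsProbabilityMeasure μ]
    (hW : IsOpen W) (x : G) :
    ∫ X, badSetWeight c a w W X x ∂Measure.pi (fun _ : Fin M => μ) =
      c * (1 - (Measure.pi fun _ : Fin M => μ).real {X | x ∈ badSet a w W X}) := by
  have hm : MeasurableSet {X : Fin M → G | x ∈ badSet a w W X} :=
    (measurableSet_setOf_mem_badSet hW).preimage measurable_prodMk_right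
  have heq : (fun X : Fin M → G => badSetWeight c a w W X x) =
      {X : Fin M → G | x ∈ badSet a w W X}ᶜ.indicator fun _ => c := rfl
  rw [heq, integral_indicator hm.compl, setIntegral_const, smul_eq_mul,
    probReal_compl_eq_one_sub hm, mul_comm]

variable [CompactSpace G] [DivisibleBy G ℤ] {μ : Measure G} [μ.IsAddHaarMeasure]

theorem measure_setOf_zsmul_add_mem (ha : a ≠ 0) (hW : MeasurableSet W) (y : G) :
    μ {x | a • x + y ∈ W} = μ W :=
  ((measurePreserving_add_right μ y).comp
    (Measure.measurePreserving_zsmul μ ha)).measure_preimage hW.nullMeasurableSet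

theorem measure_badSet_le (ha : a ≠ 0) (hW : IsOpen W) (X : Fin M → G) :
    μ (badSet a w W X) ≤ (M : ℝ≥0∞) ^ N * μ W := by
  rw [badSet_eq_iUnion]
  refine (measure_iUnion_le _).trans_eq ?_
  simp [measure_setOf_zsmul_add_mem ha hW.measurableSet]

theorem measureReal_badSet_diff_mul_le (ha : a ≠ 0) (hW : IsOpen W) {X X' : Fin M → G} {k : Fin M}
    (h : ∀ j, j ≠ k → X j = X' j) :
    μ.real (badSet a w W X \ badSet a w W X') * M ≤ N * ((M : ℝ) ^ N * μ.real W) := by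
  have hbound : μ.real (badSet a w W X \ badSet a w W X') ≤
      Finset.card {κ : Fin N → Fin M | ∃ j, κ j = k} * μ.real W := by
    refine (measureReal_mono (badSet_diff_badSet_subset h) (measure_ne_top _ _)).trans
      ((measureReal_biUnion_finset_le _ _).trans_eq ?_)
    simp [Measure.real, measure_setOf_zsmul_add_mem ha hW.measurableSet]
  calc _ ≤ Finset.card {κ : Fin N → Fin M | ∃ j, κ j = k} * μ.real W * M := by gcongr
    _ = Finset.card {κ : Fin N → Fin M | ∃ j, κ j = k} * M * μ.real W := by ring
    _ ≤ N * (M : ℝ) ^ N * μ.real W := by gcongr ?_ * _; exact card_filter_exists_eq_mul_le k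
    _ = _ := by ring

theorem measure_setOf_mem_badSet_eq (hw : ∑ j, w j ≠ 0) (x x' : G) :
    Measure.pi (fun _ : Fin M => μ) {X | x ∈ badSet a w W X} =
      Measure.pi (fun _ : Fin M => μ) {X | x' ∈ badSet a w W X} := by
  have hinv : (Measure.pi fun _ : Fin M => μ).IsAddRightInvariant :=
    Measure.pi.isAddRightInvariant _
  set v : G := DivisibleBy.div (a • (x - x')) (∑ j, w j)
  have hv : (∑ j, w j) • v = a • (x - x') := DivisibleBy.div_cancel _ hw
  simp_rw [← mem_badSet_add_const hv]
  exact measure_preimage_add_right _ (fun _ => v) {X | x' ∈ badSet a w W X}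

theorem integral_abs_badSetWeight_sub_le [IsProbabilityMeasure μ] (ha : a ≠ 0) (hW : IsOpen W)
    (hsmall : (M : ℝ) ^ N * μ.real W ≤ 1 / 2) (hc0 : 0 ≤ c) (hc2 : c ≤ 2) {X X' : Fin M → G}
    {k : Fin M} (h : ∀ j, j ≠ k → X j = X' j) :
    ∫ x, |badSetWeight c a w W X x - badSetWeight c a w W X' x| ∂μ ≤ (2 * N : ℝ) / M := by
  have hdiff (Y Y' : Fin M → G) : MeasurableSet (badSet a w W Y \ badSet a w W Y') :=
    (isOpen_badSet hW Y).measurableSet.diff (isOpen_badSet hW Y').measurableSet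
  have hint (Y Y' : Fin M → G) :
      Integrable ((badSet a w W Y \ badSet a w W Y').indicator (1 : G → ℝ)) μ :=
    (integrable_const 1).indicator (hdiff Y Y')
  have hle : (N : ℝ) * ((M : ℝ) ^ N * μ.real W) ≤ N * (1 / 2) := by gcongr
  have hXX' := (measureReal_badSet_diff_mul_le (μ := μ) (w := w) ha hW h).trans hle
  have hX'X := (measureReal_badSet_diff_mul_le (μ := μ) (w := w) ha hW
    fun j hj => (h j hj).symm).trans hle
  have hM : (0 : ℝ) < M := by exact_mod_cast k.pos
  calc ∫ x, |badSetWeight c a w W X x - badSetWeight c a w W X' x| ∂μ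
      ≤ ∫ x, c * ((badSet a w W X \ badSet a w W X').indicator (1 : G → ℝ) x +
          (badSet a w W X' \ badSet a w W X).indicator (1 : G → ℝ) x) ∂μ :=
        integral_mono_of_nonneg (ae_of_all _ fun x => abs_nonneg _)
          (((hint X X').add (hint X' X)).const_mul c)
          (ae_of_all _ (abs_badSetWeight_sub_le hc0 X X'))
    _ = c * (μ.real (badSet a w W X \ badSet a w W X') +
          μ.real (badSet a w W X' \ badSet a w W X)) := by
        rw [integral_const_mul, integral_add (hint X X') (hint X' X),
          integral_indicator_one (hdiff X X'), integral_indicator_one (hdiff X' X)]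
    _ ≤ 2 * (μ.real (badSet a w W X \ badSet a w W X') +
          μ.real (badSet a w W X' \ badSet a w W X)) := by gcongr
    _ ≤ 2 * N / M := by
        rw [le_div_iff₀ hM]
        linarith

variable [SecondCountableTopology G]

theorem measure_setOf_mem_badSet_le [IsProbabilityMeasure μ] (ha : a ≠ 0) (hW : IsOpen W)
    (hw : ∑ j, w j ≠ 0) (x : G) :
    Measure.pi (fun _ : Fin M => μ) {X | x ∈ badSet a w W X} ≤ (M : ℝ≥0∞) ^ N * μ W := by
  have hm := measurableSet_setOf_mem_badSet (M := M) (a := a) (w := w) hW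
  set P := Measure.pi fun _ : Fin M => μ
  calc P {X | x ∈ badSet a w W X} = ∫⁻ x', P {X | x' ∈ badSet a w W X} ∂μ := by
        rw [lintegral_congr fun x' => measure_setOf_mem_badSet_eq hw x' x, lintegral_const,
          measure_univ, mul_one]
    _ = ∫⁻ X, μ (badSet a w W X) ∂P :=
        (Measure.prod_apply_symm (μ := P) (ν := μ) hm).symm.trans (Measure.prod_apply hm)
    _ ≤ ∫⁻ _, (M : ℝ≥0∞) ^ N * μ W ∂P := lintegral_mono fun X => measure_badSet_le ha hW X
    _ = _ := by simp

theorem isSampleWeight_badSetWeight [IsProbabilityMeasure μ] (ha : a ≠ 0) (hW : IsOpen W)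
    (hsmall : (M : ℝ) ^ N * μ.real W ≤ 1 / 2) (hc0 : 0 ≤ c) (hc2 : c ≤ 2) {b : ℝ}
    (hmean : ∫ x, |c * (1 - (Measure.pi fun _ : Fin M => μ).real
      {X | x ∈ badSet a w W X}) - 1| ∂μ ≤ b) :
    IsSampleWeight μ (badSetWeight c a w W : (Fin M → G) → G → ℝ) (2 * N) b where
  measurable_uncurry := by
    have heq : Function.uncurry (badSetWeight c a w W : (Fin M → G) → G → ℝ) =
      {p : (Fin M → G) × G | p.2 ∈ badSet a w W p.1}ᶜ.indicator fun _ => c := rfl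
    rw [heq]
    exact measurable_const.indicator (measurableSet_setOf_mem_badSet hW).compl
  nonneg X x := indicator_nonneg (fun _ _ => hc0) x
  le_two X x := (indicator_le_self' (fun _ _ => hc0) x).trans hc2
  integral_abs_sub_le X X' k h := integral_abs_badSetWeight_sub_le ha hW hsmall hc0 hc2 h
  integral_abs_mean_sub_one_le := by simpa only [integral_badSetWeight hW] using hmean

theorem exists_isSampleWeight_of_sum_ne_zero [IsProbabilityMeasure μ] (ha : a ≠ 0) (hW : IsOpen W)
    (hw : ∑ j, w j ≠ 0) (hsmall : (M : ℝ) ^ N * μ.real W ≤ 1 / 2) :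
    ∃ c, IsSampleWeight μ (badSetWeight c a w W : (Fin M → G) → G → ℝ) (2 * N) 0 := by
  set p := (Measure.pi fun _ : Fin M => μ).real {X | (0 : G) ∈ badSet a w W X} with hp
  have hp_const (x : G) : (Measure.pi fun _ : Fin M => μ).real {X | x ∈ badSet a w W X} = p := by
    rw [hp, Measure.real, Measure.real, measure_setOf_mem_badSet_eq hw]
  have hp_le : p ≤ 1 / 2 := by
    refine le_trans ?_ hsmall
    simpa [hp, Measure.real] using ENNReal.toReal_mono (by finiteness)
      (measure_setOf_mem_badSet_le (μ := μ) (M := M) ha hW hw 0)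
  have hc2 : (1 - p)⁻¹ ≤ 2 := by
    rw [inv_le_comm₀ (by linarith) two_pos]
    linarith
  refine ⟨(1 - p)⁻¹, isSampleWeight_badSetWeight ha hW hsmall (by rw [inv_nonneg]; linarith) hc2
    (le_of_eq ?_)⟩
  simp [hp_const, inv_mul_cancel₀ (by linarith : 1 - p ≠ 0)]

theorem isSampleWeight_badSetWeight_zero [IsProbabilityMeasure μ] (hM : 1 ≤ M) (ha : a ≠ 0)
    (hW : IsOpen W) (hsmall : (M : ℝ) ^ N * μ.real W ≤ 1 / 2) :
    IsSampleWeight μ (badSetWeight 1 a (0 : Fin N → ℤ) W : (Fin M → G) → G → ℝ) (2 * N)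
      (μ.real W) := by
  refine isSampleWeight_badSetWeight ha hW hsmall zero_le_one one_le_two (le_of_eq ?_)
  have hm : MeasurableSet {x : G | a • x ∈ W} := (hW.preimage (by fun_prop)).measurableSet
  have hμ := measure_setOf_zsmul_add_mem (μ := μ) ha hW.measurableSet 0
  simp only [add_zero] at hμ
  rw [Measure.real, ← hμ, ← Measure.real, ← integral_indicator_one hm]
  congr with x
  by_cases hx : a • x ∈ W <;> simp [mem_badSet_zero hM, hx]

/-- If the `wⱼ` have nonzero sum, translating the sample shows that a point lies in the bad set with
a probability that does not depend on the point. If they all vanish, the bad set is deterministic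
and small. -/
theorem exists_isSampleWeight_ne_zero_imp_notMem_badSet [IsProbabilityMeasure μ] (hM : 1 ≤ M)
    (ha : a ≠ 0) (hW : IsOpen W) (hw : ∑ j, w j ≠ 0 ∨ w = 0)
    (hsmall : (M : ℝ) ^ N * μ.real W ≤ 1 / 2) :
    ∃ q : (Fin M → G) → G → ℝ, IsSampleWeight μ q (2 * N) (μ.real W) ∧
      ∀ X x, q X x ≠ 0 → x ∉ badSet a w W X := by
  rcases hw with hw | rfl
  · obtain ⟨c, hc⟩ := exists_isSampleWeight_of_sum_ne_zero (μ := μ) ha hW hw hsmall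
    have hmean := hc.integral_abs_mean_sub_one_le.trans (measureReal_nonneg (μ := μ) (s := W))
    exact ⟨_, { hc with integral_abs_mean_sub_one_le := hmean },
      fun _ _ => notMem_badSet_of_badSetWeight_ne_zero⟩
  · exact ⟨_, isSampleWeight_badSetWeight_zero hM ha hW hsmall,
      fun _ _ => notMem_badSet_of_badSetWeight_ne_zero⟩

end BadSet

section SampleCriterion

theorem eventually_mul_rpow_lt_mul_rpow {s e : ℝ} (h : s < e) (B : ℝ) {c : ℝ} (hc : 0 < c) :
    ∀ᶠ r : ℝ in 𝓝[>] 0, B * r ^ e < c * r ^ s := by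
  have hlim : Tendsto (fun r : ℝ => B * r ^ (e - s)) (𝓝[>] 0) (𝓝 0) := by
    have hzero := (Real.continuousAt_rpow_const 0 (e - s) (Or.inr (sub_pos.mpr h).le)).tendsto
    rw [Real.zero_rpow (sub_pos.mpr h).ne'] at hzero
    simpa using (hzero.mono_left nhdsWithin_le_nhds).const_mul B
  filter_upwards [hlim.eventually (gt_mem_nhds hc), self_mem_nhdsWithin] with r hr hr0
  calc B * r ^ e = B * r ^ (e - s) * r ^ s := by
        rw [mul_assoc, ← Real.rpow_add hr0, sub_add_cancel]
    _ < c * r ^ s := mul_lt_mul_of_pos_right hr (Real.rpow_pos_of_pos hr0 s)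

theorem eventually_mul_inv_pow_le_exp {δ c : ℝ} (hδ : 0 < δ) (hc : 0 < c) (C : ℝ) (k : ℕ) :
    ∀ᶠ r : ℝ in 𝓝[>] 0, C * r⁻¹ ^ k ≤ Real.exp (c * r ^ (-δ)) := by
  have hbound :=
    ((isLittleO_rpow_exp_pos_mul_atTop (k / δ) (b := c) hc).const_mul_left C).bound one_pos
  have htop : Tendsto (fun r : ℝ => r ^ (-δ)) (𝓝[>] 0) atTop :=
    tendsto_rpow_neg_nhdsGT_zero (neg_lt_zero.mpr hδ)
  filter_upwards [htop.eventually hbound, self_mem_nhdsWithin] with r hr hr0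
  have hpow : (r ^ (-δ)) ^ (k / δ) = r⁻¹ ^ k := by
    rw [← Real.rpow_mul (le_of_lt hr0), neg_mul, mul_div_cancel₀ _ hδ.ne',
      Real.rpow_neg (le_of_lt hr0), Real.rpow_natCast, inv_pow]
  rw [hpow, one_mul, Real.norm_eq_abs, Real.norm_eq_abs, Real.abs_exp] at hr
  exact (le_abs_self _).trans hr

theorem rpow_le_sqrt_mul_rpow {r x l t : ℝ} (hr : 0 < r) (hx : r ^ (-t) ≤ x) :
    r ^ (-((t - l) / 2)) ≤ √x * r ^ (l / 2) := by
  have hsqrt : r ^ (-t / 2) ≤ √x := by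
    refine Real.le_sqrt_of_sq_le ((le_of_eq ?_).trans hx)
    rw [← Real.rpow_natCast, ← Real.rpow_mul hr.le]
    norm_num
  calc r ^ (-((t - l) / 2)) = r ^ (-t / 2) * r ^ (l / 2) := by
        rw [← Real.rpow_add hr]
        ring_nf
    _ ≤ √x * r ^ (l / 2) := by gcongr

theorem two_mul_ceil_pow_add_le {r : ℝ} (hr0 : 0 < r) (hr1 : r ≤ 1) (k d n : ℕ) :
    2 * (2 * (⌈r⁻¹ ^ k⌉₊ : ℝ) + 1) ^ d + n ≤ (2 * 5 ^ d + n) * r⁻¹ ^ (k * d) := by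
  have hone : 1 ≤ r⁻¹ ^ k := one_le_pow₀ ((one_le_inv₀ hr0).mpr hr1)
  have hceil : (⌈r⁻¹ ^ k⌉₊ : ℝ) ≤ r⁻¹ ^ k + 1 := (Nat.ceil_lt_add_one (by positivity)).le
  have hn : (n : ℝ) ≤ n * (r⁻¹ ^ k) ^ d :=
    le_mul_of_one_le_right (by positivity) (one_le_pow₀ hone)
  calc 2 * (2 * (⌈r⁻¹ ^ k⌉₊ : ℝ) + 1) ^ d + n
      ≤ 2 * (5 * r⁻¹ ^ k) ^ d + n * (r⁻¹ ^ k) ^ d := by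
        gcongr
        linarith
    _ = _ := by
        rw [mul_pow, pow_mul]
        ring

theorem eventually_card_mul_le_exp {l t : ℝ} (hlt : l < t) (d n : ℕ) {K : ℝ} (hK : 0 ≤ K) :
    ∀ᶠ r : ℝ in 𝓝[>] 0, ∀ M : ℕ, r ^ (-t) ≤ M →
      2 * (2 * (2 * (⌈r⁻¹ ^ 3⌉₊ : ℝ) + 1) ^ d + n) * K ≤ Real.exp (√M * (r ^ (l / 2) / 4)) := by
  filter_upwards [eventually_mul_inv_pow_le_exp (half_pos (sub_pos.mpr hlt))
    (by norm_num : (0 : ℝ) < 1 / 4) (2 * (2 * 5 ^ d + n) * K) (3 * d),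
    Ioo_mem_nhdsGT one_pos] with r hexp ⟨hr0, hr1⟩ M hM
  calc 2 * (2 * (2 * (⌈r⁻¹ ^ 3⌉₊ : ℝ) + 1) ^ d + n) * K
      ≤ 2 * ((2 * 5 ^ d + n) * r⁻¹ ^ (3 * d)) * K := by
        gcongr
        exact two_mul_ceil_pow_add_le hr0 hr1.le 3 d n
    _ = 2 * (2 * 5 ^ d + n) * K * r⁻¹ ^ (3 * d) := by ring
    _ ≤ Real.exp (1 / 4 * r ^ (-((t - l) / 2))) := hexp
    _ ≤ Real.exp (√M * (r ^ (l / 2) / 4)) := by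
        rw [← mul_div_assoc, one_div_mul_eq_div]
        gcongr
        exact rpow_le_sqrt_mul_rpow hr0 hM

variable {d : ℕ}

theorem norm_fourierMeasure_sub_le_add (μ ν : Measure (Torus d)) [IsFiniteMeasure μ]
    [IsFiniteMeasure ν] (ξ : Fin d → ℤ) :
    ‖fourierMeasure μ ξ - fourierMeasure ν ξ‖ ≤
      |∫ x, (UnitAddTorus.mFourier (-ξ) x).re ∂μ - ∫ x, (UnitAddTorus.mFourier (-ξ) x).re ∂ν| +
      |∫ x, (UnitAddTorus.mFourier (-ξ) x).im ∂μ - ∫ x, (UnitAddTorus.mFourier (-ξ) x).im ∂ν| := by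
  have hre (m : Measure (Torus d)) [IsFiniteMeasure m] : (fourierMeasure m ξ).re =
      ∫ x, (UnitAddTorus.mFourier (-ξ) x).re ∂m := (integral_re (integrable_mFourier (-ξ) m)).symm
  have him (m : Measure (Torus d)) [IsFiniteMeasure m] : (fourierMeasure m ξ).im =
      ∫ x, (UnitAddTorus.mFourier (-ξ) x).im ∂m := (integral_im (integrable_mFourier (-ξ) m)).symm
  refine (Complex.norm_le_abs_re_add_abs_im _).trans_eq ?_
  rw [Complex.sub_re, Complex.sub_im, hre, hre, him, him]

/-- The finitely many functions whose integrals are tested in `ApproximatesDensity`: the real and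
imaginary parts of the characters in `freqBox d N`, and the indicators of the closed balls of radius
`ρ` about the points of `F`. -/
noncomputable def testFunction (N : ℕ) (F : Finset (Torus d)) (ρ : ℝ) :
    (freqBox d N ⊕ freqBox d N) ⊕ F → Torus d → ℝ :=
  Sum.elim (Sum.elim (fun ξ x => (UnitAddTorus.mFourier (-ξ.1) x).re)
    fun ξ x => (UnitAddTorus.mFourier (-ξ.1) x).im)
    fun y => (Metric.closedBall y.1 ρ).indicator 1

variable {F : Finset (Torus d)} {ρ : ℝ}

theorem measurable_testFunction {N : ℕ} (i) : Measurable (testFunction N F ρ i) := by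
  rcases i with (ξ | ξ) | y
  · exact Complex.measurable_re.comp (UnitAddTorus.mFourier (-ξ.1)).continuous.measurable
  · exact Complex.measurable_im.comp (UnitAddTorus.mFourier (-ξ.1)).continuous.measurable
  · exact measurable_one.indicator Metric.isClosed_closedBall.measurableSet

theorem abs_testFunction_le_one {N : ℕ} (i) (x : Torus d) : |testFunction N F ρ i x| ≤ 1 := by
  rcases i with (ξ | ξ) | y
  · exact (Complex.abs_re_le_norm _).trans (norm_mFourier_apply _ _).le
  · exact (Complex.abs_im_le_norm _).trans (norm_mFourier_apply _ _).le
  · exact (norm_indicator_le_norm_self (1 : Torus d → ℝ) x).trans_eq norm_one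

theorem card_testFunction_index (N : ℕ) :
    (Fintype.card ((freqBox d N ⊕ freqBox d N) ⊕ F) : ℝ) = 2 * (2 * (N : ℝ) + 1) ^ d + F.card := by
  simp only [Fintype.card_sum, Fintype.card_coe, card_freqBox]
  push_cast
  ring

variable {f : Torus d → ℝ} {Q : Set (Torus d)} {L l r ε D b : ℝ}

theorem approximatesDensity_of_abs_integral_testFunction_sub_le {ν : Measure (Torus d)}
    [hν : IsFiniteMeasure ν] (hf : IsBoundedDensity f L) (hν0 : ν {x | f x = 0} = 0)
    (hrε : r ^ (l / 2) ≤ 2 * ε)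
    (h : ∀ i, |∫ x, testFunction ⌈r⁻¹ ^ 3⌉₊ F ρ i x ∂ν -
      ∫ x, testFunction ⌈r⁻¹ ^ 3⌉₊ F ρ i x ∂densityMeasure volume f| ≤ r ^ (l / 2) / 2) :
    ApproximatesDensity f l r F ρ ε ν where
  isFiniteMeasure := hν
  measure_zeros := hν0
  norm_fourierMeasure_sub_le ξ hξ := by
    have := hf.isFiniteMeasure_densityMeasure (P := volume)
    have hξbox := mem_freqBox (hξ.trans (Nat.le_ceil _))
    exact (norm_fourierMeasure_sub_le_add _ _ ξ).trans
      ((add_le_add (h (.inl (.inl ⟨ξ, hξbox⟩))) (h (.inl (.inr ⟨ξ, hξbox⟩)))).trans_eq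
        (add_halves _))
  measureReal_closedBall_le y hy := by
    have hball := h (.inr ⟨y, hy⟩)
    simp only [testFunction, Sum.elim_inr] at hball
    rw [integral_indicator_one Metric.isClosed_closedBall.measurableSet,
      integral_indicator_one Metric.isClosed_closedBall.measurableSet] at hball
    linarith [(abs_le.mp hball).1]

theorem exists_approximatesDensity_sampleMeasure {M : ℕ} {q : (Fin M → Torus d) → Torus d → ℝ}
    (hM : 1 ≤ M) (hf : IsBoundedDensity f L) (hQ : MeasurableSet Q)
    (hq : IsSampleWeight volume q D b) (hb : L * b ≤ r ^ (l / 2) / 4) (hrε : r ^ (l / 2) ≤ 2 * ε)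
    (hcard : 2 * (2 * (2 * (⌈r⁻¹ ^ 3⌉₊ : ℝ) + 1) ^ d + F.card) *
      Real.exp ((L * (2 + D)) ^ 2 / 2) ≤ Real.exp (√M * (r ^ (l / 2) / 4))) :
    ∃ X, ApproximatesDensity f l r F ρ ε (sampleMeasure volume f Q q X) := by
  obtain ⟨X, hX⟩ := exists_forall_abs_integral_sampleMeasure_sub_le hM hf hQ hq
    (testFunction ⌈r⁻¹ ^ 3⌉₊ F ρ) measurable_testFunction abs_testFunction_le_one
    (by rwa [card_testFunction_index])
  have := isFiniteMeasure_sampleMeasure hf hQ hq X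
  refine ⟨X, approximatesDensity_of_abs_integral_testFunction_sub_le hf ?_ hrε
    fun i => (hX i).trans (by linarith)⟩
  refine measure_mono_null ?_ (sampleMeasure_compl_eq_zero hf.measurable hQ hq.measurable_uncurry X)
  exact fun x hx hmem => hmem.1 hx

theorem fourierApproximable_of_isSampleWeight {β : ℝ} {𝒰 : Set (Set (Torus d))}
    (hQ : MeasurableSet Q)
    (H : ∀ u, 0 < u → u < β → ∀ l < u, ∀ L : ℝ, 0 ≤ L → ∃ᶠ r : ℝ in 𝓝[>] 0,
      ∃ M : ℕ, r ^ (-u) ≤ M ∧ ∃ (q : (Fin M → Torus d) → Torus d → ℝ) (b : ℝ),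
        IsSampleWeight volume q D b ∧ L * b ≤ r ^ (l / 2) / 4 ∧
        ∀ X, Metric.thickening (2 * r) (sampleCarrier Q q X) ∈ 𝒰) :
    FourierApproximable d β 𝒰 := by
  intro t ht htβ
  obtain ⟨u, htu, huβ⟩ := exists_between htβ
  obtain ⟨l, htl, hlu⟩ := exists_between htu
  refine ⟨l, htl, fun f L hf F ρ ε r₀ hε hr₀ => ?_⟩
  have hL : 0 ≤ L := (hf.nonneg 0).trans (hf.le 0)
  have hcard := eventually_card_mul_le_exp hlu d F.card
    (Real.exp_nonneg ((L * (2 + D)) ^ 2 / 2))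
  have hsmall : ∀ᶠ r : ℝ in 𝓝[>] 0, r ^ (l / 2) < 2 * ε := by
    simpa using eventually_mul_rpow_lt_mul_rpow (s := 0) (e := l / 2) (by linarith) 1
      (by positivity : 0 < 2 * ε)
  obtain ⟨r, ⟨M, hMr, q, b, hq, hb, hmem⟩, hexp, hrε, hr0, hrr₀⟩ :=
    ((H u (by linarith) huβ l hlu L hL).and_eventually
      (hcard.and (hsmall.and (Ioc_mem_nhdsGT hr₀)))).exists
  have hM : 1 ≤ M := Nat.cast_pos.mp ((Real.rpow_pos_of_pos hr0 _).trans_le hMr)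
  obtain ⟨X, hX⟩ := exists_approximatesDensity_sampleMeasure (ρ := ρ) hM hf hQ hq hb hrε.le
    (hexp M hMr)
  exact ⟨r, hr0, hrr₀, _, hX, _, measure_mono_null (compl_subset_compl.mpr inter_subset_right)
    (sampleMeasure_compl_eq_zero hf.measurable hQ hq.measurable_uncurry X), hmem X⟩

end SampleCriterion

section EfficientCovering

/-- The open sets covered by finitely many closed balls of a common radius `r < δ` with
`∑ r ^ s < δ`. -/
def efficientlyCovered (E : Type*) [PseudoMetricSpace E] (s δ : ℝ) : Set (Set E) :=
  {U | IsOpen U ∧ ∃ (F : Finset E) (r : ℝ), 0 < r ∧ r < δ ∧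
    U ⊆ ⋃ x ∈ F, Metric.closedBall x r ∧ F.card * r ^ s < δ}

section Hausdorff

variable {E : Type*} [MetricSpace E]

theorem ediam_closedBall_le_ofReal (x : E) (r : ℝ) :
    Metric.ediam (Metric.closedBall x r) ≤ ENNReal.ofReal (2 * r) := by
  refine Metric.ediam_le_of_forall_dist_le fun y hy z hz => ?_
  rw [Metric.mem_closedBall] at hy hz
  linarith [dist_triangle_right y z x]

theorem sum_ediam_closedBall_rpow_le {s r : ℝ} (hs : 0 ≤ s) (hr : 0 ≤ r) (F : Finset E) :
    ∑ x : F, Metric.ediam (Metric.closedBall x.1 r) ^ s ≤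
      ENNReal.ofReal (2 ^ s * (F.card * r ^ s)) := by
  calc ∑ x : F, Metric.ediam (Metric.closedBall x.1 r) ^ s
      ≤ ∑ _x : F, ENNReal.ofReal (2 * r) ^ s := by
        gcongr with x
        exact ediam_closedBall_le_ofReal x.1 r
    _ = ENNReal.ofReal (2 ^ s * (F.card * r ^ s)) := by
        rw [ENNReal.ofReal_rpow_of_nonneg (by positivity) hs, Finset.sum_const, Finset.card_univ,
          Fintype.card_coe, nsmul_eq_mul, ← ENNReal.ofReal_natCast,
          ← ENNReal.ofReal_mul (by positivity), Real.mul_rpow two_pos.le hr]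
        ring_nf

variable [MeasurableSpace E] [BorelSpace E] {A : Set E}

theorem hausdorffMeasure_eq_zero_of_efficientlyCovered {s : ℝ} (hs : 0 ≤ s)
    (h : ∀ k : ℕ, ∃ U ∈ efficientlyCovered E s (1 / (k + 1 : ℝ)), A ⊆ U) :
    Measure.hausdorffMeasure s A = 0 := by
  choose U hU hAU using h
  choose _ F r hr0 hr hcov hcard using hU
  have hlim (c : ℝ) :
      Tendsto (fun k : ℕ => ENNReal.ofReal (c * (1 / (k + 1 : ℝ)))) atTop (𝓝 0) := by
    simpa using ENNReal.tendsto_ofReal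
      ((tendsto_one_div_add_atTop_nhds_zero_nat (𝕜 := ℝ)).const_mul c)
  have hle := Measure.hausdorffMeasure_le_liminf_sum (ι := fun k => F k) s A
    (fun k : ℕ => ENNReal.ofReal (2 * (1 / (k + 1 : ℝ)))) (hlim 2)
    (fun k x => Metric.closedBall x.1 (r k))
    (.of_forall fun k x => (ediam_closedBall_le_ofReal x.1 (r k)).trans
      (ENNReal.ofReal_le_ofReal (by linarith [hr k])))
    (.of_forall fun k => (hAU k).trans ((hcov k).trans (biUnion_eq_iUnion _ _).subset))
  refine le_antisymm (hle.trans ?_) zero_le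
  rw [← (hlim (2 ^ s)).liminf_eq]
  refine liminf_le_liminf (.of_forall fun k => ?_)
  exact (sum_ediam_closedBall_rpow_le hs (hr0 k).le (F k)).trans
    (ENNReal.ofReal_le_ofReal (by gcongr; exact (hcard k).le))

theorem dimH_le_of_efficientlyCovered {β : ℝ} (hβ : 0 ≤ β)
    (h : ∀ j k : ℕ, ∃ U ∈ efficientlyCovered E (β + 1 / (j + 1 : ℝ)) (1 / (k + 1 : ℝ)), A ⊆ U) :
    dimH A ≤ ENNReal.ofReal β := by
  have hle (j : ℕ) : dimH A ≤ ENNReal.ofReal (β + 1 / (j + 1 : ℝ)) := by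
    have hs : 0 ≤ β + 1 / (j + 1 : ℝ) := by positivity
    refine dimH_le_of_hausdorffMeasure_ne_top (d := Real.toNNReal (β + 1 / (j + 1 : ℝ))) ?_
    rw [Real.coe_toNNReal _ hs, hausdorffMeasure_eq_zero_of_efficientlyCovered hs (h j)]
    exact ENNReal.zero_ne_top
  have hlim : Tendsto (fun j : ℕ => ENNReal.ofReal (β + 1 / (j + 1 : ℝ))) atTop
      (𝓝 (ENNReal.ofReal β)) := by
    simpa using ENNReal.tendsto_ofReal
      ((tendsto_one_div_add_atTop_nhds_zero_nat (𝕜 := ℝ)).const_add β)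
  exact ge_of_tendsto' hlim hle

end Hausdorff

theorem isSampleWeight_one {Ω : Type*} [MeasurableSpace Ω] {P : Measure Ω} [IsProbabilityMeasure P]
    (M : ℕ) : IsSampleWeight P (fun (_ : Fin M → Ω) _ => 1) 0 0 where
  measurable_uncurry := measurable_const
  nonneg _ _ := zero_le_one
  le_two _ _ := one_le_two
  integral_abs_sub_le _ _ _ _ := by simp
  integral_abs_mean_sub_one_le := by simp

theorem natCeil_rpow_neg_le {r u : ℝ} (hr : 0 < r) (hr1 : r ≤ 1) (hu : 0 ≤ u) :
    (⌈r ^ (-u)⌉₊ : ℝ) ≤ 2 * r ^ (-u) :=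
  Nat.ceil_le_two_mul <| (by norm_num : (2⁻¹ : ℝ) ≤ 1).trans
    (Real.one_le_rpow_of_pos_of_le_one_of_nonpos hr hr1 (by linarith))

theorem thickening_range_mem_efficientlyCovered {E : Type*} [PseudoMetricSpace E] {M : ℕ}
    {s δ r : ℝ} (hr : 0 < r) (hrδ : r < δ) (hM : M * r ^ s < δ) (X : Fin M → E) :
    Metric.thickening r (range X) ∈ efficientlyCovered E s δ := by
  classical
  refine ⟨Metric.isOpen_thickening, Finset.univ.image X, r, hr, hrδ, fun x hx => ?_, ?_⟩
  · obtain ⟨_, ⟨k, rfl⟩, hxk⟩ := Metric.mem_thickening_iff.mp hx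
    exact mem_iUnion₂.mpr ⟨X k, by simp, hxk.le⟩
  · have hcard : (Finset.univ.image X).card ≤ M := Finset.card_image_le.trans_eq (by simp)
    refine lt_of_le_of_lt ?_ hM
    gcongr

theorem fourierApproximable_efficientlyCovered {d : ℕ} {β s δ : ℝ} (hs : β < s) (hδ : 0 < δ) :
    FourierApproximable d β (efficientlyCovered (Torus d) s δ) := by
  refine fourierApproximable_of_isSampleWeight (Q := ∅) MeasurableSet.empty (D := 0) ?_
  intro u hu huβ l _ L _
  refine Eventually.frequently ?_
  filter_upwards [eventually_mul_rpow_lt_mul_rpow (huβ.trans hs) (2 * 2 ^ s) hδ,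
    Ioo_mem_nhdsGT (lt_min one_pos (half_pos hδ))] with r hr ⟨hr0, hrmin⟩
  have hr1 : r ≤ 1 := hrmin.le.trans (min_le_left _ _)
  have hrδ : r < δ / 2 := hrmin.trans_le (min_le_right _ _)
  refine ⟨⌈r ^ (-u)⌉₊, Nat.le_ceil _, _, 0, isSampleWeight_one _, by rw [mul_zero]; positivity,
    fun X => ?_⟩
  have hcard : ⌈r ^ (-u)⌉₊ * (2 * r) ^ s < δ := by
    calc ⌈r ^ (-u)⌉₊ * (2 * r) ^ s ≤ 2 * r ^ (-u) * (2 * r) ^ s := by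
          gcongr
          exact natCeil_rpow_neg_le hr0 hr1 hu.le
      _ = 2 * 2 ^ s * r ^ s / r ^ u := by
          rw [Real.mul_rpow two_pos.le hr0.le, Real.rpow_neg hr0.le]
          ring
      _ < δ := (div_lt_iff₀ (Real.rpow_pos_of_pos hr0 u)).mpr hr
  simpa [sampleCarrier] using thickening_range_mem_efficientlyCovered (by positivity)
    (by linarith : 2 * r < δ) hcard X

end EfficientCovering

section SeparatedSolutions

section Geometry

variable {G : Type*} [SeminormedAddCommGroup G] {N : ℕ} {K : Set G}

/-- Open sets without solutions of `a x + ∑ⱼ wⱼ yⱼ ∈ K` such that `x` is close to `c` and all `yⱼ`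
are far from `c`. -/
def separatedSolutionFree (K : Set G) (a : ℤ) (w : Fin N → ℤ) (c : G) (ρ : ℝ) : Set (Set G) :=
  {U | IsOpen U ∧ ∀ x ∈ U, ∀ y : Fin N → G, (∀ j, y j ∈ U) → x ∈ Metric.closedBall c ρ →
    (∀ j, y j ∉ Metric.ball c (3 * ρ)) → a • x + ∑ j, w j • y j ∉ K}

theorem dist_zsmul_le_of_dist_le (m : ℤ) {x y : G} {η : ℝ} (h : dist x y ≤ η) :
    dist (m • x) (m • y) ≤ |(m : ℝ)| * η := by
  rw [dist_eq_norm, ← smul_sub]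
  refine (norm_zsmul_le m _).trans ?_
  rw [← dist_eq_norm, Int.norm_eq_abs]
  gcongr

theorem dist_zsmul_add_sum_le (a : ℤ) (w : Fin N → ℤ) {x x' : G} {y y' : Fin N → G} {η : ℝ}
    (hx : dist x x' ≤ η) (hy : ∀ j, dist (y j) (y' j) ≤ η) :
    dist (a • x + ∑ j, w j • y j) (a • x' + ∑ j, w j • y' j) ≤
      (|(a : ℝ)| + ∑ j, |(w j : ℝ)|) * η := by
  rw [add_mul, Finset.sum_mul]
  exact (dist_add_add_le _ _ _ _).trans (add_le_add (dist_zsmul_le_of_dist_le a hx)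
    (dist_sum_sum_le_of_le _ fun j _ => dist_zsmul_le_of_dist_le (w j) (hy j)))

theorem thickening_sampleCarrier_mem_separatedSolutionFree {M : ℕ} {a : ℤ} {w : Fin N → ℤ} {c : G}
    {ρ η : ℝ} (hη : 0 < η) (hηρ : η < ρ) {q : (Fin M → G) → G → ℝ} {X : Fin M → G}
    (hq : ∀ x, q X x ≠ 0 →
      x ∉ badSet a w (Metric.thickening ((|(a : ℝ)| + ∑ j, |(w j : ℝ)| + 1) * η) K) X) :
    Metric.thickening η (sampleCarrier (Metric.closedBall c (2 * ρ)) q X) ∈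
      separatedSolutionFree K a w c ρ := by
  refine ⟨Metric.isOpen_thickening, fun x hx y hy hxc hyc hmem => ?_⟩
  obtain ⟨x', hx', hxx'⟩ := Metric.mem_thickening_iff.mp hx
  have hx'_weight : q X x' ≠ 0 := by
    rcases hx' with ⟨-, hx'c⟩ | ⟨-, hx'q⟩
    · refine absurd ?_ hx'c
      rw [Metric.mem_closedBall] at hxc ⊢
      linarith [dist_triangle_left x' c x]
    · exact hx'q
  have hy_sample (j : Fin N) : ∃ k, dist (y j) (X k) < η := by
    obtain ⟨z, hz, hyz⟩ := Metric.mem_thickening_iff.mp (hy j)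
    rcases hz with ⟨⟨k, rfl⟩, -⟩ | ⟨hzc, -⟩
    · exact ⟨k, hyz⟩
    · refine absurd ?_ (hyc j)
      rw [Metric.mem_closedBall] at hzc
      rw [Metric.mem_ball]
      linarith [dist_triangle (y j) z c]
  choose κ hκ using hy_sample
  refine hq x' hx'_weight ⟨κ, Metric.mem_thickening_iff.mpr ⟨_, hmem, ?_⟩⟩
  rw [dist_comm]
  exact (dist_zsmul_add_sum_le a w hxx'.le fun j => (hκ j).le).trans_lt
    (mul_lt_mul_of_pos_right (lt_add_one _) hη)

theorem exists_ne_zero_sum_succAbove {m : Fin (N + 1) → ℤ} (hm : m ≠ 0) :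
    ∃ i, m i ≠ 0 ∧ (∑ j, m (i.succAbove j) ≠ 0 ∨ (fun j => m (i.succAbove j)) = 0) := by
  by_contra! hcon
  obtain ⟨i, hi⟩ := Function.ne_iff.mp hm
  have eq_sum (k : Fin (N + 1)) (hk : m k ≠ 0) : m k = ∑ j, m j := by
    rw [Fin.sum_univ_succAbove m k, (hcon k hk).1, add_zero]
  have hnonneg : ∀ j ∈ Finset.univ, 0 ≤ m (i.succAbove j) * m i := fun j _ => by
    by_cases hj : m (i.succAbove j) = 0
    · simp [hj]
    · rw [eq_sum _ hj, eq_sum i hi]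
      exact mul_self_nonneg _
  have hsum : ∑ j, m (i.succAbove j) * m i = 0 := by
    rw [← Finset.sum_mul, (hcon i hi).1, zero_mul]
  refine (hcon i hi).2 (funext fun j => ?_)
  have hzero := (Finset.sum_eq_zero_iff_of_nonneg hnonneg).mp hsum j (Finset.mem_univ j)
  exact (mul_eq_zero.mp hzero).resolve_right hi

end Geometry

theorem sum_zsmul_notMem_of_separatedSolutionFree {G : Type*} [NormedAddCommGroup G] {N : ℕ}
    {K E D : Set G} (hD : Dense D)
    (h : ∀ (m : Fin (N + 1) → ℤ) (i : Fin (N + 1)), m i ≠ 0 →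
      (∑ j, m (i.succAbove j) ≠ 0 ∨ (fun j => m (i.succAbove j)) = 0) → ∀ c ∈ D, ∀ k : ℕ,
      ∃ U ∈ separatedSolutionFree K (m i) (fun j => m (i.succAbove j)) c (1 / (k + 1 : ℝ)), E ⊆ U)
    {x : Fin (N + 1) → G} (hx : Function.Injective x) (hxE : ∀ i, x i ∈ E)
    {m : Fin (N + 1) → ℤ} (hm : m ≠ 0) : ∑ i, m i • x i ∉ K := by
  obtain ⟨i, hi, hw⟩ := exists_ne_zero_sum_succAbove hm
  have hsep : ∀ᶠ δ : ℝ in 𝓝[>] 0, ∀ j, 4 * δ < dist (x (i.succAbove j)) (x i) := by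
    refine eventually_all.mpr fun j => ?_
    have hpos := dist_pos.mpr (hx.ne (Fin.succAbove_ne i j))
    filter_upwards [Ioo_mem_nhdsGT (by positivity : 0 < dist (x (i.succAbove j)) (x i) / 4)]
      with δ hδ
    linarith [hδ.2]
  obtain ⟨δ, hsep, hδ⟩ := (hsep.and self_mem_nhdsWithin).exists
  obtain ⟨k, hk⟩ := exists_nat_one_div_lt hδ
  obtain ⟨c, hcD, hc⟩ := hD.exists_dist_lt (x i) (by positivity : (0 : ℝ) < 1 / (k + 1))
  obtain ⟨U, ⟨-, hU⟩, hEU⟩ := h m i hi hw c hcD k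
  rw [Fin.sum_univ_succAbove _ i]
  refine hU _ (hEU (hxE i)) _ (fun j => hEU (hxE _)) hc.le fun j hj => ?_
  rw [Metric.mem_ball] at hj
  linarith [hsep j, dist_triangle_right (x (i.succAbove j)) (x i) c]

variable {d N : ℕ} {β α : ℝ} {K : Set (Torus d)}

/-- The number of sample points is of order `r ^ (-u)`, hence `N u < d - α` is what makes the bad
set small. -/
theorem frequently_pow_mul_measureReal_thickening_le {u l : ℝ} (hN : 1 ≤ N) (hu : 0 < u)
    (hlu : l < u) (hNu : N * u < d - α) (hK : lowerMinkowskiDim K ≤ α) {A : ℝ} (hA : 0 < A) {L : ℝ}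
    (hL : 0 ≤ L) :
    ∃ᶠ r : ℝ in 𝓝[>] 0,
      (⌈r ^ (-u)⌉₊ : ℝ) ^ N * volume.real (Metric.thickening (A * r) K) ≤ 1 / 2 ∧
      L * volume.real (Metric.thickening (A * r) K) ≤ r ^ (l / 2) / 4 := by
  obtain ⟨α', hα', hNu'⟩ : ∃ α', α < α' ∧ N * u < d - α' := by
    obtain ⟨α', hα'⟩ := exists_between (lt_sub_comm.mp hNu)
    exact ⟨α', hα'.1, lt_sub_comm.mp hα'.2⟩
  have hl : l / 2 < d - α' := by
    have : u ≤ N * u := le_mul_of_one_le_left hu.le (by exact_mod_cast hN)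
    linarith
  set B := A ^ (d - α')
  have hfreq := frequently_measureReal_thickening_mul_le
    (hK.trans_lt (EReal.coe_lt_coe_iff.mpr hα')) hA
  refine (hfreq.and_eventually
    ((eventually_mul_rpow_lt_mul_rpow hNu' (2 ^ N * B) one_half_pos).and
      ((eventually_mul_rpow_lt_mul_rpow hl (L * B) (by norm_num : (0 : ℝ) < 1 / 4)).and
        (Ioo_mem_nhdsGT one_pos)))).mono fun r ⟨hV, hcount, hmass, hr0, hr1⟩ => ⟨?_, ?_⟩
  · calc (⌈r ^ (-u)⌉₊ : ℝ) ^ N * volume.real (Metric.thickening (A * r) K)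
        ≤ (2 * r ^ (-u)) ^ N * (B * r ^ (d - α')) := by
          gcongr
          exact natCeil_rpow_neg_le hr0 hr1.le hu.le
      _ = 2 ^ N * B * r ^ (d - α') / r ^ (N * u) := by
          rw [mul_pow, ← Real.rpow_natCast (r ^ (-u)), ← Real.rpow_mul hr0.le, neg_mul, mul_comm u,
            Real.rpow_neg hr0.le]
          ring
      _ ≤ 1 / 2 := (div_le_iff₀ (Real.rpow_pos_of_pos hr0 _)).mpr hcount.le
  · calc L * volume.real (Metric.thickening (A * r) K) ≤ L * (B * r ^ (d - α')) := by gcongr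
      _ ≤ r ^ (l / 2) / 4 := by linarith

theorem fourierApproximable_separatedSolutionFree (hN : 1 ≤ N) (hNβ : N * β ≤ d - α)
    (hK : lowerMinkowskiDim K ≤ α) {a : ℤ} (ha : a ≠ 0) {w : Fin N → ℤ}
    (hw : ∑ j, w j ≠ 0 ∨ w = 0) (c : Torus d) {ρ : ℝ} (hρ : 0 < ρ) :
    FourierApproximable d β (separatedSolutionFree K a w c ρ) := by
  refine fourierApproximable_of_isSampleWeight (Q := Metric.closedBall c (2 * ρ))
    Metric.isClosed_closedBall.measurableSet (D := 2 * N) ?_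
  intro u hu huβ l hlu L hL
  have hNu : N * u < d - α := (mul_lt_mul_of_pos_left huβ (by positivity)).trans_le hNβ
  set A : ℝ := |(a : ℝ)| + ∑ j, |(w j : ℝ)| + 1
  refine ((frequently_pow_mul_measureReal_thickening_le hN hu hlu hNu hK
    (by positivity : 0 < A * 2) hL).and_eventually (Ioo_mem_nhdsGT (half_pos hρ))).mono
    fun r ⟨⟨hsmall, hmass⟩, hr0, hrρ⟩ => ?_
  have hM : 1 ≤ ⌈r ^ (-u)⌉₊ := Nat.one_le_ceil_iff.mpr (Real.rpow_pos_of_pos hr0 _)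
  obtain ⟨q, hq, hqbad⟩ := exists_isSampleWeight_ne_zero_imp_notMem_badSet hM ha
    Metric.isOpen_thickening hw hsmall
  refine ⟨_, Nat.le_ceil _, q, _, hq, hmass, fun X => ?_⟩
  refine thickening_sampleCarrier_mem_separatedSolutionFree (by positivity) (by linarith)
    fun x hx => ?_
  rw [← mul_assoc]
  exact hqbad X x hx

end SeparatedSolutions

section Generic

variable {d : ℕ} {β : ℝ}

theorem SupportPair.eventually_residual_of_fourierApproximable (hd : 1 ≤ d) (hβ : 0 < β)
    (hβd : β ≤ d) {𝒰 : Set (Set (Torus d))} (h𝒰 : ∀ U ∈ 𝒰, IsOpen U)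
    (h : FourierApproximable d β 𝒰) :
    ∀ᶠ p in residual (SupportPair d β), ∃ U ∈ 𝒰, (p.set : Set (Torus d)) ⊆ U :=
  residual_of_dense_open (SupportPair.isOpen_setOf_exists_subset h𝒰)
    (SupportPair.dense_of_fourierApproximable hd hβ hβd h)

theorem SupportPair.isSalem_of_dimH_le (hβd : β ≤ d) (p : SupportPair d β)
    (h : dimH (p.set : Set (Torus d)) ≤ ENNReal.ofReal β) :
    IsSalem (p.set : Set (Torus d)) ∧ dimH (p.set : Set (Torus d)) = ENNReal.ofReal β := by
  have hdim := fourierDim_le_dimH (p.set : Set (Torus d))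
  have hβ := le_fourierDim hβd p.measure p.support_subset p.decay
  exact ⟨le_antisymm hdim (h.trans hβ), le_antisymm h (hβ.trans hdim)⟩

theorem SupportPair.eventually_residual_isSalem (hd : 1 ≤ d) (hβ : 0 < β) (hβd : β ≤ d) :
    ∀ᶠ p in residual (SupportPair d β), IsSalem (p.set : Set (Torus d)) ∧
      dimH (p.set : Set (Torus d)) = ENNReal.ofReal β := by
  have h : ∀ᶠ p in residual (SupportPair d β), ∀ j k : ℕ,
      ∃ U ∈ efficientlyCovered (Torus d) (β + 1 / (j + 1 : ℝ)) (1 / (k + 1 : ℝ)),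
        (p.set : Set (Torus d)) ⊆ U :=
    eventually_countable_forall.mpr fun j => eventually_countable_forall.mpr fun k =>
      SupportPair.eventually_residual_of_fourierApproximable hd hβ hβd (fun U hU => hU.1)
        (fourierApproximable_efficientlyCovered (lt_add_of_pos_right _ (by positivity))
          (by positivity))
  exact h.mono fun p hp => p.isSalem_of_dimH_le hβd (dimH_le_of_efficientlyCovered hβ.le hp)

theorem SupportPair.eventually_residual_avoidsLinear {N : ℕ} {α : ℝ} (hd : 1 ≤ d) (hN : 1 ≤ N)
    (hβ : 0 < β) (hβd : β ≤ d) (hNβ : N * β ≤ d - α) {C : Set (Set (Torus d))} (hC : C.Countable)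
    (hCα : ∀ K ∈ C, lowerMinkowskiDim K ≤ α) :
    ∀ᶠ p in residual (SupportPair d β),
      AvoidsLinear (N + 1) (⋃₀ C) (p.set : Set (Torus d)) := by
  obtain ⟨D, hDc, hD⟩ := exists_countable_dense (Torus d)
  have : Countable C := hC.to_subtype
  have : Countable D := hDc.to_subtype
  have h : ∀ᶠ p in residual (SupportPair d β), ∀ (K : C) (m : Fin (N + 1) → ℤ) (i : Fin (N + 1)),
      m i ≠ 0 → (∑ j, m (i.succAbove j) ≠ 0 ∨ (fun j => m (i.succAbove j)) = 0) →
      ∀ (c : D) (k : ℕ), ∃ U ∈ separatedSolutionFree (K : Set (Torus d)) (m i)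
        (fun j => m (i.succAbove j)) c (1 / (k + 1 : ℝ)), (p.set : Set (Torus d)) ⊆ U := by
    simp only [eventually_countable_forall]
    exact fun K m i hi hw c k =>
      SupportPair.eventually_residual_of_fourierApproximable hd hβ hβd (fun U hU => hU.1)
        (fourierApproximable_separatedSolutionFree hN hNβ (hCα K K.2) hi hw c (by positivity))
  refine h.mono fun p hp => ?_
  rintro s ⟨K, hK, hsK⟩ x hx hxE m hm rfl
  exact sum_zsmul_notMem_of_separatedSolutionFree hD
    (fun m i hi hw c hc k => hp ⟨K, hK⟩ m i hi hw ⟨c, hc⟩ k) hx hxE hm hsK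

theorem SupportPair.nonempty (hd : 1 ≤ d) (hβd : β ≤ d) : Nonempty (SupportPair d β) := by
  obtain ⟨C, hC, hmollifier⟩ := exists_mollifier hd
  obtain ⟨φ, hφ, -⟩ := hmollifier (1 / 2) (by norm_num) le_rfl
  have := hφ.isProbabilityMeasure
  exact ⟨SupportPair.ofMeasure φ fun s hs =>
    hφ.hasFourierDecay hC (by norm_num) hs.1 (by linarith [hs.2])⟩

theorem SupportPair.eventually_residual_isSalem_and_avoidsLinear {N : ℕ} {α : ℝ} (hd : 1 ≤ d)
    (hN : 1 ≤ N) (hβ : 0 < β) (hβd : β ≤ d) (hNβ : N * β ≤ d - α) {C : Set (Set (Torus d))}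
    (hC : C.Countable) (hCα : ∀ K ∈ C, lowerMinkowskiDim K ≤ α) :
    ∀ᶠ p in residual (SupportPair d β), IsSalem (p.set : Set (Torus d)) ∧
      dimH (p.set : Set (Torus d)) = ENNReal.ofReal β ∧
      AvoidsLinear (N + 1) (⋃₀ C) (p.set : Set (Torus d)) := by
  filter_upwards [SupportPair.eventually_residual_isSalem hd hβ hβd,
    SupportPair.eventually_residual_avoidsLinear hd hN hβ hβd hNβ hC hCα] with p hp havoid
  exact ⟨hp.1, hp.2, havoid⟩

theorem SupportPair.exists_of_eventually_residual (hd : 1 ≤ d) (hβ : 0 < β) (hβd : β ≤ d)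
    {q : SupportPair d β → Prop} (h : ∀ᶠ p in residual (SupportPair d β), q p) : ∃ p, q p := by
  have := SupportPair.baireSpace (d := d) hβ
  have := SupportPair.nonempty hd hβd
  exact (dense_of_mem_residual h).nonempty

end Generic

theorem mainTheorem4_general (d n : ℕ) (hn : 2 ≤ n) {α : ℝ} (hα : 0 ≤ α) (hαd : α < d)
    {C : Set (Set (Torus d))} (hC : C.Countable) (hCα : ∀ K ∈ C, lowerMinkowskiDim K ≤ α) :
    (∃ E : Set (Torus d), IsCompact E ∧ IsSalem E ∧
      dimH E = ENNReal.ofReal ((d - α) / ((n : ℝ) - 1)) ∧ AvoidsLinear n (⋃₀ C) E) ∧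
    ∀ β : ℝ, 0 < β → β ≤ (d - α) / ((n : ℝ) - 1) →
      ∀ᶠ p in residual (SupportPair d β),
        IsSalem (p.set : Set (Torus d)) ∧
        dimH (p.set : Set (Torus d)) = ENNReal.ofReal β ∧
        AvoidsLinear n (⋃₀ C) (p.set : Set (Torus d)) := by
  have hd : 1 ≤ d := by exact_mod_cast hα.trans_lt hαd
  obtain ⟨N, rfl⟩ : ∃ N, n = N + 1 := ⟨n - 1, by omega⟩
  have hN : 1 ≤ N := by omega
  have hN1 : (1 : ℝ) ≤ N := by exact_mod_cast hN
  rw [show ((N + 1 : ℕ) : ℝ) - 1 = N by push_cast; ring]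
  have hle {β : ℝ} (hβ : β ≤ (d - α) / N) : β ≤ d := by
    linarith [div_le_self (sub_pos.mpr hαd).le hN1]
  have hgeneric (β : ℝ) (hβ : 0 < β) (hβN : β ≤ (d - α) / N) :=
    SupportPair.eventually_residual_isSalem_and_avoidsLinear hd hN hβ (hle hβN)
      ((le_div_iff₀' (by linarith)).mp hβN) hC hCα
  have hpos : 0 < (d - α) / N := div_pos (sub_pos.mpr hαd) (by linarith)
  obtain ⟨p, hp⟩ :=
    SupportPair.exists_of_eventually_residual hd hpos (hle le_rfl) (hgeneric _ hpos le_rfl)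
  exact ⟨⟨p.set, p.set.isCompact, hp⟩, hgeneric⟩

theorem mainTheorem4 (d n : ℕ) (hd : 1 ≤ d) (hn : 2 ≤ n) (S : Set (Torus d))
    (hS : ∃ C : Set (Set (Torus d)), C.Countable ∧
      (∀ K ∈ C, IsCompact K ∧ lowerMinkowskiDim K = 0) ∧ S = ⋃₀ C) :
    (∃ E : Set (Torus d), IsCompact E ∧ IsSalem E ∧
      dimH E = ENNReal.ofReal ((d : ℝ) / ((n : ℝ) - 1)) ∧ AvoidsLinear n S E) ∧
    ∀ β : ℝ, 0 < β → β ≤ (d : ℝ) / ((n : ℝ) - 1) →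
      ∀ᶠ p in residual (SupportPair d β),
        IsSalem (p.set : Set (Torus d)) ∧
        dimH (p.set : Set (Torus d)) = ENNReal.ofReal β ∧
        AvoidsLinear n S (p.set : Set (Torus d)) := by
  obtain ⟨C, hC, hCK, rfl⟩ := hS
  simpa only [sub_zero] using mainTheorem4_general d n hn le_rfl (by exact_mod_cast hd) hC
    fun K hK => (hCK K hK).2.le
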